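/- **Structures.** Let $\omega=\{0,1,2,\dots\}$, $E_2=\{0,1\}$, and let $x_0,x_1,\dots$ be variables. A structure is a triple $U=(A,F,P)$ where $A$ is a nonempty set, $F$ is a set of functions $f:A^n\to A$ ($n\ge 0$), $P$ is a nonempty set of predicates $p:A^n\to E_2$ ($n\ge 1$), and $F\cap P=\emptyset$. Expressions over $U$ are functional expressions $x_j\Leftarrow f(x_{l_1},\dots,x_{l_r})$ with $f\in F$ and predicate expressions $p(x_{q_1},\dots,x_{q_k})$ with $p\in P$. Let $Y$ be a finite nonempty set of $n$ variables and $\beta$ a finite sequence of expressions containing exactly $r$ predicate expressions. For $\bar a\in A^n$ (values of the variables in $Y$), execute $\beta$ starting with the values $\bar a$ for the variables in $Y$, every other variable having initially the value of the variable of $Y$ with the least index; let $\alpha_1(\bar a),\dots,\alpha_r(\bar a)\in E_2$ be the values of the predicate expressions, in order. **Problems.** A problem is a tuple $z=(Y,\nu,\beta_1,\dots,\beta_m)$ with $Y$ a finite nonempty set of variables (the input variables) and $\beta(z)=\beta_1,\dots,\beta_m$ expressions over $U$ of which exactly $r\ge1$ are predicate expressions, where $\nu$ maps $E_2^r$ to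 the nonempty finite subsets of $\omega$. Put $z(\bar a)=\nu(\alpha_1(\bar a),\dots,\alpha_r(\bar a))$. Let $\mathcal P(U,n)$ be the set of problems with $n$ input variables. **Computation trees.** A computation tree is a pair $\Gamma=(Y,G)$ with $Y$ a finite nonempty set of variables and $G$ a finite directed rooted tree with at least two nodes. The root and the edges leaving it are unlabeled; each terminal node is labeled with a number from $\omega$; every other node is labeled with a functional expression (edges leaving it are unlabeled) or with a predicate expression (edges leaving it are labeled with numbers from $E_2$). It is deterministic if the root and every functional node have exactly one leaving edge and edges leaving the same predicate node have different labels. For a complete path $\xi$ (from the root to a terminal node), $\beta(\xi)$ is its sequence of expressions, $\kappa(\xi)$ the label of its terminal node, and $\mathcal A(\xi)\subseteq A^n$ ($n=|Y|$) the set of $\bar a$ for which the values of the predicate expressions of $\beta(\xi)$ equal the labels of the corresponding edges of $\xi$. The tree $\Gamma$ solves $z$ nondeterministically if both have the same set of input variables, $\bigcup_\xi\mathcal A(\xi)=A^n$, and $\kappa(\xi)\in z(\bar a)$ whenever $\bar a\in\mathcal A(\xi)$; it solves $z$ deterministically if moreover $\Gamma$ is deterministic. **Measures.** A complexity measure over $U$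 is a map $\psi:(F\cup P)^*\to\omega$ on finite words. A pair $(U,\psi)$ is called an sm-pair. It is called limited if for all words $\psi(\alpha_1\alpha_2)\le\psi(\alpha_1)+\psi(\alpha_2)$, $\psi(\alpha_1\alpha_2\alpha_3)\ge\psi(\alpha_1\alpha_3)$, and $\psi(\alpha)\ge|\alpha|$. A weighted depth is a measure $\psi(b_1\cdots b_m)=\sum_{i}w(b_i)$ (zero on the empty word) for some $w:F\cup P\to\omega\setminus\{0\}$. For a sequence $\beta$ of expressions, $\psi(\beta)$ is the value of $\psi$ on the word of its function and predicate symbols; $\psi(\Gamma)$ is the maximum of $\psi(\beta(\xi))$ over the complete paths $\xi$ of $\Gamma$. For a problem $z$ put $\psi^i(z)=\psi(\beta(z))$, and let $\psi^d(z)$ (respectively $\psi^a(z)$) be the minimum of $\psi(\Gamma)$ over the computation trees $\Gamma$ that solve $z$ deterministically (respectively nondeterministically). **Types.** For $n\ge1$ and $b,c\in\{i,d,a\}$ define partial functions $\omega\to\omega$ $$\mathcal U_n^{bc}(m)=\max\{\psi^b(z):z\in\mathcal P(U,n),\psi^c(z)\le m\},\qquad \mathcal L_n^{bc}(m)=\min\{\psi^b(z):z\in\mathcal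 P(U,n),\psi^c(z)\ge m\},$$ defined exactly where the maximum (minimum) exists. For a partial function $g$, let $Dom^+(g)$ and $Dom^-(g)$ be the sets of $m$ in its domain $Dom(g)$ with $g(m)\ge m$, respectively $g(m)\le m$. The type of $g$ is: $\alpha$ if $Dom(g)$ is infinite and $g$ is bounded from above; $\beta$ if $Dom(g)$ is infinite, $Dom^+(g)$ is finite and $g$ is unbounded from above; $\gamma$ if $Dom^+(g)$ and $Dom^-(g)$ are infinite; $\delta$ if $Dom(g)$ is infinite and $Dom^-(g)$ is finite; $\varepsilon$ if $Dom(g)$ is finite. The $n$-type of $(U,\psi)$ is the $3\times3$ table whose entry in row $b$ and column $c$ (ordered $i,d,a$) is the pair of types of $\mathcal L_n^{bc}$ and $\mathcal U_n^{bc}$, in this order; the dynamic type of $(U,\psi)$ is the infinite sequence of its $1$-type, $2$-type, $3$-type, and so on. Consider the tables $$T_1=\begin{pmatrix}\varepsilon\alpha&\varepsilon\alpha&\varepsilon\alpha\\ \varepsilon\alpha&\varepsilon\alpha&\varepsilon\alpha\\ \varepsilon\alpha&\varepsilon\alpha&\varepsilon\alpha\end{pmatrix},\quad T_2=\begin{pmatrix}\gamma\gamma&\varepsilon\varepsilon&\varepsilon\varepsilon\\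 \alpha\alpha&\varepsilon\alpha&\varepsilon\alpha\\ \alpha\alpha&\varepsilon\alpha&\varepsilon\alpha\end{pmatrix},\quad T_3=\begin{pmatrix}\gamma\gamma&\delta\varepsilon&\varepsilon\varepsilon\\ \alpha\beta&\gamma\gamma&\varepsilon\varepsilon\\ \alpha\alpha&\alpha\alpha&\varepsilon\alpha\end{pmatrix},\quad T_4=\begin{pmatrix}\gamma\gamma&\gamma\varepsilon&\varepsilon\varepsilon\\ \alpha\gamma&\gamma\gamma&\varepsilon\varepsilon\\ \alpha\alpha&\alpha\alpha&\varepsilon\alpha\end{pmatrix},$$ $$T_5=\begin{pmatrix}\gamma\gamma&\gamma\varepsilon&\gamma\varepsilon\\ \alpha\gamma&\gamma\gamma&\gamma\gamma\\ \alpha\gamma&\gamma\gamma&\gamma\gamma\end{pmatrix},\quad T_6=\begin{pmatrix}\gamma\gamma&\gamma\varepsilon&\gamma\varepsilon\\ \alpha\gamma&\gamma\gamma&\gamma\delta\\ \alpha\gamma&\beta\gamma&\gamma\gamma\end{pmatrix},\quad T_7=\begin{pmatrix}\gamma\gamma&\gamma\varepsilon&\gamma\varepsilon\\ \alpha\gamma&\gamma\gamma&\gamma\varepsilon\\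 \alpha\gamma&\alpha\gamma&\gamma\gamma\end{pmatrix},$$ and the set of infinite sequences $$\Delta=\{T_2^\infty,\;T_2^iT_3^\infty,\;T_2^iT_3^jT_4^\infty,\;T_2^iT_3^jT_4^kT_7^\infty,\;T_2^iT_5^\infty,\;T_2^iT_5^jT_6^\infty,\;T_2^iT_5^jT_6^kT_7^\infty\;:\;i,j,k\in\omega\},$$ where $T^i$ is $T$ repeated $i$ times (empty if $i=0$) and $T^\infty$ is $TTT\cdots$. **Theorem.** For every limited sm-pair $(U,\psi)$, the dynamic type of $(U,\psi)$ belongs to $\Delta$; in particular, no $n$-type of $(U,\psi)$ equals $T_1$. Conversely, for every sequence $\sigma\in\Delta$ there exists a limited sm-pair $(U,\psi)$ such that $\psi$ is a weighted depth and the dynamic type of $(U,\psi)$ is $\sigma$. -/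

import Mathlib

universe u

namespace CompTrees

/-- A structure `U = (A, F, P)`: a nonempty set `A`, a set `F` of finitary functions
`A ^ n → A` (`n ≥ 0`), and a nonempty set `P` of finitary predicates `A ^ n → E₂` (`n ≥ 1`).
Here `E₂ = {0, 1}` is `Bool`, with `false` for `0` and `true` for `1`. -/
structure Structure where
  A : Type u
  nonempty_A : Nonempty A
  F : Set (Σ n : ℕ, (Fin n → A) → A)
  P : Set (Σ n : ℕ, (Fin n → A) → Bool)
  nonempty_P : P.Nonempty
  arity_pos : ∀ p ∈ P, 0 < p.1

/-- The alphabet `F ∪ P` (a disjoint union). -/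
abbrev Symb (U : Structure.{u}) : Type u := U.F ⊕ U.P

/-- Functional expressions `x_j ⇐ f(x_{l_1}, …, x_{l_r})` and predicate expressions
`p(x_{q_1}, …, x_{q_k})`; the variable `x_j` is represented by its index `j`. -/
inductive Expr (U : Structure.{u}) : Type u
  | func (j : ℕ) (f : U.F) (l : Fin f.1.1 → ℕ) : Expr U
  | pred (p : U.P) (q : Fin p.1.1 → ℕ) : Expr U

/-- The symbol of `F ∪ P` occurring in an expression. -/
def Expr.symb {U : Structure.{u}} : Expr U → Symb U
  | .func _ f _ => Sum.inl f
  | .pred p _ => Sum.inr p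

/-- The number of predicate expressions in a sequence of expressions. -/
def predCount {U : Structure.{u}} : List (Expr U) → ℕ
  | [] => 0
  | .func _ _ _ :: β => predCount β
  | .pred _ _ :: β => predCount β + 1

/-- Finite nonempty sets of (indices of) variables. -/
abbrev Vars : Type := {Y : Finset ℕ // Y.Nonempty}

/-- Tuples of elements of `A` indexed by the `n` variables in `Y`; this is `A ^ n`. -/
abbrev Input (U : Structure.{u}) (Y : Vars) : Type u := Y.1 → U.A

/-- The initial values of all variables: `x_j` itself for `x_j ∈ Y`, and the value of the
variable of `Y` with the minimum index for `x_j ∉ Y`. -/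
def initVal {U : Structure.{u}} (Y : Vars) (a : Input U Y) : ℕ → U.A := fun j =>
  if h : j ∈ Y.1 then a ⟨j, h⟩ else a ⟨Y.1.min' Y.2, Y.1.min'_mem Y.2⟩

/-- The values of the predicate expressions of a sequence, in order, when the sequence is
executed starting from the values `s` of the variables. -/
def predVals {U : Structure.{u}} : List (Expr U) → (ℕ → U.A) → List Bool
  | [], _ => []
  | .func j f l :: β, s => predVals β (Function.update s j (f.1.2 fun i => s (l i)))
  | .pred p q :: β, s => p.1.2 (fun i => s (q i)) :: predVals β s

theorem length_predVals {U : Structure.{u}} (β : List (Expr U)) (s : ℕ → U.A) :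
    (predVals β s).length = predCount β := by
  induction β generalizing s with
  | nil => rfl
  | cons e β ih => cases e <;> simp [predVals, predCount, ih]

/-- The tuple `Π(Y, β)(ā) = (α_1(ā), …, α_r(ā))`. -/
def PiTuple {U : Structure.{u}} (Y : Vars) (β : List (Expr U)) (a : Input U Y) :
    List.Vector Bool (predCount β) :=
  ⟨predVals β (initVal Y a), length_predVals β _⟩

/-! ### Computation trees -/

/-- The part of a computation tree that hangs on a node different from the root: a terminal
node labeled with a number, a functional node, or a predicate node. Working nodes have `k + 1`
leaving edges; the edges leaving a predicate node carry labels `δ i ∈ E₂`. -/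
inductive Node (U : Structure.{u}) : Type u
  | term (κ : ℕ) : Node U
  | func (j : ℕ) (f : U.F) (l : Fin f.1.1 → ℕ) (k : ℕ) (child : Fin (k + 1) → Node U) : Node U
  | pred (p : U.P) (q : Fin p.1.1 → ℕ) (k : ℕ) (δ : Fin (k + 1) → Bool)
      (child : Fin (k + 1) → Node U) : Node U

/-- A computation tree `Γ = (Y, G)`: the set of input variables and the `k + 1` subtrees
entered by the (unlabeled) edges leaving the root. -/
structure CompTree (U : Structure.{u}) : Type u where
  Y : Vars
  k : ℕ
  child : Fin (k + 1) → Node U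

/-- Every functional node has exactly one leaving edge, and edges leaving the same predicate
node have pairwise different labels. -/
def Node.Deterministic {U : Structure.{u}} : Node U → Prop
  | .term _ => True
  | .func _ _ _ k child => k = 0 ∧ ∀ i, (child i).Deterministic
  | .pred _ _ _ δ child => Function.Injective δ ∧ ∀ i, (child i).Deterministic

/-- Deterministic computation trees. -/
def CompTree.Deterministic {U : Structure.{u}} (Γ : CompTree U) : Prop :=
  Γ.k = 0 ∧ ∀ i, (Γ.child i).Deterministic

/-- Paths from a node to a terminal node. -/
def Node.Path {U : Structure.{u}} : Node U → Type
  | .term _ => Unit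
  | .func _ _ _ k child => (i : Fin (k + 1)) × (child i).Path
  | .pred _ _ k _ child => (i : Fin (k + 1)) × (child i).Path

/-- The sequence of expressions along a path. -/
def Node.exprs {U : Structure.{u}} : (v : Node U) → v.Path → List (Expr U)
  | .term _, _ => []
  | .func j f l _ child, ⟨i, ξ⟩ => .func j f l :: (child i).exprs ξ
  | .pred p q _ _ child, ⟨i, ξ⟩ => .pred p q :: (child i).exprs ξ

/-- The labels of the edges of a path that leave predicate nodes, in order. -/
def Node.labels {U : Structure.{u}} : (v : Node U) → v.Path → List Bool
  | .term _, _ => []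
  | .func _ _ _ _ child, ⟨i, ξ⟩ => (child i).labels ξ
  | .pred _ _ _ δ child, ⟨i, ξ⟩ => δ i :: (child i).labels ξ

/-- The number at the end of a path. -/
def Node.result {U : Structure.{u}} : (v : Node U) → v.Path → ℕ
  | .term κ, _ => κ
  | .func _ _ _ _ child, ⟨i, ξ⟩ => (child i).result ξ
  | .pred _ _ _ _ child, ⟨i, ξ⟩ => (child i).result ξ

/-- The complete paths of a computation tree. -/
abbrev CompTree.Path {U : Structure.{u}} (Γ : CompTree U) : Type :=
  (i : Fin (Γ.k + 1)) × (Γ.child i).Path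

/-- `β(ξ)` -/
def CompTree.exprs {U : Structure.{u}} (Γ : CompTree U) (ξ : Γ.Path) : List (Expr U) :=
  (Γ.child ξ.1).exprs ξ.2

/-- `(δ_1, …, δ_r)` -/
def CompTree.labels {U : Structure.{u}} (Γ : CompTree U) (ξ : Γ.Path) : List Bool :=
  (Γ.child ξ.1).labels ξ.2

/-- `κ(ξ)` -/
def CompTree.result {U : Structure.{u}} (Γ : CompTree U) (ξ : Γ.Path) : ℕ :=
  (Γ.child ξ.1).result ξ.2

/-- The set `𝒜(ξ)` of all inputs `ā` with `α_1(ā) = δ_1, …, α_r(ā) = δ_r`, for the set `Y` of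
input variables. -/
def CompTree.region {U : Structure.{u}} (Γ : CompTree U) (Y : Vars) (ξ : Γ.Path) :
    Set (Input U Y) :=
  {a | (PiTuple Y (Γ.exprs ξ) a).toList = Γ.labels ξ}

instance Node.finite_path {U : Structure.{u}} (v : Node U) : Finite v.Path := by
  induction v with
  | term κ => exact inferInstanceAs (Finite Unit)
  | func j f l k child ih => exact inferInstanceAs (Finite ((i : Fin (k + 1)) × (child i).Path))
  | pred p q k δ child ih => exact inferInstanceAs (Finite ((i : Fin (k + 1)) × (child i).Path))

instance Node.nonempty_path {U : Structure.{u}} (v : Node U) : Nonempty v.Path := by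
  induction v with
  | term κ => exact ⟨()⟩
  | func j f l k child ih => exact (ih 0).elim fun ξ => ⟨⟨0, ξ⟩⟩
  | pred p q k δ child ih => exact (ih 0).elim fun ξ => ⟨⟨0, ξ⟩⟩

/-! ### Problems -/

/-- A problem `z = (Y, ν, β_1, …, β_m)`, where `β_1, …, β_m` contain exactly `r ≥ 1` predicate
expressions and `ν` maps `E₂ ^ r` to the nonempty finite subsets of `ω`. -/
structure Problem (U : Structure.{u}) : Type u where
  Y : Vars
  β : List (Expr U)
  predCount_pos : 0 < predCount β
  ν : List.Vector Bool (predCount β) → {S : Finset ℕ // S.Nonempty}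

/-- The set `z(ā) = ν(α_1(ā), …, α_r(ā))` of solutions for the input `ā`. -/
def Problem.solutions {U : Structure.{u}} (z : Problem U) (a : Input U z.Y) : Finset ℕ :=
  (z.ν (PiTuple z.Y z.β a)).1

/-- `Γ` solves `z` nondeterministically. -/
def CompTree.SolvesN {U : Structure.{u}} (Γ : CompTree U) (z : Problem U) : Prop :=
  Γ.Y = z.Y ∧ (⋃ ξ : Γ.Path, Γ.region z.Y ξ) = Set.univ ∧
    ∀ (a : Input U z.Y) (ξ : Γ.Path), a ∈ Γ.region z.Y ξ → Γ.result ξ ∈ z.solutions a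

/-- `Γ` solves `z` deterministically. -/
def CompTree.SolvesD {U : Structure.{u}} (Γ : CompTree U) (z : Problem U) : Prop :=
  Γ.Deterministic ∧ Γ.SolvesN z

/-! ### Complexity measures -/

/-- Complexity measures: arbitrary maps `(F ∪ P)^* → ω`. -/
abbrev Measure (U : Structure.{u}) : Type u := List (Symb U) → ℕ

/-- Limited complexity measures. -/
structure Measure.Limited {U : Structure.{u}} (ψ : Measure U) : Prop where
  subadditive : ∀ α₁ α₂ : List (Symb U), ψ (α₁ ++ α₂) ≤ ψ α₁ + ψ α₂
  deletion : ∀ α₁ α₂ α₃ : List (Symb U), ψ (α₁ ++ α₃) ≤ ψ (α₁ ++ α₂ ++ α₃)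
  length_le : ∀ α : List (Symb U), α.length ≤ ψ α

/-- Weighted depths `ψ^w`, `w : F ∪ P → ω \ {0}`. -/
def Measure.IsWeightedDepth {U : Structure.{u}} (ψ : Measure U) : Prop :=
  ∃ w : Symb U → ℕ, (∀ b, 0 < w b) ∧ ∀ α, ψ α = (α.map w).sum

/-- The measure of a sequence of expressions. -/
def Measure.ofExprs {U : Structure.{u}} (ψ : Measure U) (β : List (Expr U)) : ℕ :=
  ψ (β.map Expr.symb)

/-- `ψ(Γ)`: the maximum of `ψ(β(ξ))` over the (finite nonempty set of) complete paths `ξ`. -/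
noncomputable def Measure.ofTree {U : Structure.{u}} (ψ : Measure U) (Γ : CompTree U) : ℕ :=
  ⨆ ξ : Γ.Path, ψ.ofExprs (Γ.exprs ξ)

/-- The three parameters of a problem: `i` (description), `d` (deterministic),
`a` (nondeterministic). -/
inductive Param
  | i | d | a

/-- `ψ_U^i(z)`, `ψ_U^d(z)` and `ψ_U^a(z)`. The minima are over nonempty sets, see
`exists_solvesD` below. -/
noncomputable def Measure.param {U : Structure.{u}} (ψ : Measure U) : Param → Problem U → ℕ
  | .i, z => ψ.ofExprs z.β
  | .d, z => sInf {c | ∃ Γ : CompTree U, Γ.SolvesD z ∧ ψ.ofTree Γ = c}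
  | .a, z => sInf {c | ∃ Γ : CompTree U, Γ.SolvesN z ∧ ψ.ofTree Γ = c}

/-- The tree that executes `β` and then outputs a number depending on the predicate values. -/
def Node.follow {U : Structure.{u}} : List (Expr U) → (List Bool → ℕ) → Node U
  | [], g => .term (g [])
  | .func j f l :: β, g => .func j f l 0 fun _ => Node.follow β g
  | .pred p q :: β, g => .pred p q 1 (fun i => decide (i = 1)) fun i =>
      Node.follow β fun t => g (decide (i = 1) :: t)

theorem Node.follow_deterministic {U : Structure.{u}} (β : List (Expr U)) (g : List Bool → ℕ) :
    (Node.follow β g).Deterministic := by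
  induction β generalizing g with
  | nil => trivial
  | cons e β ih =>
    cases e with
    | func j f l => exact ⟨rfl, fun _ => ih g⟩
    | pred p q => exact ⟨by decide, fun _ => ih _⟩

theorem Node.follow_path {U : Structure.{u}} (β : List (Expr U)) (g : List Bool → ℕ)
    (ξ : (Node.follow β g).Path) :
    (Node.follow β g).exprs ξ = β ∧
      (Node.follow β g).result ξ = g ((Node.follow β g).labels ξ) := by
  induction β generalizing g with
  | nil => exact ⟨rfl, rfl⟩
  | cons e β ih =>
    cases e with
    | func j f l =>
      obtain ⟨i, ξ⟩ := ξ
      exact ⟨congrArg _ (ih g ξ).1, (ih g ξ).2⟩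
    | pred p q =>
      obtain ⟨i, ξ⟩ := ξ
      exact ⟨congrArg _ (ih _ ξ).1, (ih _ ξ).2⟩

theorem Node.follow_exists {U : Structure.{u}} (β : List (Expr U)) (g : List Bool → ℕ)
    (t : List Bool) (ht : t.length = predCount β) :
    ∃ ξ : (Node.follow β g).Path, (Node.follow β g).labels ξ = t := by
  induction β generalizing g t with
  | nil => exact ⟨(), (List.length_eq_zero_iff.mp ht).symm⟩
  | cons e β ih =>
    cases e with
    | func j f l =>
      obtain ⟨ξ, h⟩ := ih g t ht
      exact ⟨⟨0, ξ⟩, h⟩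
    | pred p q =>
      cases t with
      | nil => simp [predCount] at ht
      | cons b t =>
        have ht' : t.length = predCount β := by simpa [predCount] using ht
        cases b with
        | false =>
          obtain ⟨ξ, h⟩ := ih (fun t => g (decide ((0 : Fin 2) = 1) :: t)) t ht'
          exact ⟨⟨0, ξ⟩, congrArg (List.cons false) h⟩
        | true =>
          obtain ⟨ξ, h⟩ := ih (fun t => g (decide ((1 : Fin 2) = 1) :: t)) t ht'
          exact ⟨⟨1, ξ⟩, congrArg (List.cons true) h⟩

/-- Every problem is solved deterministically by some computation tree. -/
theorem exists_solvesD {U : Structure.{u}} (z : Problem U) : ∃ Γ : CompTree U, Γ.SolvesD z := by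
  let g : List Bool → ℕ := fun t =>
    if h : t.length = predCount z.β then (z.ν ⟨t, h⟩).1.min' (z.ν ⟨t, h⟩).2 else 0
  refine ⟨⟨z.Y, 0, fun _ => Node.follow z.β g⟩, ⟨rfl, fun _ => Node.follow_deterministic _ _⟩,
    rfl, ?_, ?_⟩
  · refine Set.eq_univ_of_forall fun a => Set.mem_iUnion.mpr ?_
    obtain ⟨ξ, h⟩ := Node.follow_exists z.β g (predVals z.β (initVal z.Y a)) (length_predVals _ _)
    refine ⟨⟨0, ξ⟩, ?_⟩
    change predVals ((Node.follow z.β g).exprs ξ) _ = (Node.follow z.β g).labels ξ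
    rw [(Node.follow_path z.β g ξ).1, h]
  · rintro a ⟨i, ξ⟩ h
    change predVals ((Node.follow z.β g).exprs ξ) _ = (Node.follow z.β g).labels ξ at h
    change (Node.follow z.β g).result ξ ∈ _
    rw [(Node.follow_path z.β g ξ).2, ← h, (Node.follow_path z.β g ξ).1]
    simp only [g, length_predVals, dif_pos]
    exact Finset.min'_mem _ _

/-! ### Types of partial functions, `n`-types and dynamic types -/

/-- `𝒰^{bc}_{Uψn}(m) = max {ψ^b(z) : z ∈ 𝒫(U, n), ψ^c(z) ≤ m}`, defined whenever this maximum
exists. -/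
noncomputable def upper {U : Structure.{u}} (ψ : Measure U) (n : ℕ) (b c : Param) : ℕ →. ℕ :=
  fun m =>
    ⟨∃ v, IsGreatest {x | ∃ z : Problem U, z.Y.1.card = n ∧ ψ.param c z ≤ m ∧ ψ.param b z = x} v,
      fun h => h.choose⟩

/-- `ℒ^{bc}_{Uψn}(m) = min {ψ^b(z) : z ∈ 𝒫(U, n), ψ^c(z) ≥ m}`, defined whenever this minimum
exists. -/
noncomputable def lower {U : Structure.{u}} (ψ : Measure U) (n : ℕ) (b c : Param) : ℕ →. ℕ :=
  fun m =>
    ⟨∃ v, IsLeast {x | ∃ z : Problem U, z.Y.1.card = n ∧ m ≤ ψ.param c z ∧ ψ.param b z = x} v,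
      fun h => h.choose⟩

/-- The five types of partial functions. -/
inductive FType
  | α | β | γ | δ | ε

/-- `Dom⁺(g) = {n ∈ Dom(g) : g(n) ≥ n}`. -/
def domPlus (g : ℕ →. ℕ) : Set ℕ := {n | ∃ v ∈ g n, n ≤ v}

/-- `Dom⁻(g) = {n ∈ Dom(g) : g(n) ≤ n}`. -/
def domMinus (g : ℕ →. ℕ) : Set ℕ := {n | ∃ v ∈ g n, v ≤ n}

/-- `g` is bounded from above. -/
def IsBdd (g : ℕ →. ℕ) : Prop := ∃ C, ∀ n, ∀ v ∈ g n, v ≤ C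

open Classical in
/-- The type of a partial function; `typ_spec` gives the characterization of the five cases. -/
noncomputable def typ (g : ℕ →. ℕ) : FType :=
  if g.Dom.Finite then .ε
  else if IsBdd g then .α
  else if (domPlus g).Finite then .β
  else if (domMinus g).Finite then .δ
  else .γ

/-- The five clauses defining the type of a partial function. -/
theorem typ_spec (g : ℕ →. ℕ) :
    (typ g = .α ↔ g.Dom.Infinite ∧ IsBdd g) ∧
    (typ g = .β ↔ g.Dom.Infinite ∧ (domPlus g).Finite ∧ ¬ IsBdd g) ∧
    (typ g = .γ ↔ (domPlus g).Infinite ∧ (domMinus g).Infinite) ∧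
    (typ g = .δ ↔ g.Dom.Infinite ∧ (domMinus g).Finite) ∧
    (typ g = .ε ↔ g.Dom.Finite) := by
  have hp : domPlus g ⊆ g.Dom := fun n ⟨v, hv, _⟩ => Part.dom_iff_mem.mpr ⟨v, hv⟩
  have hu : g.Dom ⊆ domPlus g ∪ domMinus g := fun n hn => by
    obtain ⟨v, hv⟩ := Part.dom_iff_mem.mp hn
    rcases le_total n v with h | h
    · exact Or.inl ⟨v, hv, h⟩
    · exact Or.inr ⟨v, hv, h⟩
  have h1 : g.Dom.Finite → (domPlus g).Finite := fun h => h.subset hp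
  have h2 : (domPlus g).Finite → (domMinus g).Finite → g.Dom.Finite :=
    fun h h' => (h.union h').subset hu
  have h3 : IsBdd g → (domPlus g).Finite := fun ⟨C, hC⟩ =>
    (Set.finite_Iic C).subset fun n ⟨v, hv, hnv⟩ => hnv.trans (hC n v hv)
  unfold typ
  simp only [Set.Infinite]
  split_ifs <;> simp <;> tauto

/-- Tables with rows and columns labeled with `i, d, a`; an entry consists of two types. -/
abbrev Table : Type := Param → Param → FType × FType

/-- The table `typ(U, ψ, n)`: the entry in row `b` and column `c` is the pair
`typ(ℒ^{bc}) typ(𝒰^{bc})`. -/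
noncomputable def nType {U : Structure.{u}} (ψ : Measure U) (n : ℕ) : Table :=
  fun b c => (typ (lower ψ n b c), typ (upper ψ n b c))

/-- The dynamic type `typ(U, ψ, 1) typ(U, ψ, 2) ⋯`; the sequence is indexed from `0`, so its
term with index `k` is the `(k + 1)`-type. -/
noncomputable def dtyp {U : Structure.{u}} (ψ : Measure U) : ℕ → Table :=
  fun k => nType ψ (k + 1)

/-- The table with the given rows. -/
def mkTable (ii id ia di dd da ai ad aa : FType × FType) : Table
  | .i, .i => ii
  | .i, .d => id
  | .i, .a => ia
  | .d, .i => di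
  | .d, .d => dd
  | .d, .a => da
  | .a, .i => ai
  | .a, .d => ad
  | .a, .a => aa

open FType in
def T₁ : Table := mkTable
  (ε, α) (ε, α) (ε, α)
  (ε, α) (ε, α) (ε, α)
  (ε, α) (ε, α) (ε, α)

open FType in
def T₂ : Table := mkTable
  (γ, γ) (ε, ε) (ε, ε)
  (α, α) (ε, α) (ε, α)
  (α, α) (ε, α) (ε, α)

open FType in
def T₃ : Table := mkTable
  (γ, γ) (δ, ε) (ε, ε)
  (α, β) (γ, γ) (ε, ε)
  (α, α) (α, α) (ε, α)

open FType in
def T₄ : Table := mkTable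
  (γ, γ) (γ, ε) (ε, ε)
  (α, γ) (γ, γ) (ε, ε)
  (α, α) (α, α) (ε, α)

open FType in
def T₅ : Table := mkTable
  (γ, γ) (γ, ε) (γ, ε)
  (α, γ) (γ, γ) (γ, γ)
  (α, γ) (γ, γ) (γ, γ)

open FType in
def T₆ : Table := mkTable
  (γ, γ) (γ, ε) (γ, ε)
  (α, γ) (γ, γ) (γ, δ)
  (α, γ) (β, γ) (γ, γ)

open FType in
def T₇ : Table := mkTable
  (γ, γ) (γ, ε) (γ, ε)
  (α, γ) (γ, γ) (γ, ε)
  (α, γ) (α, γ) (γ, γ)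

/-- The constant sequence `T^∞`. -/
def rep (T : Table) : ℕ → Table := fun _ => T

/-- The sequence `T^i s`: `i` copies of `T` followed by the sequence `s`. -/
def prep (T : Table) (i : ℕ) (s : ℕ → Table) : ℕ → Table :=
  fun k => if k < i then T else s (k - i)

/-- The set `Δ` of sequences of tables. -/
def Δ : Set (ℕ → Table) :=
  {σ | σ = rep T₂ ∨
    (∃ i, σ = prep T₂ i (rep T₃)) ∨
    (∃ i j, σ = prep T₂ i (prep T₃ j (rep T₄))) ∨
    (∃ i j k, σ = prep T₂ i (prep T₃ j (prep T₄ k (rep T₇)))) ∨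
    (∃ i, σ = prep T₂ i (rep T₅)) ∨
    (∃ i j, σ = prep T₂ i (prep T₅ j (rep T₆))) ∨
    (∃ i j k, σ = prep T₂ i (prep T₅ j (prep T₆ k (rep T₇))))}

end CompTrees

namespace CompTrees

/-! Always `ψ^a ≤ ψ^d ≤ ψ^i`, and problems with a constant answer have arbitrarily long descriptions
but cost at most `ψ []` to solve (`Measure.exists_trivial`). This fixes several entries of every
table. The others depend only on whether `ψ^d` and `ψ^a` are bounded and on the properties
`TightAt`, `SeparatedAt` and `ControlledAt`. The crucial point is that an unbounded `ψ^a` yields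
infinitely many `m` with a problem satisfying `ψ^i = ψ^d = ψ^a = m`
(`Measure.exists_param_i_eq_param_a`): otherwise the paths of cost `m` in an optimal
nondeterministic tree could be replaced by cheaper ones. Six tables remain (`nType_eq_tableOf`).

A dummy input variable changes none of the three parameters (`Measure.exists_succ`). So
unboundedness, tightness and separation persist as the number of variables grows, while control can
only be lost. A bounded `ψ^a` with an unbounded `ψ^d` is already a separation, hence `T₃` and `T₄`
never turn into `T₅` or `T₆`. Sequences obeying these rules lie in `Δ` (`tableOf_comp_mem_Δ`).

For the converse, the models have no functions, and their elements are numbers with tags. A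
predicate with tag `f` holds only on tuples of `M f + 1` distinct elements whose last one has tag
`f` and a number in a prescribed set `S`. With at most `M f` input variables it is constantly false,
so `M f` decides when the tag starts to matter. Each tag contributes one phenomenon: `C`, thresholds
of weight 1: two of them certify a position, but finding it needs unboundedly many queries
(`separatedAt_of_active_C`); asking a middle threshold first always saves a query in a long
description, so there is no tightness (`not_tightAt`). `R`, all finite sets with weight 1: reading
binary digits is tight (`tightAt_of_active_R`). `V`, singletons `{k}` of weight `(k!)^2`: `ψ^a` is
unbounded, but the weights grow so fast that all predicates cheaper than `(K!)^2` together still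
cost less than `(K!)^2`, for large `K` (`controlledAt`). `G`, the two-element subsets of a triple:
one query certifies an answer that no deterministic tree finds at the same cost
(`not_controlledAt_of_active_G`). -/

/-! ### Types of extremal functions of two abstract parameters -/

theorem typ_eq_alpha {g : ℕ →. ℕ} (h : g.Dom.Infinite) (hb : IsBdd g) : typ g = .α :=
  (typ_spec g).1.mpr ⟨h, hb⟩

theorem typ_eq_beta {g : ℕ →. ℕ} (h : g.Dom.Infinite) (hp : (domPlus g).Finite)
    (hb : ¬ IsBdd g) : typ g = .β :=
  (typ_spec g).2.1.mpr ⟨h, hp, hb⟩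

theorem typ_eq_gamma {g : ℕ →. ℕ} (hp : (domPlus g).Infinite) (hm : (domMinus g).Infinite) :
    typ g = .γ :=
  (typ_spec g).2.2.1.mpr ⟨hp, hm⟩

theorem typ_eq_delta {g : ℕ →. ℕ} (h : g.Dom.Infinite) (hm : (domMinus g).Finite) :
    typ g = .δ :=
  (typ_spec g).2.2.2.1.mpr ⟨h, hm⟩

theorem typ_eq_epsilon {g : ℕ →. ℕ} (h : g.Dom.Finite) : typ g = .ε :=
  (typ_spec g).2.2.2.2.mpr h

/-- `g m` is the maximum of `b` on the set `{c ≤ m}`, where it exists. -/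
def IsUpper {Z : Type*} (b c : Z → ℕ) (g : ℕ →. ℕ) : Prop :=
  ∀ m v, v ∈ g m ↔ IsGreatest {x | ∃ z, c z ≤ m ∧ b z = x} v

/-- `g m` is the minimum of `b` on the set `{m ≤ c}`, where it exists. -/
def IsLower {Z : Type*} (b c : Z → ℕ) (g : ℕ →. ℕ) : Prop :=
  ∀ m v, v ∈ g m ↔ IsLeast {x | ∃ z, m ≤ c z ∧ b z = x} v

section Abstract

variable {Z : Type*} {b c : Z → ℕ} {g : ℕ →. ℕ}

theorem IsUpper.exists_mem (h : IsUpper b c g) {m C : ℕ} {z : Z} (hz : c z ≤ m)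
    (hC : ∀ z, c z ≤ m → b z ≤ C) : ∃ v, v ∈ g m := by
  have hne : {x | ∃ z, c z ≤ m ∧ b z = x}.Nonempty := ⟨b z, z, hz, rfl⟩
  have hbd : BddAbove {x | ∃ z, c z ≤ m ∧ b z = x} :=
    ⟨C, by rintro x ⟨z, h1, rfl⟩; exact hC z h1⟩
  exact ⟨_, (h m _).mpr ⟨Nat.sSup_mem hne hbd, fun x hx => le_csSup hbd hx⟩⟩

theorem IsLower.exists_mem (h : IsLower b c g) {m : ℕ} {z : Z} (hz : m ≤ c z) :
    ∃ v, v ∈ g m := by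
  have hne : {x | ∃ z, m ≤ c z ∧ b z = x}.Nonempty := ⟨b z, z, hz, rfl⟩
  exact ⟨_, (h m _).mpr ⟨Nat.sInf_mem hne, fun x hx => Nat.sInf_le hx⟩⟩

theorem infinite_of_forall_ge {s : Set ℕ} (k : ℕ) (h : ∀ m, k ≤ m → m ∈ s) : s.Infinite :=
  (Set.Ici_infinite k).mono h

theorem mem_dom_of {m v : ℕ} (h : v ∈ g m) : m ∈ g.Dom := Part.dom_iff_mem.mpr ⟨v, h⟩

theorem infinite_setOf_of_unbounded {p : ℕ → Prop} (h : ∀ C, ∃ m, C < m ∧ p m) :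
    {m | p m}.Infinite :=
  Set.infinite_of_not_bddAbove fun ⟨C, hC⟩ => by
    obtain ⟨m, h1, h2⟩ := h C
    exact absurd (hC h2) (by omega)

/-! #### `IsUpper` below the diagonal -/

theorem IsUpper.dom_infinite_of_le [Nonempty Z] (h : IsUpper b c g) (hbc : ∀ z, b z ≤ c z) :
    g.Dom.Infinite := by
  obtain ⟨z⟩ := ‹Nonempty Z›
  refine infinite_of_forall_ge (c z) fun m hm => ?_
  obtain ⟨v, hv⟩ := h.exists_mem (C := m) hm fun z hz => (hbc z).trans hz
  exact mem_dom_of hv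

theorem IsUpper.typ_alpha [Nonempty Z] (h : IsUpper b c g) {C : ℕ} (hC : ∀ z, b z ≤ C) :
    typ g = .α := by
  obtain ⟨z⟩ := ‹Nonempty Z›
  refine typ_eq_alpha (infinite_of_forall_ge (c z) fun m hm => ?_) ⟨C, fun m v hv => ?_⟩
  · obtain ⟨v, hv⟩ := h.exists_mem (C := C) hm fun z _ => hC z
    exact mem_dom_of hv
  · obtain ⟨z, -, rfl⟩ := ((h m v).mp hv).1
    exact hC z

theorem IsUpper.typ_gamma_of_le [Nonempty Z] (h : IsUpper b c g) (hbc : ∀ z, b z ≤ c z)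
    (hinf : {m | ∃ z, c z = m ∧ b z = m}.Infinite) : typ g = .γ := by
  have key : ∀ m v, v ∈ g m → v ≤ m := fun m v hv => by
    obtain ⟨z, h1, rfl⟩ := ((h m v).mp hv).1
    exact (hbc z).trans h1
  refine typ_eq_gamma (hinf.mono ?_) ((h.dom_infinite_of_le hbc).mono ?_)
  · rintro m ⟨z, h1, h2⟩
    obtain ⟨v, hv⟩ := h.exists_mem (C := m) h1.le fun z hz => (hbc z).trans hz
    exact ⟨v, hv, ((h m v).mp hv).2 ⟨z, h1.le, h2⟩⟩
  · intro m hm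
    obtain ⟨v, hv⟩ := Part.dom_iff_mem.mp hm
    exact ⟨v, hv, key m v hv⟩

theorem IsUpper.typ_beta_of_le [Nonempty Z] (h : IsUpper b c g) (hbc : ∀ z, b z ≤ c z)
    (hfin : {m | ∃ z, c z = m ∧ b z = m}.Finite) (hb : ∀ C, ∃ z, C < b z) : typ g = .β := by
  refine typ_eq_beta (h.dom_infinite_of_le hbc) (hfin.subset ?_) ?_
  · rintro m ⟨v, hv, hmv⟩
    obtain ⟨z, h1, rfl⟩ := ((h m v).mp hv).1
    exact ⟨z, h1.antisymm (hmv.trans (hbc z)), ((hbc z).trans h1).antisymm hmv⟩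
  · rintro ⟨C, hC⟩
    obtain ⟨z, hz⟩ := hb C
    obtain ⟨v, hv⟩ := h.exists_mem (C := c z) le_rfl fun z' hz' => (hbc z').trans hz'
    have := ((h _ v).mp hv).2 ⟨z, le_rfl, rfl⟩
    exact absurd (hC _ v hv) (by omega)

/-! #### `IsUpper` above the diagonal -/

/-- Once `b` is unbounded on a sublevel set of `c`, it is unbounded on all larger ones, so no later
maximum exists. -/
theorem IsUpper.typ_epsilon (h : IsUpper b c g) {m : ℕ}
    (hm : ∀ C, ∃ z, c z ≤ m ∧ C < b z) : typ g = .ε := by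
  refine typ_eq_epsilon ((Set.finite_Iio m).subset fun k hk => ?_)
  obtain ⟨v, hv⟩ := Part.dom_iff_mem.mp hk
  by_contra hkm
  obtain ⟨z, h1, h2⟩ := hm v
  have := ((h k v).mp hv).2 ⟨z, h1.trans (not_lt.mp hkm), rfl⟩
  omega

theorem IsUpper.dom_infinite_of_bdd [Nonempty Z] (h : IsUpper b c g)
    (hbd : ∀ m, ∃ C, ∀ z, c z ≤ m → b z ≤ C) : g.Dom.Infinite := by
  obtain ⟨z⟩ := ‹Nonempty Z›
  refine infinite_of_forall_ge (c z) fun m hm => ?_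
  obtain ⟨C, hC⟩ := hbd m
  obtain ⟨v, hv⟩ := h.exists_mem hm hC
  exact mem_dom_of hv

theorem IsUpper.typ_gamma_of_ge [Nonempty Z] (h : IsUpper b c g)
    (hbd : ∀ m, ∃ C, ∀ z, c z ≤ m → b z ≤ C)
    (hp : {m | ∃ z, c z = m ∧ b z = m}.Infinite)
    (hm : {m | ∀ z, c z ≤ m → b z ≤ m}.Infinite) : typ g = .γ := by
  obtain ⟨z₀⟩ := ‹Nonempty Z›
  -- For `m < c z₀` the condition in `hm` may hold vacuously while `g m` is undefined; these
  -- finitely many `m` are removed.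
  refine typ_eq_gamma (hp.mono ?_) ((hm.sdiff (Set.finite_Iio (c z₀))).mono ?_)
  · rintro m ⟨z, h1, h2⟩
    obtain ⟨C, hC⟩ := hbd m
    obtain ⟨v, hv⟩ := h.exists_mem h1.le hC
    exact ⟨v, hv, ((h m v).mp hv).2 ⟨z, h1.le, h2⟩⟩
  · rintro m ⟨h1, h2⟩
    obtain ⟨v, hv⟩ := h.exists_mem (not_lt.mp h2) h1
    obtain ⟨z, h3, rfl⟩ := ((h m v).mp hv).1
    exact ⟨_, hv, h1 z h3⟩

theorem IsUpper.typ_delta [Nonempty Z] (h : IsUpper b c g)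
    (hbd : ∀ m, ∃ C, ∀ z, c z ≤ m → b z ≤ C)
    (hm : {m | ∀ z, c z ≤ m → b z ≤ m}.Finite) : typ g = .δ := by
  refine typ_eq_delta (h.dom_infinite_of_bdd hbd) (hm.subset ?_)
  rintro m ⟨v, hv, hvm⟩ z hz
  exact (((h m v).mp hv).2 ⟨z, hz, rfl⟩).trans hvm

/-! #### `IsLower` -/

theorem IsLower.typ_epsilon (h : IsLower b c g) {C : ℕ} (hC : ∀ z, c z ≤ C) : typ g = .ε := by
  refine typ_eq_epsilon ((Set.finite_Iic C).subset fun k hk => ?_)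
  obtain ⟨v, hv⟩ := Part.dom_iff_mem.mp hk
  obtain ⟨z, h1, -⟩ := ((h k v).mp hv).1
  exact h1.trans (hC z)

theorem IsLower.dom_eq_univ (h : IsLower b c g) (hc : ∀ C, ∃ z, C < c z) :
    g.Dom = Set.univ := by
  refine Set.eq_univ_of_forall fun m => ?_
  obtain ⟨z, hz⟩ := hc m
  obtain ⟨v, hv⟩ := h.exists_mem hz.le
  exact mem_dom_of hv

theorem IsLower.typ_alpha (h : IsLower b c g) {m : ℕ}
    (hm : ∀ C, ∃ z, b z ≤ m ∧ C < c z) : typ g = .α := by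
  refine typ_eq_alpha ?_ ⟨m, fun k v hv => ?_⟩
  · rw [h.dom_eq_univ fun C => (hm C).imp fun z hz => hz.2]
    exact Set.infinite_univ
  · obtain ⟨z, h1, h2⟩ := hm k
    exact (((h k v).mp hv).2 ⟨z, h2.le, rfl⟩).trans h1

theorem IsLower.typ_gamma_of_ge (h : IsLower b c g) (hbc : ∀ z, c z ≤ b z)
    (hinf : {m | ∃ z, c z = m ∧ b z = m}.Infinite) (hc : ∀ C, ∃ z, C < c z) : typ g = .γ := by
  refine typ_eq_gamma (infinite_of_forall_ge 0 fun m _ => ?_) (hinf.mono ?_)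
  · obtain ⟨z, hz⟩ := hc m
    obtain ⟨v, hv⟩ := h.exists_mem hz.le
    obtain ⟨z, h1, rfl⟩ := ((h m v).mp hv).1
    exact ⟨_, hv, h1.trans (hbc z)⟩
  · rintro m ⟨z, h1, h2⟩
    obtain ⟨v, hv⟩ := h.exists_mem h1.ge
    exact ⟨v, hv, ((h m v).mp hv).2 ⟨z, h1.ge, h2⟩⟩

theorem IsLower.typ_delta (h : IsLower b c g) (hbc : ∀ z, c z ≤ b z)
    (hfin : {m | ∃ z, c z = m ∧ b z = m}.Finite) (hc : ∀ C, ∃ z, C < c z) : typ g = .δ := by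
  refine typ_eq_delta ?_ (hfin.subset ?_)
  · rw [h.dom_eq_univ hc]
    exact Set.infinite_univ
  · rintro m ⟨v, hv, hvm⟩
    obtain ⟨z, h1, rfl⟩ := ((h m v).mp hv).1
    exact ⟨z, ((hbc z).trans hvm).antisymm h1, hvm.antisymm (h1.trans (hbc z))⟩

theorem IsLower.domMinus_infinite (h : IsLower b c g)
    (hinf : {m | ∃ z, c z = m ∧ b z = m}.Infinite) : (domMinus g).Infinite := by
  refine hinf.mono ?_
  rintro m ⟨z, h1, h2⟩
  obtain ⟨v, hv⟩ := h.exists_mem h1.ge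
  exact ⟨v, hv, ((h m v).mp hv).2 ⟨z, h1.ge, h2⟩⟩

/-- If `b ≤ m` forces `c ≤ m`, then `c ≥ m + 1` forces `b ≥ m + 1`. Contraposition therefore turns
control at `m` into a point `m + 1` of `domPlus g`. -/
theorem IsLower.typ_gamma_of_le (h : IsLower b c g)
    (hinf : {m | ∃ z, c z = m ∧ b z = m}.Infinite) (hc : ∀ C, ∃ z, C < c z)
    (hm : {m | ∀ z, b z ≤ m → c z ≤ m}.Infinite) : typ g = .γ := by
  refine typ_eq_gamma ?_ (h.domMinus_infinite hinf)
  refine (hm.image (Nat.succ_injective.injOn)).mono ?_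
  rintro _ ⟨m, hm, rfl⟩
  obtain ⟨z, hz⟩ := hc m.succ
  obtain ⟨v, hv⟩ := h.exists_mem hz.le
  obtain ⟨z, h1, rfl⟩ := ((h _ v).mp hv).1
  refine ⟨_, hv, ?_⟩
  by_contra hlt
  have := hm z (by omega)
  omega

/-- The same contraposition read backwards: every positive point of `domPlus g` is the successor of
a controlled `m`. A bound on `g` would give arbitrarily large `c` on a sublevel set of `b`, against
`hbd`. -/
theorem IsLower.typ_beta (h : IsLower b c g) (hc : ∀ C, ∃ z, C < c z)
    (hbd : ∀ m, ∃ C, ∀ z, b z ≤ m → c z ≤ C)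
    (hm : {m | ∀ z, b z ≤ m → c z ≤ m}.Finite) : typ g = .β := by
  refine typ_eq_beta ?_ (((hm.image Nat.succ).insert 0).subset ?_) ?_
  · rw [h.dom_eq_univ hc]
    exact Set.infinite_univ
  · rintro m ⟨v, hv, hmv⟩
    rcases m with - | m
    · exact Or.inl rfl
    · refine Or.inr ⟨m, fun z hz => ?_, rfl⟩
      by_contra hlt
      have := ((h _ v).mp hv).2 ⟨z, (by omega : m + 1 ≤ c z), rfl⟩
      omega
  · rintro ⟨C, hC⟩
    obtain ⟨D, hD⟩ := hbd C
    obtain ⟨z, hz⟩ := hc (D + 1)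
    obtain ⟨v, hv⟩ := h.exists_mem hz.le
    obtain ⟨z, h1, rfl⟩ := ((h _ v).mp hv).1
    have := hD z (hC _ _ hv)
    omega

end Abstract

/-! ### The extremal functions of an sm-pair as instances of the abstract ones -/

theorem isUpper_upper {U : Structure.{u}} (ψ : Measure U) (n : ℕ) (b c : Param) :
    IsUpper (fun z : {z : Problem U // z.Y.1.card = n} => ψ.param b z.1)
      (fun z => ψ.param c z.1) (upper ψ n b c) := by
  intro m v
  have hs : {x | ∃ z : {z : Problem U // z.Y.1.card = n}, ψ.param c z.1 ≤ m ∧ ψ.param b z.1 = x} =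
      {x | ∃ z : Problem U, z.Y.1.card = n ∧ ψ.param c z ≤ m ∧ ψ.param b z = x} := by
    ext x; simp [and_left_comm]
  rw [hs]
  constructor
  · rintro ⟨h, rfl⟩
    exact h.choose_spec
  · intro h
    exact ⟨⟨v, h⟩, (Exists.choose_spec (⟨v, h⟩ : ∃ v, IsGreatest _ v)).unique h⟩

theorem isLower_lower {U : Structure.{u}} (ψ : Measure U) (n : ℕ) (b c : Param) :
    IsLower (fun z : {z : Problem U // z.Y.1.card = n} => ψ.param b z.1)
      (fun z => ψ.param c z.1) (lower ψ n b c) := by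
  intro m v
  have hs : {x | ∃ z : {z : Problem U // z.Y.1.card = n}, m ≤ ψ.param c z.1 ∧ ψ.param b z.1 = x} =
      {x | ∃ z : Problem U, z.Y.1.card = n ∧ m ≤ ψ.param c z ∧ ψ.param b z = x} := by
    ext x; simp [and_left_comm]
  rw [hs]
  constructor
  · rintro ⟨h, rfl⟩
    exact h.choose_spec
  · intro h
    exact ⟨⟨v, h⟩, (Exists.choose_spec (⟨v, h⟩ : ∃ v, IsLeast _ v)).unique h⟩


variable {U : Structure.{u}}

/-! ### Nondeterministic complexity and decision rules -/

theorem Measure.ofExprs_le_ofTree (ψ : Measure U) (Γ : CompTree U) (ξ : Γ.Path) :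
    ψ.ofExprs (Γ.exprs ξ) ≤ ψ.ofTree Γ :=
  le_ciSup (f := fun ξ : Γ.Path => ψ.ofExprs (Γ.exprs ξ)) (Set.finite_range _).bddAbove ξ

instance CompTree.nonempty_path (Γ : CompTree U) : Nonempty Γ.Path :=
  (Γ.child 0).nonempty_path.elim fun ξ => ⟨⟨0, ξ⟩⟩

theorem Measure.ofTree_le (ψ : Measure U) (Γ : CompTree U) {m : ℕ}
    (h : ∀ ξ : Γ.Path, ψ.ofExprs (Γ.exprs ξ) ≤ m) : ψ.ofTree Γ ≤ m :=
  ciSup_le h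

theorem CompTree.mem_region (Γ : CompTree U) (Y : Vars) (ξ : Γ.Path) (a : Input U Y) :
    a ∈ Γ.region Y ξ ↔ predVals (Γ.exprs ξ) (initVal Y a) = Γ.labels ξ := Iff.rfl

theorem CompTree.solvesN_iff (Γ : CompTree U) (z : Problem U) :
    Γ.SolvesN z ↔ Γ.Y = z.Y ∧
      (∀ a, ∃ ξ : Γ.Path, predVals (Γ.exprs ξ) (initVal z.Y a) = Γ.labels ξ) ∧
      ∀ a (ξ : Γ.Path), predVals (Γ.exprs ξ) (initVal z.Y a) = Γ.labels ξ →
        Γ.result ξ ∈ z.solutions a := by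
  simp only [CompTree.SolvesN, Set.eq_univ_iff_forall, Set.mem_iUnion, CompTree.mem_region]

theorem Measure.exists_tree_a (ψ : Measure U) (z : Problem U) :
    ∃ Γ : CompTree U, Γ.SolvesN z ∧ ψ.ofTree Γ = ψ.param .a z := by
  obtain ⟨Γ, h⟩ := exists_solvesD z
  exact Nat.sInf_mem (s := {c | ∃ Γ : CompTree U, Γ.SolvesN z ∧ ψ.ofTree Γ = c}) ⟨_, Γ, h.2, rfl⟩

theorem Measure.exists_tree_d (ψ : Measure U) (z : Problem U) :
    ∃ Γ : CompTree U, Γ.SolvesD z ∧ ψ.ofTree Γ = ψ.param .d z := by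
  obtain ⟨Γ, h⟩ := exists_solvesD z
  exact Nat.sInf_mem (s := {c | ∃ Γ : CompTree U, Γ.SolvesD z ∧ ψ.ofTree Γ = c}) ⟨_, Γ, h, rfl⟩

theorem Measure.param_a_le (ψ : Measure U) {z : Problem U} {Γ : CompTree U} (h : Γ.SolvesN z) :
    ψ.param .a z ≤ ψ.ofTree Γ := Nat.sInf_le ⟨Γ, h, rfl⟩

theorem Measure.param_d_le (ψ : Measure U) {z : Problem U} {Γ : CompTree U} (h : Γ.SolvesD z) :
    ψ.param .d z ≤ ψ.ofTree Γ := Nat.sInf_le ⟨Γ, h, rfl⟩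

theorem Measure.param_a_le_param_d (ψ : Measure U) (z : Problem U) :
    ψ.param .a z ≤ ψ.param .d z := by
  obtain ⟨Γ, h, e⟩ := ψ.exists_tree_d z
  exact e ▸ ψ.param_a_le h.2

/-- The tree with a single path that executes `β`, with the labels `t` (padded by `false`). -/
def Node.chain : List (Expr U) → List Bool → ℕ → Node U
  | [], _, κ => .term κ
  | .func j f l :: β, t, κ => .func j f l 0 fun _ => Node.chain β t κ
  | .pred p q :: β, t, κ => .pred p q 0 (fun _ => t.headD false) fun _ => Node.chain β t.tail κ

theorem Node.chain_path (β : List (Expr U)) (t : List Bool) (κ : ℕ)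
    (ξ : (Node.chain β t κ).Path) :
    (Node.chain β t κ).exprs ξ = β ∧ (Node.chain β t κ).result ξ = κ ∧
      (t.length = predCount β → (Node.chain β t κ).labels ξ = t) := by
  induction β generalizing t with
  | nil => exact ⟨rfl, rfl, fun h => (List.length_eq_zero_iff.mp h).symm⟩
  | cons e β ih =>
    cases e with
    | func j f l =>
      obtain ⟨i, ξ⟩ := ξ
      exact ⟨congrArg _ (ih t ξ).1, (ih t ξ).2.1, (ih t ξ).2.2⟩
    | pred p q =>
      obtain ⟨i, ξ⟩ := ξ
      obtain ⟨h1, h2, h3⟩ := ih t.tail ξ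
      refine ⟨congrArg _ h1, h2, fun h => ?_⟩
      cases t with
      | nil => simp [predCount] at h
      | cons b t =>
        exact congrArg (List.cons b) (h3 (by simpa [predCount] using h))

/-- A finite family of decision rules `(β i, t i, κ i)` that covers all inputs and gives correct
answers can be organized into a nondeterministic computation tree. -/
theorem Measure.param_a_le_of_rules (ψ : Measure U) (z : Problem U) {m : ℕ} {ι : Type*}
    [Finite ι] (β : ι → List (Expr U)) (t : ι → List Bool) (κ : ι → ℕ)
    (hψ : ∀ i, ψ.ofExprs (β i) ≤ m)
    (hcov : ∀ a, ∃ i, predVals (β i) (initVal z.Y a) = t i)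
    (hsol : ∀ a i, predVals (β i) (initVal z.Y a) = t i → κ i ∈ z.solutions a) :
    ψ.param .a z ≤ m := by
  obtain ⟨x⟩ := U.nonempty_A
  -- A rule whose list of labels has the wrong length is never satisfied. It is discarded, because
  -- `Node.chain` would pad or truncate its labels.
  let J := {i : ι // (t i).length = predCount (β i)}
  obtain ⟨n, ⟨e⟩⟩ := Finite.exists_equiv_fin J
  have hJ : ∀ a, ∃ j : J, predVals (β j.1) (initVal z.Y a) = t j.1 := fun a => by
    obtain ⟨i, hi⟩ := hcov a
    exact ⟨⟨i, by rw [← hi, length_predVals]⟩, hi⟩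
  obtain ⟨j₀, -⟩ := hJ fun _ => x
  -- The root needs at least one child; some rule exists because it covers a constant input.
  obtain ⟨k, rfl⟩ : ∃ k, n = k + 1 := ⟨n - 1, by have := (e j₀).pos; omega⟩
  let Γ : CompTree U := ⟨z.Y, k, fun i => Node.chain (β (e.symm i).1) (t (e.symm i).1)
    (κ (e.symm i).1)⟩
  have hlab : ∀ ξ : Γ.Path, Γ.exprs ξ = β (e.symm ξ.1).1 ∧ Γ.result ξ = κ (e.symm ξ.1).1 ∧
      Γ.labels ξ = t (e.symm ξ.1).1 := fun ξ =>
    have h := Node.chain_path _ _ _ ξ.2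
    ⟨h.1, h.2.1, h.2.2 (e.symm ξ.1).2⟩
  have hΓ : Γ.SolvesN z := by
    refine (Γ.solvesN_iff z).mpr ⟨rfl, fun a => ?_, fun a ξ h => ?_⟩
    · obtain ⟨j, hj⟩ := hJ a
      obtain ⟨ξ⟩ := (Γ.child (e j)).nonempty_path
      refine ⟨⟨e j, ξ⟩, ?_⟩
      rw [(hlab _).1, (hlab _).2.2, e.symm_apply_apply]
      exact hj
    · rw [(hlab _).1, (hlab _).2.2] at h
      rw [(hlab _).2.1]
      exact hsol _ _ h
  exact (ψ.param_a_le hΓ).trans (ψ.ofTree_le _ fun ξ => (hlab ξ).1 ▸ hψ _)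

theorem Measure.exists_rules (ψ : Measure U) (z : Problem U) :
    ∃ (ι : Type) (_ : Finite ι) (β : ι → List (Expr U)) (t : ι → List Bool) (κ : ι → ℕ),
      (∀ i, ψ.ofExprs (β i) ≤ ψ.param .a z) ∧
      (∀ a, ∃ i, predVals (β i) (initVal z.Y a) = t i) ∧
      ∀ a i, predVals (β i) (initVal z.Y a) = t i → κ i ∈ z.solutions a := by
  obtain ⟨Γ, h, e⟩ := ψ.exists_tree_a z
  obtain ⟨-, h2, h3⟩ := (Γ.solvesN_iff z).mp h
  exact ⟨Γ.Path, inferInstance, Γ.exprs, Γ.labels, Γ.result, fun ξ => e ▸ ψ.ofExprs_le_ofTree Γ ξ,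
    h2, h3⟩

/-! ### Upper bounds on the deterministic complexity -/

/-- Executing `L` suffices if the values of the predicates determine a solution. -/
theorem Measure.param_d_le_ofExprs (ψ : Measure U) (z : Problem U) (L : List (Expr U))
    (h : ∀ a, ∃ κ, ∀ a', predVals L (initVal z.Y a') = predVals L (initVal z.Y a) →
      κ ∈ z.solutions a') : ψ.param .d z ≤ ψ.ofExprs L := by
  classical
  choose κ hκ using h
  -- The value 0 is given to lists that no input produces, so it is never an answer.
  let g : List Bool → ℕ := fun t =>
    if h : ∃ a, predVals L (initVal z.Y a) = t then κ h.choose else 0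
  have hg : ∀ a, g (predVals L (initVal z.Y a)) ∈ z.solutions a := fun a => by
    have h : ∃ a', predVals L (initVal z.Y a') = predVals L (initVal z.Y a) := ⟨a, rfl⟩
    simp only [g, dif_pos h]
    exact hκ _ _ h.choose_spec.symm
  let Γ : CompTree U := ⟨z.Y, 0, fun _ => Node.follow L g⟩
  have hΓ : Γ.SolvesD z := by
    refine ⟨⟨rfl, fun _ => Node.follow_deterministic _ _⟩,
      (Γ.solvesN_iff z).mpr ⟨rfl, fun a => ?_, ?_⟩⟩
    · obtain ⟨ξ, hξ⟩ := Node.follow_exists L g (predVals L (initVal z.Y a)) (length_predVals _ _)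
      refine ⟨⟨0, ξ⟩, ?_⟩
      change predVals ((Node.follow L g).exprs ξ) _ = (Node.follow L g).labels ξ
      rw [(Node.follow_path L g ξ).1, hξ]
    · rintro a ⟨i, ξ⟩ h
      change predVals ((Node.follow L g).exprs ξ) _ = (Node.follow L g).labels ξ at h
      change (Node.follow L g).result ξ ∈ _
      rw [(Node.follow_path L g ξ).2, ← h, (Node.follow_path L g ξ).1]
      exact hg a
  refine (ψ.param_d_le hΓ).trans (ψ.ofTree_le _ fun ξ => ?_)
  exact (congrArg ψ.ofExprs (Node.follow_path L g ξ.2).1).le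

/-- Evaluating one predicate and then executing one of two sequences suffices if the values of
the predicates determine a solution. -/
theorem Measure.param_d_le_of_branch (ψ : Measure U) (z : Problem U) (p : U.P)
    (q : Fin p.1.1 → ℕ) (L : Bool → List (Expr U)) {m : ℕ}
    (hm : ∀ b, ψ.ofExprs (.pred p q :: L b) ≤ m)
    (h : ∀ a, ∃ κ, ∀ a',
      p.1.2 (fun i => initVal z.Y a' (q i)) = p.1.2 (fun i => initVal z.Y a (q i)) →
      predVals (L (p.1.2 fun i => initVal z.Y a (q i))) (initVal z.Y a') =
        predVals (L (p.1.2 fun i => initVal z.Y a (q i))) (initVal z.Y a) →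
      κ ∈ z.solutions a') : ψ.param .d z ≤ m := by
  classical
  choose κ hκ using h
  let pv : Input U z.Y → Bool := fun a => p.1.2 fun i => initVal z.Y a (q i)
  let g : Bool → List Bool → ℕ := fun b t =>
    if h : ∃ a, pv a = b ∧ predVals (L b) (initVal z.Y a) = t then κ h.choose else 0
  have hg : ∀ a, g (pv a) (predVals (L (pv a)) (initVal z.Y a)) ∈ z.solutions a := fun a => by
    have h : ∃ a', pv a' = pv a ∧
      predVals (L (pv a)) (initVal z.Y a') = predVals (L (pv a)) (initVal z.Y a) := ⟨a, rfl, rfl⟩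
    simp only [g, dif_pos h]
    have e := h.choose_spec.1
    refine hκ _ _ e.symm ?_
    change predVals (L (pv h.choose)) _ = predVals (L (pv h.choose)) _
    rw [e]
    exact h.choose_spec.2.symm
  let ch : Fin 2 → Node U := fun i => Node.follow (L (decide (i = 1))) (g (decide (i = 1)))
  let Γ : CompTree U := ⟨z.Y, 0, fun _ => Node.pred p q 1 (fun i => decide (i = 1)) ch⟩
  have hΓ : Γ.SolvesD z := by
    refine ⟨⟨rfl, fun _ => ⟨by decide, fun _ => Node.follow_deterministic _ _⟩⟩,
      (Γ.solvesN_iff z).mpr ⟨rfl, fun a => ?_, ?_⟩⟩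
    · obtain ⟨i, hi⟩ : ∃ i : Fin 2, decide (i = 1) = pv a := by
        cases pv a
        · exact ⟨0, rfl⟩
        · exact ⟨1, rfl⟩
      obtain ⟨ξ, hξ⟩ := Node.follow_exists (L (decide (i = 1))) (g (decide (i = 1)))
        (predVals (L (decide (i = 1))) (initVal z.Y a)) (length_predVals _ _)
      refine ⟨⟨0, ⟨i, ξ⟩⟩, ?_⟩
      change pv a :: predVals ((ch i).exprs ξ) _ = decide (i = 1) :: (ch i).labels ξ
      rw [(Node.follow_path _ _ ξ).1, hξ, hi]
    · rintro a ⟨o, i, ξ⟩ h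
      change pv a :: predVals ((ch i).exprs ξ) _ = decide (i = 1) :: (ch i).labels ξ at h
      change (ch i).result ξ ∈ _
      obtain ⟨h1, h2⟩ := List.cons.inj h
      rw [(Node.follow_path _ _ ξ).2, ← h2, (Node.follow_path _ _ ξ).1, ← h1]
      exact hg a
  refine (ψ.param_d_le hΓ).trans (ψ.ofTree_le _ ?_)
  rintro ⟨o, i, ξ⟩
  change ψ.ofExprs (.pred p q :: (ch i).exprs ξ) ≤ m
  rw [(Node.follow_path _ _ ξ).1]
  exact hm _

theorem Measure.param_d_le_param_i (ψ : Measure U) (z : Problem U) :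
    ψ.param .d z ≤ ψ.param .i z :=
  ψ.param_d_le_ofExprs z z.β fun a => by
    obtain ⟨κ, hκ⟩ := (z.ν (PiTuple z.Y z.β a)).2
    refine ⟨κ, fun a' h => ?_⟩
    have : PiTuple z.Y z.β a' = PiTuple z.Y z.β a := Subtype.ext h
    rw [Problem.solutions, this]
    exact hκ

/-! ### Problems given by functions on lists -/

/-- The problem with the set of solutions `g t` for the list `t` of predicate values. -/
def Problem.ofFun (Y : Vars) (β : List (Expr U)) (h : 0 < predCount β)
    (g : List Bool → {S : Finset ℕ // S.Nonempty}) : Problem U :=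
  ⟨Y, β, h, fun t => g t.1⟩

theorem Problem.solutions_ofFun (Y : Vars) (β : List (Expr U)) (h : 0 < predCount β)
    (g : List Bool → {S : Finset ℕ // S.Nonempty}) (a : Input U Y) :
    (Problem.ofFun Y β h g).solutions a = (g (predVals β (initVal Y a))).1 := rfl

/-- The problem of finding the values of all predicates. -/
def Problem.full (Y : Vars) (β : List (Expr U)) (h : 0 < predCount β) : Problem U :=
  .ofFun Y β h fun t => ⟨{Encodable.encode t}, Finset.singleton_nonempty _⟩

theorem Problem.mem_solutions_full (Y : Vars) (β : List (Expr U)) (h : 0 < predCount β)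
    (a : Input U Y) (κ : ℕ) : κ ∈ (Problem.full Y β h).solutions a ↔
      κ = Encodable.encode (predVals β (initVal Y a)) :=
  Finset.mem_singleton

theorem predCount_replicate (p : U.P) (q : Fin p.1.1 → ℕ) (k : ℕ) :
    predCount (List.replicate k (.pred p q : Expr U)) = k := by
  induction k with
  | zero => rfl
  | succ k ih => rw [List.replicate_succ, predCount, ih]

/-- Trivial problems with long descriptions. -/
theorem Measure.exists_trivial (ψ : Measure U) (hψ : ψ.Limited) (Y : Vars) (C : ℕ) :
    ∃ z : Problem U, z.Y = Y ∧ C < ψ.param .i z ∧ ψ.param .d z ≤ ψ [] := by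
  obtain ⟨p, hp⟩ := U.nonempty_P
  let β : List (Expr U) := List.replicate (C + 1) (.pred ⟨p, hp⟩ fun _ => 0)
  have hβ : 0 < predCount β := by
    rw [predCount_replicate]; omega
  refine ⟨.ofFun Y β hβ fun _ => ⟨{0}, Finset.singleton_nonempty _⟩, rfl, ?_, ?_⟩
  · have := hψ.length_le (β.map Expr.symb)
    rw [List.length_map, List.length_replicate] at this
    exact this
  · exact ψ.param_d_le_ofExprs _ [] fun a => ⟨0, fun a' _ => Finset.mem_singleton_self _⟩

/-! ### Problems with equal description and nondeterministic complexity -/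

/-- If no problem has both description and nondeterministic complexity `m`, then the region
of a path of complexity at most `m` splits into regions of cheaper paths. -/
theorem Measure.exists_cheap_cover {ψ : Measure U} (Y : Vars) {m : ℕ} (hm : ψ [] < m)
    (hcon : ∀ z' : Problem U, z'.Y = Y → ψ.param .i z' = m → ψ.param .a z' ≠ m)
    (β : List (Expr U)) (t : List Bool) (hβ : ψ.ofExprs β ≤ m) :
    ∃ (J : Type) (_ : Finite J) (β' : J → List (Expr U)) (t' : J → List Bool),
      (∀ j, ψ.ofExprs (β' j) < m) ∧ ∀ a : Input U Y,
        predVals β (initVal Y a) = t ↔ ∃ j, predVals (β' j) (initVal Y a) = t' j := by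
  rcases hβ.lt_or_eq with hlt | heq
  · exact ⟨Unit, inferInstance, fun _ => β, fun _ => t, fun _ => hlt, fun a => by simp⟩
  -- Without predicates the region is everything or nothing: the empty path, of cost `ψ [] < m`, or
  -- no path at all.
  by_cases h0 : predCount β = 0
  · have hnil : ∀ s, predVals β s = [] := fun s => by
      rw [← List.length_eq_zero_iff, length_predVals, h0]
    by_cases ht : t = []
    · exact ⟨Unit, inferInstance, fun _ => [], fun _ => [], fun _ => hm, fun a => by
        simp [hnil, ht, predVals]⟩
    · exact ⟨Empty, inferInstance, fun _ => [], fun _ => [], fun _ => hm, fun a => by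
        simp [hnil, Ne.symm ht]⟩
  -- The problem of deciding whether the input follows the path. Its description costs `m`, so by
  -- `hcon` it has rules of cost below `m`; those that answer 1 cover exactly the region.
  · let z : Problem U := .ofFun Y β (Nat.pos_of_ne_zero h0) fun u =>
      ⟨{if u = t then 1 else 0}, Finset.singleton_nonempty _⟩
    have hz : ψ.param .a z < m :=
      lt_of_le_of_ne ((ψ.param_a_le_param_d z).trans ((ψ.param_d_le_param_i z).trans hβ))
        (hcon z rfl heq)
    obtain ⟨ι, _, β', t', κ, h1, h2, h3⟩ := ψ.exists_rules z
    have hκ : ∀ (a : Input U Y) i, predVals (β' i) (initVal Y a) = t' i →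
        κ i = if predVals β (initVal Y a) = t then 1 else 0 := fun a i h =>
      Finset.mem_singleton.mp (h3 a i h)
    refine ⟨{i : ι // κ i = 1}, inferInstance, fun i => β' i.1, fun i => t' i.1,
      fun i => (h1 _).trans_lt hz, fun a => ⟨fun h => ?_, ?_⟩⟩
    · obtain ⟨i, hi⟩ := h2 a
      exact ⟨⟨i, by rw [hκ a i hi, if_pos h]⟩, hi⟩
    · rintro ⟨⟨i, hi⟩, h⟩
      by_contra hne
      rw [hκ a i h, if_neg hne] at hi
      exact zero_ne_one hi

/-- If there were no such problem, each rule of an optimal system for `z` could be refined by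
`exists_cheap_cover` into finitely many cheaper rules with the same answer. This would solve `z`
with cost at most `ψ.param .a z - 1`. -/
theorem Measure.exists_param_i_eq_param_a {ψ : Measure U} (z : Problem U)
    (hz : ψ [] < ψ.param .a z) :
    ∃ z' : Problem U, z'.Y = z.Y ∧ ψ.param .i z' = ψ.param .a z ∧
      ψ.param .a z' = ψ.param .a z := by
  by_contra hcon
  push Not at hcon
  obtain ⟨ι, _, β, t, κ, hβ, hcov, hsol⟩ := ψ.exists_rules z
  have key := fun i => Measure.exists_cheap_cover z.Y hz hcon (β i) (t i) (hβ i)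
  choose J hJ β' t' hβ' hreg using key
  have := ψ.param_a_le_of_rules z (m := ψ.param .a z - 1) (ι := Σ i, J i) (fun j => β' j.1 j.2)
    (fun j => t' j.1 j.2) (fun j => κ j.1) (fun j => by have := hβ' j.1 j.2; omega)
    (fun a => by
      obtain ⟨i, hi⟩ := hcov a
      obtain ⟨j, hj⟩ := (hreg i a).mp hi
      exact ⟨⟨i, j⟩, hj⟩)
    (fun a j h => hsol a j.1 ((hreg j.1 a).mpr ⟨j.2, h⟩))
  omega

/-! ### Adding an input variable -/

/-- Only finitely many variables occur in a sequence, so a new input variable of large index cannot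
affect it. -/
theorem exists_bound_vars (β : List (Expr U)) : ∃ B, ∀ s s' : ℕ → U.A,
    (∀ j < B, s j = s' j) → predVals β s = predVals β s' := by
  induction β with
  | nil => exact ⟨0, fun _ _ _ => rfl⟩
  | cons e β ih =>
    obtain ⟨B, hB⟩ := ih
    cases e with
    | func j f l =>
      refine ⟨B + ∑ i, (l i + 1), fun s s' h => hB _ _ fun i hi => ?_⟩
      by_cases hij : i = j
      · subst hij
        simp only [Function.update_self]
        refine congrArg f.1.2 (funext fun i => h _ ?_)
        have := Finset.single_le_sum (f := fun i => l i + 1) (fun _ _ => Nat.zero_le _)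
          (Finset.mem_univ i)
        omega
      · simp only [Function.update_of_ne hij]
        exact h _ (by omega)
    | pred p q =>
      refine ⟨B + ∑ i, (q i + 1), fun s s' h => congrArg₂ List.cons ?_ (hB _ _ fun i hi => h i (by omega))⟩
      refine congrArg p.1.2 (funext fun i => h _ ?_)
      have := Finset.single_le_sum (f := fun i => q i + 1) (fun _ _ => Nat.zero_le _)
        (Finset.mem_univ i)
      omega

theorem CompTree.exists_bound_vars (Γ : CompTree U) : ∃ B, ∀ ξ : Γ.Path, ∀ s s' : ℕ → U.A,
    (∀ j < B, s j = s' j) → predVals (Γ.exprs ξ) s = predVals (Γ.exprs ξ) s' := by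
  choose B hB using fun ξ : Γ.Path => CompTrees.exists_bound_vars (Γ.exprs ξ)
  obtain ⟨M, hM⟩ := (Set.finite_range B).bddAbove
  exact ⟨M, fun ξ s s' h => hB ξ s s' fun j hj => h j (hj.trans_le (hM ⟨ξ, rfl⟩))⟩

/-- The set of variables `Y ∪ {x_y}`. -/
def Vars.insert (Y : Vars) (y : ℕ) : Vars := ⟨Insert.insert y Y.1, Finset.insert_nonempty _ _⟩

def Input.restrict {Y : Vars} {y : ℕ} (a : Input U (Y.insert y)) : Input U Y :=
  fun j => a ⟨j.1, Finset.mem_insert_of_mem j.2⟩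

/-- The new variable receives the value that it would have had by default, so that no execution
notices the change. -/
def Input.extend {Y : Vars} {y : ℕ} (a : Input U Y) : Input U (Y.insert y) :=
  fun j => initVal Y a j.1

/-- A new index above all old ones leaves unchanged the variable that supplies the default values.
-/
theorem Vars.min'_insert {Y : Vars} {y : ℕ} (hy : ∀ j ∈ Y.1, j < y) :
    (Y.insert y).1.min' (Y.insert y).2 = Y.1.min' Y.2 := by
  refine le_antisymm (Finset.min'_le _ _ (Finset.mem_insert_of_mem (Y.1.min'_mem Y.2))) ?_
  refine Finset.le_min' _ _ _ fun j hj => ?_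
  rcases Finset.mem_insert.mp hj with rfl | hj
  · exact (hy _ (Y.1.min'_mem Y.2)).le
  · exact Finset.min'_le _ _ hj

theorem initVal_restrict {Y : Vars} {y : ℕ} (hy : ∀ j ∈ Y.1, j < y) (a : Input U (Y.insert y))
    (j : ℕ) (hj : j < y) : initVal Y a.restrict j = initVal (Y.insert y) a j := by
  have hmem : j ∈ (Y.insert y).1 ↔ j ∈ Y.1 := by
    simp [Vars.insert, hj.ne]
  unfold initVal
  by_cases h : j ∈ Y.1
  · rw [dif_pos h, dif_pos (hmem.mpr h)]
    rfl
  · rw [dif_neg h, dif_neg (mt hmem.mp h)]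
    simp only [Vars.min'_insert hy]
    rfl

theorem initVal_extend {Y : Vars} {y : ℕ} (hy : ∀ j ∈ Y.1, j < y) (a : Input U Y) :
    initVal (Y.insert y) a.extend = initVal Y a := by
  funext j
  by_cases h : j ∈ (Y.insert y).1
  · rw [initVal, dif_pos h]
    rfl
  · have h' : j ∉ Y.1 := fun h' => h (Finset.mem_insert_of_mem h')
    rw [initVal, dif_neg h]
    simp only [Vars.min'_insert hy, Input.extend]
    simp only [initVal, dif_neg h', Y.1.min'_mem Y.2, dite_true]

/-- The values of the three parameters at `z` are also attained at a problem with one more input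
variable. -/
theorem Measure.exists_succ (ψ : Measure U) (z : Problem U) :
    ∃ z' : Problem U, z'.Y.1.card = z.Y.1.card + 1 ∧ ∀ b, ψ.param b z' = ψ.param b z := by
  obtain ⟨Γd, hd, ed⟩ := ψ.exists_tree_d z
  obtain ⟨Γa, ha, ea⟩ := ψ.exists_tree_a z
  obtain ⟨B, hB⟩ := CompTrees.exists_bound_vars z.β
  obtain ⟨Bd, hBd⟩ := Γd.exists_bound_vars
  obtain ⟨Ba, hBa⟩ := Γa.exists_bound_vars
  obtain ⟨m, hm⟩ := z.Y.1.bddAbove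
  -- Larger than every element of `z.Y` and beyond all variables that matter for the description and
  -- for the two optimal trees.
  let y := B + Bd + Ba + m + 1
  have hy : ∀ j ∈ z.Y.1, j < y := fun j hj => by
    have : j ≤ m := hm hj
    simp only [y]; omega
  have hyY : y ∉ z.Y.1 := fun h => (hy y h).false
  let z' : Problem U := ⟨z.Y.insert y, z.β, z.predCount_pos, z.ν⟩
  have hsr : ∀ a : Input U z'.Y, z'.solutions a = z.solutions a.restrict := fun a => by
    have : PiTuple (z.Y.insert y) z.β a = PiTuple z.Y z.β a.restrict :=
      Subtype.ext (hB _ _ fun j hj => (initVal_restrict hy a j (by simp only [y]; omega)).symm)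
    exact congrArg (fun t => (z.ν t).1) this
  have hse : ∀ a : Input U z.Y, z'.solutions a.extend = z.solutions a := fun a => by
    have : PiTuple (z.Y.insert y) z.β a.extend = PiTuple z.Y z.β a :=
      Subtype.ext (congrArg (predVals z.β) (initVal_extend hy a))
    exact congrArg (fun t => (z.ν t).1) this
  have up : ∀ (Γ : CompTree U) B', B' ≤ y → (∀ ξ : Γ.Path, ∀ s s' : ℕ → U.A,
      (∀ j < B', s j = s' j) → predVals (Γ.exprs ξ) s = predVals (Γ.exprs ξ) s') →
      Γ.SolvesN z → CompTree.SolvesN ⟨z.Y.insert y, Γ.k, Γ.child⟩ z' := by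
    intro Γ B' hB' hΓ h
    obtain ⟨-, h2, h3⟩ := (Γ.solvesN_iff z).mp h
    have hpv : ∀ (a : Input U z'.Y) (ξ : Γ.Path), predVals (Γ.exprs ξ) (initVal z'.Y a) =
        predVals (Γ.exprs ξ) (initVal z.Y a.restrict) := fun a ξ =>
      hΓ ξ _ _ fun j hj => (initVal_restrict hy a j (by omega)).symm
    refine (CompTree.solvesN_iff _ z').mpr ⟨rfl, fun a => ?_, fun a ξ hξ => ?_⟩
    · obtain ⟨ξ, hξ⟩ := h2 a.restrict
      exact ⟨ξ, (hpv a ξ).trans hξ⟩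
    · rw [hsr]
      exact h3 _ ξ ((hpv a ξ).symm.trans hξ)
  -- Here no bound on the variables of `Γ` is needed: an extended input gives exactly the same
  -- initial values, at `y` as well.
  have down : ∀ Γ : CompTree U, Γ.SolvesN z' → CompTree.SolvesN ⟨z.Y, Γ.k, Γ.child⟩ z := by
    intro Γ h
    obtain ⟨-, h2, h3⟩ := (Γ.solvesN_iff z').mp h
    refine (CompTree.solvesN_iff _ z).mpr ⟨rfl, fun a => ?_, fun a ξ hξ => ?_⟩
    · obtain ⟨ξ, hξ⟩ := h2 a.extend
      rw [show initVal z'.Y a.extend = initVal z.Y a from initVal_extend hy a] at hξ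
      exact ⟨ξ, hξ⟩
    · rw [← hse]
      refine h3 _ ξ ?_
      rw [show initVal z'.Y a.extend = initVal z.Y a from initVal_extend hy a]
      exact hξ
  refine ⟨z', Finset.card_insert_of_notMem hyY, fun b => ?_⟩
  cases b with
  | i => rfl
  | d =>
    refine le_antisymm ?_ ?_
    · exact (ψ.param_d_le (Γ := ⟨z.Y.insert y, Γd.k, Γd.child⟩)
        ⟨hd.1, up Γd Bd (by simp only [y]; omega) hBd hd.2⟩).trans ed.le
    · obtain ⟨Γ, h, e⟩ := ψ.exists_tree_d z'
      exact (ψ.param_d_le (Γ := ⟨z.Y, Γ.k, Γ.child⟩) ⟨h.1, down Γ h.2⟩).trans e.le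
  | a =>
    refine le_antisymm ?_ ?_
    · exact (ψ.param_a_le (up Γa Ba (by simp only [y]; omega) hBa ha)).trans ea.le
    · obtain ⟨Γ, h, e⟩ := ψ.exists_tree_a z'
      exact (ψ.param_a_le (down Γ h)).trans e.le


/-! ### Classification of the n-types by boundedness, tightness, separation and control -/

/-- The problems with `n` input variables. -/
abbrev ProblemN (U : Structure.{u}) (n : ℕ) : Type u := {z : Problem U // z.Y.1.card = n}

/-- The parameter `ψ^b` is unbounded on the problems with `n` input variables. -/
def UnboundedAt (ψ : Measure U) (b : Param) (n : ℕ) : Prop :=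
  ∀ C, ∃ z : ProblemN U n, C < ψ.param b z.1

/-- For infinitely many `m` there is a problem with `ψ^i = ψ^d = m`. -/
def TightAt (ψ : Measure U) (n : ℕ) : Prop :=
  {m | ∃ z : ProblemN U n, ψ.param .i z.1 = m ∧ ψ.param .d z.1 = m}.Infinite

/-- `ψ^d` is unbounded on the problems with `ψ^a ≤ m`, for some `m`. -/
def SeparatedAt (ψ : Measure U) (n : ℕ) : Prop :=
  ∃ m, ∀ C, ∃ z : ProblemN U n, ψ.param .a z.1 ≤ m ∧ C < ψ.param .d z.1

/-- `ψ^a ≤ m` implies `ψ^d ≤ m` for infinitely many `m`. -/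
def ControlledAt (ψ : Measure U) (n : ℕ) : Prop :=
  {m | ∀ z : ProblemN U n, ψ.param .a z.1 ≤ m → ψ.param .d z.1 ≤ m}.Infinite

theorem exists_card {n : ℕ} (hn : 1 ≤ n) : ∃ Y : Vars, Y.1.card = n :=
  ⟨⟨Finset.range n, Finset.nonempty_range_iff.mpr (by omega)⟩, Finset.card_range n⟩

section Classification

variable {ψ : Measure U} {n : ℕ}

theorem nonempty_problemN (hψ : ψ.Limited) (hn : 1 ≤ n) : Nonempty (ProblemN U n) := by
  obtain ⟨Y, hY⟩ := exists_card hn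
  obtain ⟨z, hz, -⟩ := ψ.exists_trivial hψ Y 0
  exact ⟨⟨z, hz ▸ hY⟩⟩

theorem exists_trivialN (hψ : ψ.Limited) (hn : 1 ≤ n) (C : ℕ) :
    ∃ z : ProblemN U n, ψ.param .d z.1 ≤ ψ [] ∧ C < ψ.param .i z.1 := by
  obtain ⟨Y, hY⟩ := exists_card hn
  obtain ⟨z, hz, h1, h2⟩ := ψ.exists_trivial hψ Y C
  exact ⟨⟨z, hz ▸ hY⟩, h2, h1⟩

theorem infinite_values {f : ProblemN U n → ℕ} (h : ∀ C, ∃ z, C < f z) :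
    {m | ∃ z, f z = m ∧ f z = m}.Infinite :=
  infinite_setOf_of_unbounded fun C => (h C).elim fun z hz => ⟨f z, hz, z, rfl, rfl⟩

theorem lower_self {b : Param} (h : ∀ C, ∃ z : ProblemN U n, C < ψ.param b z.1) :
    typ (lower ψ n b b) = .γ :=
  (isLower_lower ψ n b b).typ_gamma_of_ge (fun _ => le_rfl)
    (infinite_values (f := fun z => ψ.param b z.1) h) h

theorem upper_self {b : Param} (hψ : ψ.Limited) (hn : 1 ≤ n) (h : UnboundedAt ψ b n) :
    typ (upper ψ n b b) = .γ :=
  have := nonempty_problemN hψ hn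
  (isUpper_upper ψ n b b).typ_gamma_of_le (fun _ => le_rfl)
    (infinite_values (f := fun z => ψ.param b z.1) h)

theorem unboundedAt_i (hψ : ψ.Limited) (hn : 1 ≤ n) : UnboundedAt ψ .i n := fun C =>
  (exists_trivialN hψ hn C).imp fun _ h => h.2

theorem lower_ii (hψ : ψ.Limited) (hn : 1 ≤ n) : typ (lower ψ n .i .i) = .γ :=
  lower_self (unboundedAt_i hψ hn)

theorem upper_ii (hψ : ψ.Limited) (hn : 1 ≤ n) : typ (upper ψ n .i .i) = .γ :=
  upper_self hψ hn (unboundedAt_i hψ hn)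

theorem upper_id (hψ : ψ.Limited) (hn : 1 ≤ n) : typ (upper ψ n .i .d) = .ε :=
  (isUpper_upper ψ n .i .d).typ_epsilon (exists_trivialN hψ hn)

theorem upper_ia (hψ : ψ.Limited) (hn : 1 ≤ n) : typ (upper ψ n .i .a) = .ε :=
  (isUpper_upper ψ n .i .a).typ_epsilon fun C => (exists_trivialN hψ hn C).imp fun z hz =>
    ⟨(ψ.param_a_le_param_d z.1).trans hz.1, hz.2⟩

theorem lower_di (hψ : ψ.Limited) (hn : 1 ≤ n) : typ (lower ψ n .d .i) = .α :=
  (isLower_lower ψ n .d .i).typ_alpha (exists_trivialN hψ hn)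

theorem lower_ai (hψ : ψ.Limited) (hn : 1 ≤ n) : typ (lower ψ n .a .i) = .α :=
  (isLower_lower ψ n .a .i).typ_alpha fun C => (exists_trivialN hψ hn C).imp fun z hz =>
    ⟨(ψ.param_a_le_param_d z.1).trans hz.1, hz.2⟩

theorem not_unboundedAt {b : Param} (h : ¬ UnboundedAt ψ b n) :
    ∃ C, ∀ z : ProblemN U n, ψ.param b z.1 ≤ C := by
  simpa [UnboundedAt] using h

theorem not_separatedAt (h : ¬ SeparatedAt ψ n) :
    ∀ m, ∃ C, ∀ z : ProblemN U n, ψ.param .a z.1 ≤ m → ψ.param .d z.1 ≤ C := by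
  unfold SeparatedAt at h
  push Not at h
  exact h

theorem UnboundedAt.d_of_a (h : UnboundedAt ψ .a n) : UnboundedAt ψ .d n := fun C =>
  (h C).imp fun z hz => hz.trans_le (ψ.param_a_le_param_d z.1)

theorem UnboundedAt.infinite_tight (h : UnboundedAt ψ .a n) :
    {m | ∃ z : ProblemN U n, ψ.param .i z.1 = m ∧ ψ.param .a z.1 = m}.Infinite :=
  infinite_setOf_of_unbounded fun C => by
    -- The summand `ψ []` ensures the hypothesis of `exists_param_i_eq_param_a`.
    obtain ⟨z, hz⟩ := h (C + ψ [])
    obtain ⟨z', h1, h2, h3⟩ := ψ.exists_param_i_eq_param_a z.1 (by omega)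
    exact ⟨_, by omega, ⟨z', h1 ▸ z.2⟩, h2, h3⟩

/-- `ψ^d` is squeezed between `ψ^a` and `ψ^i`, which coincide for these problems. -/
theorem UnboundedAt.infinite_tight_d_a (h : UnboundedAt ψ .a n) :
    {m | ∃ z : ProblemN U n, ψ.param .d z.1 = m ∧ ψ.param .a z.1 = m}.Infinite :=
  Set.Infinite.mono (by
    rintro m ⟨z, h1, h2⟩
    exact ⟨z, le_antisymm (h1 ▸ ψ.param_d_le_param_i z.1) (h2 ▸ ψ.param_a_le_param_d z.1), h2⟩)
    h.infinite_tight

theorem UnboundedAt.tightAt (h : UnboundedAt ψ .a n) : TightAt ψ n :=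
  Set.Infinite.mono (by
    rintro m ⟨z, h1, h2⟩
    exact ⟨z, h1, le_antisymm (h1 ▸ ψ.param_d_le_param_i z.1) (h2 ▸ ψ.param_a_le_param_d z.1)⟩)
    h.infinite_tight

theorem TightAt.unboundedAt_d (h : TightAt ψ n) : UnboundedAt ψ .d n := fun C => by
  obtain ⟨m, ⟨z, -, h2⟩, hm⟩ := h.exists_gt C
  exact ⟨z, h2 ▸ hm⟩

theorem swap_infinite {f g : ProblemN U n → ℕ} (h : {m | ∃ z, f z = m ∧ g z = m}.Infinite) :
    {m | ∃ z, g z = m ∧ f z = m}.Infinite := by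
  simpa only [and_comm] using h

theorem nType_eq_mkTable {ii id ia di dd da ai ad aa : FType × FType}
    (h1 : nType ψ n .i .i = ii) (h2 : nType ψ n .i .d = id) (h3 : nType ψ n .i .a = ia)
    (h4 : nType ψ n .d .i = di) (h5 : nType ψ n .d .d = dd) (h6 : nType ψ n .d .a = da)
    (h7 : nType ψ n .a .i = ai) (h8 : nType ψ n .a .d = ad) (h9 : nType ψ n .a .a = aa) :
    nType ψ n = mkTable ii id ia di dd da ai ad aa := by
  funext b c
  cases b <;> cases c <;> assumption

variable (hψ : ψ.Limited) (hn : 1 ≤ n)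
include hψ hn

theorem nType_eq_T₂ (hd : ¬ UnboundedAt ψ .d n) : nType ψ n = T₂ := by
  have := nonempty_problemN hψ hn
  obtain ⟨C, hC⟩ := not_unboundedAt hd
  have hC' : ∀ z : ProblemN U n, ψ.param .a z.1 ≤ C := fun z =>
    (ψ.param_a_le_param_d z.1).trans (hC z)
  exact nType_eq_mkTable
    (Prod.ext (lower_ii hψ hn) (upper_ii hψ hn))
    (Prod.ext ((isLower_lower ψ n _ _).typ_epsilon hC) (upper_id hψ hn))
    (Prod.ext ((isLower_lower ψ n _ _).typ_epsilon hC') (upper_ia hψ hn))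
    (Prod.ext (lower_di hψ hn) ((isUpper_upper ψ n _ _).typ_alpha hC))
    (Prod.ext ((isLower_lower ψ n _ _).typ_epsilon hC) ((isUpper_upper ψ n _ _).typ_alpha hC))
    (Prod.ext ((isLower_lower ψ n _ _).typ_epsilon hC') ((isUpper_upper ψ n _ _).typ_alpha hC))
    (Prod.ext (lower_ai hψ hn) ((isUpper_upper ψ n _ _).typ_alpha hC'))
    (Prod.ext ((isLower_lower ψ n _ _).typ_epsilon hC) ((isUpper_upper ψ n _ _).typ_alpha hC'))
    (Prod.ext ((isLower_lower ψ n _ _).typ_epsilon hC') ((isUpper_upper ψ n _ _).typ_alpha hC'))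

/-- With `ψ^a` bounded and `ψ^d` unbounded, tightness affects only the two entries that compare `i`
with `d`: it decides between δ and γ for the minimum and between β and γ for the maximum. -/
theorem nType_eq_T₃ (hd : UnboundedAt ψ .d n) (ha : ¬ UnboundedAt ψ .a n)
    (ht : ¬ TightAt ψ n) : nType ψ n = T₃ := by
  have := nonempty_problemN hψ hn
  obtain ⟨C, hC⟩ := not_unboundedAt ha
  have ht := Set.not_infinite.mp ht
  have ht' : {m | ∃ z : ProblemN U n, ψ.param .d z.1 = m ∧ ψ.param .i z.1 = m}.Finite := by
    simpa only [and_comm] using ht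
  exact nType_eq_mkTable
    (Prod.ext (lower_ii hψ hn) (upper_ii hψ hn))
    (Prod.ext ((isLower_lower ψ n _ _).typ_delta (fun z => ψ.param_d_le_param_i z.1) ht' hd)
      (upper_id hψ hn))
    (Prod.ext ((isLower_lower ψ n _ _).typ_epsilon hC) (upper_ia hψ hn))
    (Prod.ext (lower_di hψ hn)
      ((isUpper_upper ψ n _ _).typ_beta_of_le (fun z => ψ.param_d_le_param_i z.1) ht hd))
    (Prod.ext (lower_self hd) (upper_self hψ hn hd))
    (Prod.ext ((isLower_lower ψ n _ _).typ_epsilon hC)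
      ((isUpper_upper ψ n _ _).typ_epsilon (m := C) fun D => (hd D).imp fun z hz => ⟨hC z, hz⟩))
    (Prod.ext (lower_ai hψ hn) ((isUpper_upper ψ n _ _).typ_alpha hC))
    (Prod.ext ((isLower_lower ψ n _ _).typ_alpha (m := C) fun D => (hd D).imp fun z hz => ⟨hC z, hz⟩)
      ((isUpper_upper ψ n _ _).typ_alpha hC))
    (Prod.ext ((isLower_lower ψ n _ _).typ_epsilon hC) ((isUpper_upper ψ n _ _).typ_alpha hC))

theorem nType_eq_T₄ (ha : ¬ UnboundedAt ψ .a n) (ht : TightAt ψ n) : nType ψ n = T₄ := by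
  have := nonempty_problemN hψ hn
  have hd := ht.unboundedAt_d
  obtain ⟨C, hC⟩ := not_unboundedAt ha
  exact nType_eq_mkTable
    (Prod.ext (lower_ii hψ hn) (upper_ii hψ hn))
    (Prod.ext ((isLower_lower ψ n _ _).typ_gamma_of_ge (fun z => ψ.param_d_le_param_i z.1)
      (swap_infinite ht) hd) (upper_id hψ hn))
    (Prod.ext ((isLower_lower ψ n _ _).typ_epsilon hC) (upper_ia hψ hn))
    (Prod.ext (lower_di hψ hn)
      ((isUpper_upper ψ n _ _).typ_gamma_of_le (fun z => ψ.param_d_le_param_i z.1) ht))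
    (Prod.ext (lower_self hd) (upper_self hψ hn hd))
    (Prod.ext ((isLower_lower ψ n _ _).typ_epsilon hC)
      ((isUpper_upper ψ n _ _).typ_epsilon (m := C) fun D => (hd D).imp fun z hz => ⟨hC z, hz⟩))
    (Prod.ext (lower_ai hψ hn) ((isUpper_upper ψ n _ _).typ_alpha hC))
    (Prod.ext ((isLower_lower ψ n _ _).typ_alpha (m := C) fun D => (hd D).imp fun z hz => ⟨hC z, hz⟩)
      ((isUpper_upper ψ n _ _).typ_alpha hC))
    (Prod.ext ((isLower_lower ψ n _ _).typ_epsilon hC) ((isUpper_upper ψ n _ _).typ_alpha hC))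

/-- The common part of `T₅`, `T₆` and `T₇`: an unbounded `ψ^a` leaves open only how large `ψ^d` can
be for given `ψ^a`, and dually how small `ψ^a` can be for given `ψ^d`. -/
theorem nType_eq_of_unboundedAt_a (ha : UnboundedAt ψ .a n) {da ad : FType × FType}
    (hda : typ (upper ψ n .d .a) = da.2) (had : typ (lower ψ n .a .d) = ad.1)
    (h1 : da.1 = .γ) (h2 : ad.2 = .γ) :
    nType ψ n = mkTable (.γ, .γ) (.γ, .ε) (.γ, .ε) (.α, .γ) (.γ, .γ) da (.α, .γ) ad (.γ, .γ) := by
  have := nonempty_problemN hψ hn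
  have hd := ha.d_of_a
  exact nType_eq_mkTable
    (Prod.ext (lower_ii hψ hn) (upper_ii hψ hn))
    (Prod.ext ((isLower_lower ψ n _ _).typ_gamma_of_ge (fun z => ψ.param_d_le_param_i z.1)
      (swap_infinite ha.tightAt) hd) (upper_id hψ hn))
    (Prod.ext ((isLower_lower ψ n _ _).typ_gamma_of_ge
      (fun z => (ψ.param_a_le_param_d z.1).trans (ψ.param_d_le_param_i z.1))
      (swap_infinite ha.infinite_tight) ha) (upper_ia hψ hn))
    (Prod.ext (lower_di hψ hn)
      ((isUpper_upper ψ n _ _).typ_gamma_of_le (fun z => ψ.param_d_le_param_i z.1) ha.tightAt))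
    (Prod.ext (lower_self hd) (upper_self hψ hn hd))
    (Prod.ext (((isLower_lower ψ n _ _).typ_gamma_of_ge (fun z => ψ.param_a_le_param_d z.1)
      (swap_infinite ha.infinite_tight_d_a) ha).trans h1.symm) hda)
    (Prod.ext (lower_ai hψ hn) ((isUpper_upper ψ n _ _).typ_gamma_of_le
      (fun z => (ψ.param_a_le_param_d z.1).trans (ψ.param_d_le_param_i z.1)) ha.infinite_tight))
    (Prod.ext had (((isUpper_upper ψ n _ _).typ_gamma_of_le (fun z => ψ.param_a_le_param_d z.1)
      ha.infinite_tight_d_a).trans h2.symm))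
    (Prod.ext (lower_self ha) (upper_self hψ hn ha))

theorem nType_eq_T₅ (ha : UnboundedAt ψ .a n) (hs : ¬ SeparatedAt ψ n)
    (hc : ControlledAt ψ n) : nType ψ n = T₅ :=
  have := nonempty_problemN hψ hn
  nType_eq_of_unboundedAt_a hψ hn ha
    ((isUpper_upper ψ n _ _).typ_gamma_of_ge (not_separatedAt hs)
      (swap_infinite ha.infinite_tight_d_a) hc)
    ((isLower_lower ψ n _ _).typ_gamma_of_le ha.infinite_tight_d_a ha.d_of_a hc) rfl rfl

theorem nType_eq_T₆ (ha : UnboundedAt ψ .a n) (hs : ¬ SeparatedAt ψ n)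
    (hc : ¬ ControlledAt ψ n) : nType ψ n = T₆ :=
  have := nonempty_problemN hψ hn
  nType_eq_of_unboundedAt_a hψ hn ha
    ((isUpper_upper ψ n _ _).typ_delta (not_separatedAt hs) (Set.not_infinite.mp hc))
    ((isLower_lower ψ n _ _).typ_beta ha.d_of_a (not_separatedAt hs) (Set.not_infinite.mp hc))
    rfl rfl

theorem nType_eq_T₇ (ha : UnboundedAt ψ .a n) (hs : SeparatedAt ψ n) : nType ψ n = T₇ :=
  hs.elim fun _ hm => nType_eq_of_unboundedAt_a hψ hn ha
    ((isUpper_upper ψ n _ _).typ_epsilon hm) ((isLower_lower ψ n _ _).typ_alpha hm) rfl rfl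

end Classification

/-! ### Monotonicity in the number of input variables -/

section Monotone

variable {ψ : Measure U} {n : ℕ}

theorem exists_problemN_succ (ψ : Measure U) (z : ProblemN U n) :
    ∃ z' : ProblemN U (n + 1), ∀ b, ψ.param b z'.1 = ψ.param b z.1 := by
  obtain ⟨z', h1, h2⟩ := ψ.exists_succ z.1
  exact ⟨⟨z', by rw [h1, z.2]⟩, h2⟩

theorem UnboundedAt.succ {b : Param} (h : UnboundedAt ψ b n) : UnboundedAt ψ b (n + 1) :=
  fun C => by
    obtain ⟨z, hz⟩ := h C
    obtain ⟨z', hz'⟩ := exists_problemN_succ ψ z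
    exact ⟨z', by rwa [hz']⟩

theorem TightAt.succ (h : TightAt ψ n) : TightAt ψ (n + 1) :=
  Set.Infinite.mono (s := {m | ∃ z : ProblemN U n, ψ.param .i z.1 = m ∧ ψ.param .d z.1 = m}) (by
    rintro m ⟨z, h1, h2⟩
    obtain ⟨z', hz'⟩ := exists_problemN_succ ψ z
    exact ⟨z', by rwa [hz'], by rwa [hz']⟩) h

theorem SeparatedAt.succ (h : SeparatedAt ψ n) : SeparatedAt ψ (n + 1) := by
  obtain ⟨m, hm⟩ := h
  refine ⟨m, fun C => ?_⟩
  obtain ⟨z, h1, h2⟩ := hm C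
  obtain ⟨z', hz'⟩ := exists_problemN_succ ψ z
  exact ⟨z', by rwa [hz'], by rwa [hz']⟩

/-- Control is universally quantified over problems, so, unlike the other properties, it is
inherited downwards. -/
theorem ControlledAt.of_succ (h : ControlledAt ψ (n + 1)) : ControlledAt ψ n :=
  h.mono fun m hm z hz => by
    obtain ⟨z', hz'⟩ := exists_problemN_succ ψ z
    rw [← hz'] at hz ⊢
    exact hm z' hz

end Monotone

/-! ### Sequences of tables -/

/-- The tables `T₂, …, T₇`. -/
def tableOf : ℕ → Table
  | 0 => T₂
  | 1 => T₃
  | 2 => T₄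
  | 3 => T₅
  | 4 => T₆
  | _ => T₇

/-- `tableOf y` may follow `tableOf x` in a dynamic type. -/
def Follows (x y : ℕ) : Prop :=
  x ≤ y ∧ y ≤ 5 ∧ ((x = 1 ∨ x = 2) → y ≠ 3 ∧ y ≠ 4)

/-- Cut `c` at the first index where it differs from `x`. The block before the cut may be empty, and
then the rest starts with `c 0` itself; otherwise the first new value is a legal successor of `c 0 =
x`. The last disjunction records this. -/
theorem exists_peel (c : ℕ → ℕ) (hc : ∀ k, Follows (c k) (c (k + 1))) (x : ℕ) (hx : x ≤ c 0) :
    (tableOf ∘ c = rep (tableOf x)) ∨ ∃ i c', tableOf ∘ c = prep (tableOf x) i (tableOf ∘ c') ∧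
      (∀ k, Follows (c' k) (c' (k + 1))) ∧ x < c' 0 ∧ (c' 0 = c 0 ∨ Follows (c 0) (c' 0)) := by
  by_cases h : ∀ k, c k = x
  · left
    funext k
    simp [rep, h k]
  · right
    push Not at h
    classical
    have hi := Nat.find_spec h
    have hlt : ∀ k < Nat.find h, c k = x := fun k hk => not_not.mp (Nat.find_min h hk)
    refine ⟨Nat.find h, fun k => c (k + Nat.find h), ?_, fun k => ?_, ?_, ?_⟩
    · funext k
      simp only [prep, Function.comp]
      split_ifs with hk
      · rw [hlt k hk]
      · rw [Nat.sub_add_cancel (not_lt.mp hk)]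
    · have := hc (k + Nat.find h)
      rwa [Nat.add_right_comm] at this
    · simp only [zero_add]
      refine lt_of_le_of_ne (hx.trans ?_) hi.symm
      exact monotone_nat_of_le_succ (fun k => (hc k).1) (Nat.zero_le _)
    · simp only [zero_add]
      rcases hf : Nat.find h with - | i
      · exact Or.inl rfl
      · refine Or.inr ?_
        rw [hlt 0 (by omega), ← hlt i (by omega)]
        exact hc i

theorem tableOf_comp_mem_Δ (c : ℕ → ℕ) (hc : ∀ k, Follows (c k) (c (k + 1))) :
    tableOf ∘ c ∈ Δ := by
  have last : ∀ c : ℕ → ℕ, (∀ k, Follows (c k) (c (k + 1))) → 5 ≤ c 0 → tableOf ∘ c = rep T₇ := by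
    intro c hc h5
    rcases exists_peel c hc 5 h5 with h | ⟨_, c', -, h2, h3, -⟩
    · exact h
    · have := h2 0
      unfold Follows at this
      omega
  have zero : ∀ (T : Table) (s : ℕ → Table), s = prep T 0 s := fun T s => by
    funext k; simp [prep]
  have chain₁ : ∀ c : ℕ → ℕ, (∀ k, Follows (c k) (c (k + 1))) → (c 0 = 1 ∨ c 0 = 2 ∨ c 0 = 5) →
      (tableOf ∘ c = rep T₃) ∨ (∃ j, tableOf ∘ c = prep T₃ j (rep T₄)) ∨
      ∃ j k, tableOf ∘ c = prep T₃ j (prep T₄ k (rep T₇)) := by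
    intro c hc h0
    rcases exists_peel c hc 1 (by omega) with h | ⟨j, c', h1, h2, h3, h4⟩
    · exact Or.inl h
    have h0' : c' 0 = 2 ∨ c' 0 = 5 := by
      have := h2 0
      unfold Follows at *
      omega
    rcases exists_peel c' h2 2 (by omega) with h | ⟨k, c'', h1', h2', h3', h4'⟩
    · exact Or.inr (Or.inl ⟨j, by rw [h1, h]; rfl⟩)
    have h0'' : 5 ≤ c'' 0 := by
      have := h2' 0
      unfold Follows at *
      omega
    exact Or.inr (Or.inr ⟨j, k, by rw [h1, h1', last c'' h2' h0'']; rfl⟩)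
  have chain₂ : ∀ c : ℕ → ℕ, (∀ k, Follows (c k) (c (k + 1))) → (c 0 = 3 ∨ c 0 = 4) →
      (tableOf ∘ c = rep T₅) ∨ (∃ j, tableOf ∘ c = prep T₅ j (rep T₆)) ∨
      ∃ j k, tableOf ∘ c = prep T₅ j (prep T₆ k (rep T₇)) := by
    intro c hc h0
    rcases exists_peel c hc 3 (by omega) with h | ⟨j, c', h1, h2, h3, h4⟩
    · exact Or.inl h
    rcases exists_peel c' h2 4 (by omega) with h | ⟨k, c'', h1', h2', h3', h4'⟩
    · exact Or.inr (Or.inl ⟨j, by rw [h1, h]; rfl⟩)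
    exact Or.inr (Or.inr ⟨j, k, by rw [h1, h1', last c'' h2' (by omega)]; rfl⟩)
  rcases exists_peel c hc 0 (Nat.zero_le _) with h | ⟨i, c', h1, h2, h3, h4⟩
  · exact Or.inl h
  have h5 : c' 0 ≤ 5 := by
    have := h2 0
    unfold Follows at this
    omega
  -- After the block of `T₂` the first index decides the branch. A direct jump to `T₇` goes into the
  -- first branch, with empty blocks of `T₃` and `T₄`.
  by_cases h34 : c' 0 = 3 ∨ c' 0 = 4
  · rcases chain₂ c' h2 h34 with h | ⟨j, h⟩ | ⟨j, k, h⟩ <;> rw [h1, h]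
    · exact Or.inr (Or.inr (Or.inr (Or.inr (Or.inl ⟨i, rfl⟩))))
    · exact Or.inr (Or.inr (Or.inr (Or.inr (Or.inr (Or.inl ⟨i, j, rfl⟩)))))
    · exact Or.inr (Or.inr (Or.inr (Or.inr (Or.inr (Or.inr ⟨i, j, k, rfl⟩)))))
  · rcases chain₁ c' h2 (by omega) with h | ⟨j, h⟩ | ⟨j, k, h⟩ <;> rw [h1, h]
    · exact Or.inr (Or.inl ⟨i, rfl⟩)
    · exact Or.inr (Or.inr (Or.inl ⟨i, j, rfl⟩))
    · exact Or.inr (Or.inr (Or.inr (Or.inl ⟨i, j, k, rfl⟩)))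

open Classical in
/-- The index of the `n`-type of a limited sm-pair. -/
noncomputable def typeIndex (ψ : Measure U) (n : ℕ) : ℕ :=
  if UnboundedAt ψ .a n then
    if SeparatedAt ψ n then 5 else if ControlledAt ψ n then 3 else 4
  else if UnboundedAt ψ .d n then
    if TightAt ψ n then 2 else 1
  else 0

theorem nType_eq_tableOf {ψ : Measure U} (hψ : ψ.Limited) {n : ℕ} (hn : 1 ≤ n) :
    nType ψ n = tableOf (typeIndex ψ n) := by
  unfold typeIndex
  split_ifs with h1 h2 h3 h4 h5
  · exact nType_eq_T₇ hψ hn h1 h2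
  · exact nType_eq_T₅ hψ hn h1 h2 h3
  · exact nType_eq_T₆ hψ hn h1 h2 h3
  · exact nType_eq_T₄ hψ hn h1 h5
  · exact nType_eq_T₃ hψ hn h4 h1 h5
  · exact nType_eq_T₂ hψ hn h4

theorem follows_typeIndex (ψ : Measure U) (n : ℕ) :
    Follows (typeIndex ψ n) (typeIndex ψ (n + 1)) := by
  have ha : UnboundedAt ψ .a n → UnboundedAt ψ .a (n + 1) := UnboundedAt.succ
  have hd : UnboundedAt ψ .d n → UnboundedAt ψ .d (n + 1) := UnboundedAt.succ
  have had : UnboundedAt ψ .a n → UnboundedAt ψ .d n := UnboundedAt.d_of_a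
  have ht : TightAt ψ n → TightAt ψ (n + 1) := TightAt.succ
  have hs : SeparatedAt ψ n → SeparatedAt ψ (n + 1) := SeparatedAt.succ
  have hc : ControlledAt ψ (n + 1) → ControlledAt ψ n := ControlledAt.of_succ
  -- This forbids passing from `T₃` or `T₄` to `T₅` or `T₆`: the separation present now persists, so
  -- once `ψ^a` becomes unbounded the table is `T₇`.
  have hs' : ¬ UnboundedAt ψ .a n → UnboundedAt ψ .d n → SeparatedAt ψ n := fun h h' => by
    obtain ⟨C, hC⟩ := not_unboundedAt h
    exact ⟨C, fun D => (h' D).imp fun z hz => ⟨hC z, hz⟩⟩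
  unfold typeIndex Follows
  by_cases h1 : UnboundedAt ψ .a n
  · simp only [h1, ha h1, if_true]
    by_cases h2 : SeparatedAt ψ n
    · simp [h2, hs h2]
    · by_cases h3 : ControlledAt ψ n
      · simp only [h2, h3, if_true, if_false]
        split_ifs <;> omega
      · simp only [h2, h3, mt hc h3, if_false]
        split_ifs <;> omega
  · by_cases h2 : UnboundedAt ψ .d n
    · simp only [h1, h2, hd h2, hs (hs' h1 h2), if_true, if_false]
      by_cases h3 : TightAt ψ n
      · simp only [h3, ht h3, if_true]
        split_ifs <;> omega
      · simp only [h3, if_false]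
        split_ifs <;> omega
    · simp only [h1, h2, if_false]
      split_ifs <;> simp

theorem dtyp_mem_Δ {ψ : Measure U} (hψ : ψ.Limited) : dtyp ψ ∈ Δ := by
  have : dtyp ψ = tableOf ∘ fun k => typeIndex ψ (k + 1) :=
    funext fun k => nType_eq_tableOf hψ (by omega)
  rw [this]
  exact tableOf_comp_mem_Δ _ fun k => follows_typeIndex ψ (k + 1)

theorem nType_ne_T₁ {ψ : Measure U} (hψ : ψ.Limited) {n : ℕ} (hn : 1 ≤ n) : nType ψ n ≠ T₁ := by
  intro h
  have h1 : typ (lower ψ n .i .i) = FType.ε := congrArg (fun T : Table => (T .i .i).1) h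
  rw [lower_ii hψ hn] at h1
  exact FType.noConfusion h1


/-! ### Structures without functions -/

/-- The value of a predicate expression. -/
def Expr.val : Expr U → (ℕ → U.A) → Bool
  | .func _ _ _, _ => false
  | .pred p q, s => p.1.2 fun i => s (q i)

/-- Only functional expressions change variables, so every predicate is evaluated at the initial
values. -/
theorem predVals_eq_map [IsEmpty U.F] (β : List (Expr U)) (s : ℕ → U.A) :
    predVals β s = β.map fun e => e.val s := by
  induction β with
  | nil => rfl
  | cons e β ih =>
    cases e with
    | func j f l => exact (IsEmpty.false f).elim
    | pred p q => exact congrArg _ ih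

theorem predCount_eq_length [IsEmpty U.F] (β : List (Expr U)) : predCount β = β.length := by
  obtain ⟨x⟩ := U.nonempty_A
  rw [← length_predVals β fun _ => x, predVals_eq_map, List.length_map]

theorem Problem.solutions_congr [IsEmpty U.F] (z : Problem U) {a a' : Input U z.Y}
    (h : ∀ e ∈ z.β, e.val (initVal z.Y a) = e.val (initVal z.Y a')) :
    z.solutions a = z.solutions a' := by
  have : PiTuple z.Y z.β a = PiTuple z.Y z.β a' := Subtype.ext (by
    change predVals _ _ = predVals _ _
    rw [predVals_eq_map, predVals_eq_map]
    exact List.map_congr_left h)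
  rw [Problem.solutions, this, Problem.solutions]

theorem Problem.exists_mem_solutions (z : Problem U) (a : Input U z.Y) :
    ∃ κ, κ ∈ z.solutions a := (z.ν (PiTuple z.Y z.β a)).2

/-- If more than `2 ^ c` inputs are accepted by a deterministic tree each path of which contains
at most `c` expressions that distinguish these inputs, then two of them follow the same path. -/
theorem Node.exists_common_path [IsEmpty U.F] {I : Type*} (s : I → ℕ → U.A) (D : Expr U → Bool)
    (hD : ∀ e, D e = false → ∀ i j, e.val (s i) = e.val (s j)) (v : Node U)
    (hv : v.Deterministic) (c : ℕ) (hc : ∀ ξ, (v.exprs ξ).countP D ≤ c) (J : Finset I)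
    (hJ : 2 ^ c < J.card) (hpath : ∀ i ∈ J, ∃ ξ, predVals (v.exprs ξ) (s i) = v.labels ξ) :
    ∃ i ∈ J, ∃ j ∈ J, i ≠ j ∧ ∃ ξ, predVals (v.exprs ξ) (s i) = v.labels ξ ∧
      predVals (v.exprs ξ) (s j) = v.labels ξ := by
  induction v generalizing c J with
  | term κ =>
    obtain ⟨i, hi, j, hj, hij⟩ := Finset.one_lt_card.mp (Nat.one_le_two_pow.trans_lt hJ)
    exact ⟨i, hi, j, hj, hij, (), rfl, rfl⟩
  | func j f l k child ih => exact (IsEmpty.false f).elim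
  | pred p q k δ child ih =>
    let e : Expr U := .pred p q
    have key : ∀ (c' : ℕ) (J' : Finset I), J' ⊆ J → 2 ^ c' < J'.card →
        (∀ i ∈ J', ∀ j ∈ J', e.val (s i) = e.val (s j)) →
        (∀ x ξ, ((child x).exprs ξ).countP D ≤ c') →
        ∃ i ∈ J, ∃ j ∈ J, i ≠ j ∧ ∃ ξ : (Node.pred p q k δ child).Path,
          predVals ((Node.pred p q k δ child).exprs ξ) (s i) =
            (Node.pred p q k δ child).labels ξ ∧
          predVals ((Node.pred p q k δ child).exprs ξ) (s j) =
            (Node.pred p q k δ child).labels ξ := by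
      intro c' J' hsub hcard hconst hc'
      -- One input fixes the outgoing edge; as edges have different labels and `e` is constant on
      -- `J'`, all of `J'` enters the same child.
      obtain ⟨i₀, hi₀⟩ := Finset.card_pos.mp ((Nat.zero_le _).trans_lt hcard)
      obtain ⟨⟨x₀, ξ₀⟩, h₀⟩ := hpath i₀ (hsub hi₀)
      have h₀' : e.val (s i₀) = δ x₀ := (List.cons.inj h₀).1
      obtain ⟨i, hi, j, hj, hij, ξ, h1, h2⟩ := ih x₀ (hv.2 x₀) c' (hc' x₀) J' hcard fun i hi => by
        obtain ⟨⟨x, ξ⟩, h⟩ := hpath i (hsub hi)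
        have h1 : e.val (s i) = δ x := (List.cons.inj h).1
        obtain rfl : x = x₀ := hv.1 (by rw [← h1, ← h₀', hconst i hi i₀ hi₀])
        exact ⟨ξ, (List.cons.inj h).2⟩
      exact ⟨i, hsub hi, j, hsub hj, hij, ⟨x₀, ξ⟩,
        congrArg₂ List.cons ((hconst i hi i₀ hi₀).trans h₀') h1,
        congrArg₂ List.cons ((hconst j hj i₀ hi₀).trans h₀') h2⟩
    have hcount : ∀ x ξ, ((child x).exprs ξ).countP D + (if D e then 1 else 0) ≤ c := fun x ξ => by
      have := hc ⟨x, ξ⟩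
      rwa [show (Node.pred p q k δ child).exprs ⟨x, ξ⟩ = e :: (child x).exprs ξ from rfl,
        List.countP_cons] at this
    cases hDe : D e with
    | false =>
      exact key c J (Finset.Subset.refl _) hJ (fun i _ j _ => hD e hDe i j) fun x ξ =>
        (Nat.le_add_right _ _).trans (hcount x ξ)
    | true =>
      simp only [hDe, if_true] at hcount
      obtain ⟨c, rfl⟩ : ∃ c', c = c' + 1 := by
        obtain ⟨ξ⟩ := (child 0).nonempty_path
        exact ⟨c - 1, by have := hcount 0 ξ; omega⟩
      -- An adversary's choice: one of the two outcomes keeps at least half of the inputs.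
      obtain ⟨b, hb⟩ : ∃ b, 2 ^ c < (J.filter fun i => e.val (s i) = b).card := by
        by_contra hcon
        push Not at hcon
        have h1 := hcon true
        have h2 := hcon false
        have h3 := Finset.card_filter_add_card_filter_not (s := J) fun i => e.val (s i) = true
        simp only [Bool.not_eq_true] at h3
        rw [pow_succ] at hJ
        omega
      refine key c _ (Finset.filter_subset _ _) hb (fun i hi j hj => ?_) fun x ξ =>
        Nat.le_of_succ_le_succ (hcount x ξ)
      rw [(Finset.mem_filter.mp hi).2, (Finset.mem_filter.mp hj).2]

/-- In a tree of cost at most `m` each path has at most `c` distinguishing queries, so two inputs of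
`J` reach the same terminal node. Its number would solve both, against the disjointness of their
solution sets. -/
theorem Measure.lt_param_d [IsEmpty U.F] (ψ : Measure U) (z : Problem U) {I : Type*}
    (a : I → Input U z.Y) (J : Finset I) (D : Expr U → Bool) {m c : ℕ}
    (hD : ∀ e, D e = false → ∀ i j, e.val (initVal z.Y (a i)) = e.val (initVal z.Y (a j)))
    (hm : ∀ β : List (Expr U), ψ.ofExprs β ≤ m → β.countP D ≤ c) (hJ : 2 ^ c < J.card)
    (hsol : ∀ i ∈ J, ∀ j ∈ J, i ≠ j → ∀ κ ∈ z.solutions (a i), κ ∉ z.solutions (a j)) :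
    m < ψ.param .d z := by
  by_contra hcon
  obtain ⟨Γ, ⟨⟨hk, hdet⟩, hsolves⟩, e⟩ := ψ.exists_tree_d z
  obtain ⟨-, h2, h3⟩ := (Γ.solvesN_iff z).mp hsolves
  have hx : ∀ x : Fin (Γ.k + 1), x = 0 := fun x => Fin.ext (by
    have := x.2
    simp only [Fin.val_zero]
    omega)
  obtain ⟨i, hi, j, hj, hij, ξ, hξi, hξj⟩ := Node.exists_common_path
    (fun i => initVal z.Y (a i)) D hD (Γ.child 0) (hdet 0) c
    (fun ξ => hm _ (((ψ.ofExprs_le_ofTree Γ ⟨0, ξ⟩).trans e.le).trans (not_lt.mp hcon))) J hJ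
    (fun i _ => by
      obtain ⟨⟨x, ξ⟩, hξ⟩ := h2 (a i)
      obtain rfl := hx x
      exact ⟨ξ, hξ⟩)
  exact hsol i hi j hj hij _ (h3 (a i) ⟨0, ξ⟩ hξi) (h3 (a j) ⟨0, ξ⟩ hξj)

/-! ### Weighted depths -/

/-- The weighted depth given by `w`. -/
def weightedDepth (w : Symb U → ℕ) : Measure U := fun α => (α.map w).sum

theorem weightedDepth_limited {w : Symb U → ℕ} (hw : ∀ b, 0 < w b) :
    (weightedDepth w).Limited where
  subadditive α₁ α₂ := by simp [weightedDepth]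
  deletion α₁ α₂ α₃ := by simp [weightedDepth]
  length_le α := by
    induction α with
    | nil => exact Nat.zero_le _
    | cons b α ih =>
      have := hw b
      simp only [weightedDepth, List.map_cons, List.sum_cons, List.length_cons] at *
      omega

/-- The weight of an expression. -/
def Expr.weight (w : Symb U → ℕ) (e : Expr U) : ℕ := w e.symb

theorem ofExprs_weightedDepth (w : Symb U → ℕ) (β : List (Expr U)) :
    (weightedDepth w).ofExprs β = (β.map (Expr.weight w)).sum := by
  rw [Measure.ofExprs, weightedDepth, List.map_map]
  rfl

theorem weight_le_ofExprs (w : Symb U → ℕ) {β : List (Expr U)} {e : Expr U} (he : e ∈ β) :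
    e.weight w ≤ (weightedDepth w).ofExprs β := by
  rw [ofExprs_weightedDepth]
  exact List.single_le_sum (fun _ _ => Nat.zero_le _) _ (List.mem_map_of_mem he)

theorem countP_mul_le_ofExprs (w : Symb U → ℕ) (D : Expr U → Bool) (k : ℕ)
    (hD : ∀ e, D e = true → k ≤ e.weight w) (β : List (Expr U)) :
    β.countP D * k ≤ (weightedDepth w).ofExprs β := by
  rw [ofExprs_weightedDepth]
  induction β with
  | nil => simp
  | cons e β ih =>
    rw [List.countP_cons, List.map_cons, List.sum_cons, add_mul]
    split_ifs with h
    · have := hD e h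
      omega
    · omega

theorem ofExprs_le_length_mul (w : Symb U → ℕ) (k : ℕ) {β : List (Expr U)}
    (h : ∀ e ∈ β, e.weight w ≤ k) : (weightedDepth w).ofExprs β ≤ β.length * k := by
  rw [ofExprs_weightedDepth]
  have := List.sum_le_card_nsmul (β.map (Expr.weight w)) k (by simpa using h)
  simpa using this

/-- If the values of all predicates are determined by the positions of finitely many elements of
linear orders with respect to given thresholds, then two thresholds per element certify these
positions. -/
theorem param_a_le_of_thresholds [IsEmpty U.F] (w : Symb U → ℕ) (z : Problem U) {σ : Type*}
    [Fintype σ] (th : σ → ℕ → Expr U) (K : ℕ) (hw : ∀ s k, (th s k).weight w = 1)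
    (h0 : ∀ s a, (th s 0).val (initVal z.Y a) = false)
    (hmono : ∀ s a k, (th s k).val (initVal z.Y a) = true →
      (th s (k + 1)).val (initVal z.Y a) = true)
    (hdet : ∀ a a', (∀ s, ∀ k ≤ K, (th s k).val (initVal z.Y a) =
      (th s k).val (initVal z.Y a')) → z.solutions a = z.solutions a') :
    (weightedDepth w).param .a z ≤ 2 * Fintype.card σ := by
  classical
  have hmono' : ∀ s a k k', k ≤ k' → (th s k).val (initVal z.Y a) = true →
      (th s k').val (initVal z.Y a) = true := fun s a k k' hk h => by
    induction k', hk using Nat.le_induction with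
    | base => exact h
    | succ k' _ ih => exact hmono s a k' ih
  let L : List σ := Finset.univ.toList
  have hL : ∀ s, s ∈ L := fun s => Finset.mem_toList.mpr (Finset.mem_univ s)
  -- For each `s` the rule claims that `κ s` is the last failing threshold up to `K`. When `κ s = K`
  -- the second query just repeats the first, and both must be false.
  let β : (σ → Fin (K + 1)) → List (Expr U) := fun κ =>
    L.map (fun s => th s (κ s)) ++ L.map fun s => th s (min (κ s + 1) K)
  let t : (σ → Fin (K + 1)) → List Bool := fun κ =>
    L.map (fun _ => false) ++ L.map fun s => decide ((κ s : ℕ) < K)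
  have hrule : ∀ κ a, predVals (β κ) (initVal z.Y a) = t κ ↔ ∀ s,
      (th s (κ s)).val (initVal z.Y a) = false ∧
      (th s (min (κ s + 1) K)).val (initVal z.Y a) = decide ((κ s : ℕ) < K) := by
    intro κ a
    simp only [predVals_eq_map, β, t, List.map_append, List.map_map]
    constructor
    · intro h s
      obtain ⟨h1, h2⟩ := List.append_inj h (by simp)
      exact ⟨List.map_inj_left.mp h1 s (hL s), List.map_inj_left.mp h2 s (hL s)⟩
    · intro h
      exact congrArg₂ _ (List.map_inj_left.mpr fun s _ => (h s).1)
        (List.map_inj_left.mpr fun s _ => (h s).2)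
  have hval : ∀ κ a, predVals (β κ) (initVal z.Y a) = t κ → ∀ s, ∀ k ≤ K,
      (th s k).val (initVal z.Y a) = decide ((κ s : ℕ) < k) := by
    intro κ a h s k hk
    obtain ⟨h1, h2⟩ := (hrule κ a).mp h s
    by_cases hlt : (κ s : ℕ) < k
    · rw [decide_eq_true hlt]
      rw [decide_eq_true (hlt.trans_le hk)] at h2
      exact hmono' s a _ k (by omega) h2
    · rw [decide_eq_false hlt, ← Bool.not_eq_true]
      intro h3
      rw [hmono' s a k _ (not_lt.mp hlt) h3] at h1
      exact Bool.noConfusion h1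
  let r : (σ → Fin (K + 1)) → ℕ := fun κ =>
    if h : ∃ a, predVals (β κ) (initVal z.Y a) = t κ then
      (z.exists_mem_solutions h.choose).choose else 0
  refine (weightedDepth w).param_a_le_of_rules z β t r (fun κ => ?_) (fun a => ?_) fun a κ h => ?_
  · refine (ofExprs_le_length_mul w 1 ?_).trans ?_
    · intro e he
      rcases List.mem_append.mp he with he | he <;>
        obtain ⟨s, -, rfl⟩ := List.mem_map.mp he <;> exact (hw _ _).le
    · simp [β, L]
      omega
  · let P : σ → ℕ → Prop := fun s k => (th s k).val (initVal z.Y a) = false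
    have hP : ∀ s, P s (Nat.findGreatest (P s) K) := fun s =>
      Nat.findGreatest_spec (P := P s) (Nat.zero_le K) (h0 s a)
    refine ⟨fun s => ⟨Nat.findGreatest (P s) K, Nat.lt_succ_of_le (Nat.findGreatest_le K)⟩,
      (hrule _ a).mpr fun s => ⟨hP s, ?_⟩⟩
    have hle := Nat.findGreatest_le (P := P s) K
    simp only
    by_cases hlt : Nat.findGreatest (P s) K < K
    · rw [decide_eq_true hlt, min_eq_left hlt, ← Bool.not_eq_false]
      exact Nat.findGreatest_is_greatest (P := P s) (Nat.lt_succ_self _) hlt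
    · rw [decide_eq_false hlt, min_eq_right (by omega)]
      have := hP s
      rwa [show Nat.findGreatest (P s) K = K by omega] at this
  · have hex : ∃ a, predVals (β κ) (initVal z.Y a) = t κ := ⟨a, h⟩
    simp only [r, dif_pos hex]
    rw [hdet a hex.choose fun s k hk => by
      rw [hval κ a h s k hk, hval κ _ hex.choose_spec s k hk]]
    exact (z.exists_mem_solutions hex.choose).choose_spec

/-- If the values of all cheap expressions are determined by `L`, then executing `L` solves
every problem of small nondeterministic complexity. -/
theorem param_d_le_of_cheap [IsEmpty U.F] (w : Symb U → ℕ) (z : Problem U) {m : ℕ}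
    (L : List (Expr U)) (ha : (weightedDepth w).param .a z ≤ m)
    (hL : ∀ e : Expr U, e.weight w ≤ m →
      (∀ a, e.val (initVal z.Y a) = false) ∨
      ∃ l ∈ L, ∀ a, e.val (initVal z.Y a) = l.val (initVal z.Y a)) :
    (weightedDepth w).param .d z ≤ (weightedDepth w).ofExprs L := by
  obtain ⟨ι, _, β, t, κ, h1, h2, h3⟩ := (weightedDepth w).exists_rules z
  -- An input that agrees with `a` on `L` also agrees with it on the affordable queries of the rule
  -- covering `a`, so the answer of that rule is valid for both.
  refine (weightedDepth w).param_d_le_ofExprs z L fun a => ?_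
  obtain ⟨i, hi⟩ := h2 a
  refine ⟨κ i, fun a' h => h3 a' i ?_⟩
  rw [← hi, predVals_eq_map, predVals_eq_map]
  rw [predVals_eq_map, predVals_eq_map] at h
  refine List.map_congr_left fun e he => ?_
  rcases hL e ((weight_le_ofExprs w he).trans ((h1 i).trans ha)) with h0 | ⟨l, hl, hl'⟩
  · rw [h0, h0]
  · rw [hl', hl']
    exact List.map_inj_left.mp h l hl


/-! ### A family of structures -/

/-- The kinds of elements and of predicates. -/
inductive Tag
  | C | R | V | G | O
  deriving DecidableEq

instance : Fintype Tag := ⟨{.C, .R, .V, .G, .O}, fun f => by cases f <;> decide⟩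

namespace Model

/-- Elements of the universe: numbers with tags. -/
abbrev Pt : Type u := ULift.{u} (Tag × ℕ)

/-- The last number of an injective tuple the last element of which has the tag `f`. -/
noncomputable def lastNum (f : Tag) {M : ℕ} (x : Fin (M + 1) → Pt.{u}) : Option ℕ :=
  open Classical in
  if Function.Injective x ∧ (x (Fin.last M)).down.1 = f then some (x (Fin.last M)).down.2 else none

theorem lastNum_eq_some {f : Tag} {N v : ℕ} {x : Fin (N + 1) → Pt.{u}}
    (hx : Function.Injective x) (hlast : (x (Fin.last N)).down = (f, v)) :
    lastNum f x = some v := by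
  unfold lastNum
  rw [if_pos ⟨hx, by rw [hlast]⟩, hlast]

theorem lastNum_eq_none {f : Tag} {N : ℕ} {x : Fin (N + 1) → Pt.{u}}
    (h : Function.Injective x → (x (Fin.last N)).down.1 ≠ f) : lastNum f x = none := by
  unfold lastNum
  rw [if_neg fun h' => h h'.1 h'.2]

/-- The predicate `lastNum f x ∈ S`. -/
noncomputable def prd (f : Tag) (M : ℕ) (S : Finset ℕ) : Σ n : ℕ, (Fin n → Pt.{u}) → Bool :=
  ⟨M + 1, fun x => (lastNum f x).any fun v => decide (v ∈ S)⟩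

/-- Two of the three numbers `3m, 3m+1, 3m+2`. -/
def gadget (m j : ℕ) : Finset ℕ := Finset.erase {3 * m, 3 * m + 1, 3 * m + 2} (3 * m + j)

/-- The sets `S` for which predicates with the tag `f` are considered. -/
def baseFam : Tag → Set (Finset ℕ)
  | .C => {S | ∃ k, S = Finset.range k}
  | .R => Set.univ
  | .V => {S | ∃ k, S = {k}}
  | .G => {S | ∃ m j, j < 3 ∧ S = gadget m j}
  | .O => ∅

/-- The sets `S` for which there are predicates with the tag `f`, if only the tags from `on` are
used. -/
def fam (on : Tag → Prop) (f : Tag) : Set (Finset ℕ) := {S | S = ∅ ∨ on f ∧ S ∈ baseFam f}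

/-- The constantly false predicates keep the set of predicates nonempty even when no tag is used. -/
theorem empty_mem_fam (on : Tag → Prop) (f : Tag) : ∅ ∈ fam on f := Or.inl rfl

variable (M : Tag → ℕ) (on : Tag → Prop)

/-- The structure without functions and with the predicates `lastNum f x ∈ S` of arity `M f + 1`
for `S ∈ fam on f`. -/
noncomputable abbrev str : Structure.{u} where
  A := Pt
  nonempty_A := ⟨⟨.C, 0⟩⟩
  F := ∅
  P := {p | ∃ f, ∃ S ∈ fam on f, p = prd f (M f) S}
  nonempty_P := ⟨_, .C, ∅, empty_mem_fam on .C, rfl⟩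
  arity_pos := by
    rintro _ ⟨f, S, -, rfl⟩
    exact Nat.succ_pos _

instance : IsEmpty (str.{u} M on).F := inferInstanceAs (IsEmpty (∅ : Set _))

/-- The numbers `v` for which the predicate accepts an injective tuple with the last element
`(f, v)`. -/
def support (p : Σ n : ℕ, (Fin n → Pt.{u}) → Bool) (f : Tag) : Set ℕ :=
  {v | p.2 (fun i => ⟨f, if i.1 + 1 = p.1 then v else v + 1 + i.1⟩) = true}

/-- Symbols of the structure are bare functions, so the weight must recover the tag and the set from
the values. The filler numbers `v + 1 + i` make the probing tuple injective. -/
theorem mem_support_prd (f f' : Tag) (N : ℕ) (S : Finset ℕ) (v : ℕ) :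
    v ∈ support (prd.{u} f N S) f' ↔ f' = f ∧ v ∈ S := by
  let x : Fin (N + 1) → Pt.{u} := fun i => ⟨f', if i.1 + 1 = N + 1 then v else v + 1 + i.1⟩
  have hx : Function.Injective x := fun i j h => by
    have h' : (if i.1 + 1 = N + 1 then v else v + 1 + i.1) =
        if j.1 + 1 = N + 1 then v else v + 1 + j.1 := congrArg (fun y : Pt => y.down.2) h
    ext
    split_ifs at h' <;> omega
  have hlast : x (Fin.last N) = ⟨f', v⟩ := by simp [x]
  change (lastNum f x).any _ = true ↔ _
  by_cases hf : f' = f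
  · subst hf
    rw [lastNum_eq_some hx (congrArg ULift.down hlast)]
    simp
  · rw [lastNum_eq_none fun _ => by rw [hlast]; exact hf]
    simp [hf]

open Classical in
/-- The weight of a predicate. -/
noncomputable def predWeight (p : Σ n : ℕ, (Fin n → Pt.{u}) → Bool) : ℕ :=
  if (support p .V).Nonempty then (sInf (support p .V)).factorial ^ 2
  else if (support p .G).Nonempty then sInf (support p .G) / 3 + 1
  else 1

/-- The weights of symbols. -/
noncomputable def wt : Symb (str.{u} M on) → ℕ
  | .inl _ => 1
  | .inr p => predWeight p.1

theorem wt_pos (b : Symb (str.{u} M on)) : 0 < wt M on b := by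
  cases b with
  | inl f => exact one_pos
  | inr p =>
    change 0 < predWeight p.1
    unfold predWeight
    split_ifs
    · exact pow_pos (Nat.factorial_pos _) 2
    · exact Nat.succ_pos _
    · exact one_pos

theorem support_prd_self (f : Tag) (N : ℕ) (S : Finset ℕ) : support (prd.{u} f N S) f = ↑S := by
  ext v
  simp [mem_support_prd]

theorem support_prd_of_ne {f f' : Tag} (h : f' ≠ f) (N : ℕ) (S : Finset ℕ) :
    support (prd.{u} f N S) f' = ∅ := by
  ext v
  simp [mem_support_prd, h]

theorem predWeight_V (N k : ℕ) : predWeight (prd.{u} .V N {k}) = k.factorial ^ 2 := by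
  rw [predWeight, support_prd_self, if_pos (by simp)]
  simp

theorem sInf_gadget (m : ℕ) {j : ℕ} (hj : j < 3) :
    (gadget m j : Set ℕ).Nonempty ∧ sInf (gadget m j : Set ℕ) / 3 = m := by
  have hne : (gadget m j : Set ℕ).Nonempty := by
    by_cases h : j = 0
    · exact ⟨3 * m + 1, by simp [gadget]; omega⟩
    · exact ⟨3 * m, by simp [gadget]; omega⟩
  refine ⟨hne, ?_⟩
  have := Nat.sInf_mem hne
  generalize sInf (gadget m j : Set ℕ) = x at this ⊢
  simp [gadget] at this
  omega

theorem predWeight_G (N m : ℕ) {j : ℕ} (hj : j < 3) :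
    predWeight (prd.{u} .G N (gadget m j)) = m + 1 := by
  obtain ⟨h1, h2⟩ := sInf_gadget m hj
  rw [predWeight, support_prd_of_ne (by decide), support_prd_self, if_neg (by simp), if_pos h1, h2]

theorem predWeight_CR {f : Tag} (hf : f = .C ∨ f = .R) (N : ℕ) (S : Finset ℕ) :
    predWeight (prd.{u} f N S) = 1 := by
  rw [predWeight, support_prd_of_ne (by rcases hf with rfl | rfl <;> decide),
    support_prd_of_ne (by rcases hf with rfl | rfl <;> decide)]
  simp

variable {M on}

/-- The expression `lastNum f (x_{q 0}, …, x_{q (M f)}) ∈ S`. -/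
noncomputable def mk (f : Tag) (S : Finset ℕ) (hS : S ∈ fam on f) (q : Fin (M f + 1) → ℕ) :
    Expr (str.{u} M on) :=
  .pred ⟨prd f (M f) S, f, S, hS, rfl⟩ q

theorem exists_eq_mk (e : Expr (str.{u} M on)) : ∃ f S hS q, e = mk f S hS q := by
  cases e with
  | func j f l => exact (IsEmpty.false f).elim
  | pred p q =>
    obtain ⟨p, f, S, hS, rfl⟩ := p
    exact ⟨f, S, hS, q, rfl⟩

theorem val_mk (f : Tag) (S : Finset ℕ) (hS : S ∈ fam on f) (q : Fin (M f + 1) → ℕ)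
    (s : ℕ → Pt.{u}) : (mk f S hS q : Expr (str M on)).val s =
      (lastNum f fun i => s (q i)).any fun v => decide (v ∈ S) := rfl

theorem weight_mk_V (k : ℕ) (hS : {k} ∈ fam on .V) (q : Fin (M .V + 1) → ℕ) :
    (mk .V {k} hS q : Expr (str.{u} M on)).weight (wt M on) = k.factorial ^ 2 :=
  predWeight_V _ _

theorem weight_mk_G (m : ℕ) {j : ℕ} (hj : j < 3) (hS : gadget m j ∈ fam on .G)
    (q : Fin (M .G + 1) → ℕ) :
    (mk .G (gadget m j) hS q : Expr (str.{u} M on)).weight (wt M on) = m + 1 :=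
  predWeight_G _ _ hj

theorem weight_mk_CR {f : Tag} (hf : f = .C ∨ f = .R) (S : Finset ℕ) (hS : S ∈ fam on f)
    (q : Fin (M f + 1) → ℕ) :
    (mk f S hS q : Expr (str.{u} M on)).weight (wt M on) = 1 :=
  predWeight_CR hf _ _

theorem weight_pos (e : Expr (str.{u} M on)) : 0 < e.weight (wt M on) := wt_pos M on _

/-- The measure considered on `str M on`. -/
noncomputable abbrev msr (M : Tag → ℕ) (on : Tag → Prop) : Measure (str.{u} M on) :=
  weightedDepth (wt M on)

/-! #### Inputs -/

/-- The input variable the value of which is the initial value of `x_j`. -/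
def resolve (Y : Vars) (j : ℕ) : Y.1 :=
  if h : j ∈ Y.1 then ⟨j, h⟩ else ⟨Y.1.min' Y.2, Y.1.min'_mem Y.2⟩

theorem initVal_eq {U : Structure.{u}} (Y : Vars) (a : Input U Y) (j : ℕ) :
    initVal Y a j = a (resolve Y j) := by
  unfold initVal resolve
  split_ifs <;> rfl

theorem resolve_coe (Y : Vars) (y : Y.1) : resolve Y y.1 = y := by
  simp [resolve]

/-- The value of an expression as a function of the values of the input variables. -/
theorem val_mk_initVal (f : Tag) (S : Finset ℕ) (hS : S ∈ fam on f) (q : Fin (M f + 1) → ℕ)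
    (Y : Vars) (a : Input (str.{u} M on) Y) :
    (mk f S hS q : Expr (str.{u} M on)).val (initVal Y a) =
      (lastNum.{u} f fun i => a (resolve Y (q i))).any fun v => decide (v ∈ S) := by
  rw [val_mk]
  simp only [initVal_eq]

/-- The predicates with the tag `f` are not constant on `n` input variables. -/
def Active (M : Tag → ℕ) (on : Tag → Prop) (f : Tag) (n : ℕ) : Prop := on f ∧ M f < n

theorem val_eq_false_of_empty {f : Tag} (hS : ∅ ∈ fam on f) (q : Fin (M f + 1) → ℕ)
    (s : ℕ → Pt.{u}) : (mk f ∅ hS q : Expr (str.{u} M on)).val s = false := by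
  rw [val_mk]
  cases lastNum f fun i => s (q i) <;> simp

/-- With fewer than `M f + 1` input variables two arguments share their initial value, and `lastNum`
rejects tuples that are not injective. If the tag is off, only `S = ∅` is left. -/
theorem val_eq_false_of_not_active {f : Tag} {S : Finset ℕ} (hS : S ∈ fam on f)
    (q : Fin (M f + 1) → ℕ) {Y : Vars} (h : ¬ Active M on f Y.1.card)
    (a : Input (str.{u} M on) Y) : (mk f S hS q : Expr (str.{u} M on)).val (initVal Y a) = false := by
  by_cases hne : S = ∅
  · subst hne
    exact val_eq_false_of_empty hS q _
  · have h1 : on f := (hS.resolve_left hne).1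
    rw [val_mk_initVal]
    have hni : ¬ Function.Injective fun i => a (resolve Y (q i)) := fun hinj => by
      have hinj' : Function.Injective fun i => resolve Y (q i) := fun i j hij =>
        hinj (congrArg a hij)
      have := Fintype.card_le_of_injective _ hinj'
      simp only [Fintype.card_fin, Fintype.card_coe] at this
      exact h ⟨h1, this⟩
    rw [lastNum_eq_none fun h => absurd h hni]
    rfl

/-- The first `n` variables. -/
def firstVars (n : ℕ) (hn : 0 < n) : Vars := ⟨Finset.range n, Finset.nonempty_range_iff.mpr hn.ne'⟩

/-- The input where `x_{M f}` has the value `(f, v)` and the other variables have values of no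
importance. -/
def test (M : Tag → ℕ) (on : Tag → Prop) (f : Tag) {n : ℕ} (hn : 0 < n) (v : ℕ) :
    Input (str.{u} M on) (firstVars n hn) :=
  fun y => ⟨if y.1 = M f then (f, v) else (.O, y.1)⟩

theorem test_injective {f : Tag} (hf : f ≠ .O) {n : ℕ} (hn : 0 < n) (v : ℕ) :
    Function.Injective (test.{u} M on f hn v) := by
  intro y y' h
  have h' : (if y.1 = M f then (f, v) else (Tag.O, y.1)) =
      if y'.1 = M f then (f, v) else (Tag.O, y'.1) := congrArg ULift.down h
  ext
  split_ifs at h' with h1 h2 h2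
  · rw [h1, h2]
  · exact absurd (congrArg Prod.fst h') hf
  · exact absurd (congrArg Prod.fst h').symm hf
  · exact congrArg Prod.snd h'

/-- An expression either does not distinguish the test inputs, or tests `v ∈ S`. -/
theorem val_test {f : Tag} (hf : f ≠ .O) {n : ℕ} (hn : 0 < n) (e : Expr (str.{u} M on)) :
    (∀ v, e.val (initVal _ (test M on f hn v)) = false) ∨
    ∃ S hS q, e = mk f S hS q ∧ ∀ v, e.val (initVal _ (test M on f hn v)) = decide (v ∈ S) := by
  obtain ⟨f', S, hS, q, rfl⟩ := exists_eq_mk e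
  have hval := fun v => val_mk_initVal f' S hS q _ (test.{u} M on f hn v)
  by_cases hinj : Function.Injective fun i => resolve (firstVars n hn) (q i)
  · have hinj' : ∀ v, Function.Injective fun i => test.{u} M on f hn v (resolve _ (q i)) := fun v =>
      (test_injective hf hn v).comp hinj
    by_cases hlast : (resolve (firstVars n hn) (q (Fin.last _))).1 = M f
    · by_cases hff : f' = f
      · subst hff
        refine Or.inr ⟨S, hS, q, rfl, fun v => ?_⟩
        rw [hval, lastNum_eq_some (v := v) (hinj' v) (if_pos hlast)]
        rfl
      · refine Or.inl fun v => ?_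
        rw [hval, lastNum_eq_none fun _ => ?_]
        · rfl
        · simp only [test, hlast, if_true]
          exact Ne.symm hff
    · refine Or.inl fun v => ?_
      -- The last argument has tag `O` here, and the only predicates with that tag have `S = ∅`.
      by_cases hO : f' = .O
      · subst hO
        rcases hS with rfl | ⟨-, h⟩
        · exact val_eq_false_of_empty _ q _
        · exact absurd h (Set.notMem_empty _)
      · rw [hval, lastNum_eq_none fun _ => ?_]
        · rfl
        · simp only [test, hlast, if_false]
          exact Ne.symm hO
  · refine Or.inl fun v => ?_
    rw [hval, lastNum_eq_none fun h => absurd (fun i j hij => h (congrArg (test M on f hn v) hij)) hinj]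
    rfl

theorem val_test_self {f : Tag} (hf : f ≠ .O) {n : ℕ} (hn : M f < n) {S : Finset ℕ}
    (hS : S ∈ fam on f) (v : ℕ) :
    (mk f S hS (fun i => i.1) : Expr (str.{u} M on)).val
      (initVal _ (test M on f (Nat.zero_lt_of_lt hn) v)) = decide (v ∈ S) := by
  have hres : ∀ i : Fin (M f + 1), (resolve (firstVars n (Nat.zero_lt_of_lt hn)) i.1).1 = i.1 :=
    fun i => congrArg Subtype.val (resolve_coe _ ⟨i.1, Finset.mem_range.mpr (by have := i.2; omega)⟩)
  have hinj : Function.Injective fun i : Fin (M f + 1) =>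
      resolve (firstVars n (Nat.zero_lt_of_lt hn)) i.1 := fun i j h => by
    ext
    rw [← hres i, ← hres j]
    exact congrArg Subtype.val h
  have hlast := hres (Fin.last _)
  rw [Fin.val_last] at hlast
  rw [val_mk_initVal, lastNum_eq_some (v := v) (x := fun i : Fin (M f + 1) =>
    test.{u} M on f _ v (resolve _ i.1)) ((test_injective hf _ v).comp hinj) (if_pos hlast)]
  rfl

end Model


theorem Problem.notMem_solutions_full {U : Structure.{u}} {Y : Vars} {β : List (Expr U)}
    {h : 0 < predCount β} {a a' : Input U Y}
    (hne : predVals β (initVal Y a) ≠ predVals β (initVal Y a')) (κ : ℕ)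
    (hκ : κ ∈ (Problem.full Y β h).solutions a) : κ ∉ (Problem.full Y β h).solutions a' := by
  rw [Problem.mem_solutions_full] at hκ ⊢
  intro hκ'
  exact hne (Encodable.encode_injective (hκ.symm.trans hκ'))

namespace Model

variable {M : Tag → ℕ} {on : Tag → Prop} {n : ℕ}

theorem predVals_str (β : List (Expr (str.{u} M on))) (s : ℕ → Pt.{u}) :
    predVals β s = β.map fun e => e.val s := predVals_eq_map β s

theorem predCount_str (β : List (Expr (str.{u} M on))) : predCount β = β.length :=
  predCount_eq_length β

theorem msr_limited (M : Tag → ℕ) (on : Tag → Prop) : (msr.{u} M on).Limited :=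
  weightedDepth_limited (wt_pos M on)

/-! #### Lower bounds -/

/-- Deciding `v = k` for `k = C + 1` costs more than `C`: a rule of cost at most `C` that covers `v
= k` cannot afford the predicate `{k}`, and its other queries have the same values for all large
`v`. Such a `v` would get the same answer. -/
theorem unboundedAt_a_of_active_V (h : Active M on .V n) : UnboundedAt (msr.{u} M on) .a n := by
  obtain ⟨hon, hn⟩ := h
  have hn0 := Nat.zero_lt_of_lt hn
  intro C
  let k := C + 1
  have hS : ∀ k, {k} ∈ fam on .V := fun k => Or.inr ⟨hon, k, rfl⟩
  let β : List (Expr (str.{u} M on)) := [mk .V {k} (hS k) fun i => i.1]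
  let z : Problem (str.{u} M on) := .full (firstVars n hn0) β (by
    rw [predCount_str]; exact one_pos)
  refine ⟨⟨z, Finset.card_range n⟩, ?_⟩
  by_contra hcon
  obtain ⟨ι, _, β', t, κ, h1, h2, h3⟩ := (msr M on).exists_rules z
  obtain ⟨i, hi⟩ := h2 (test M on .V hn0 k)
  have hev : ∀ e ∈ {e | e ∈ β' i}, ∀ᶠ v in Filter.atTop,
      e.val (initVal _ (test M on .V hn0 v)) = e.val (initVal _ (test M on .V hn0 k)) := by
    intro e he
    rcases val_test (f := .V) (by decide) hn0 e with h0 | ⟨S, hS, q, rfl, hval⟩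
    · exact Filter.Eventually.of_forall fun v => by rw [h0, h0]
    · filter_upwards [Filter.eventually_gt_atTop (S.sup id)] with v hv
      have hvS : v ∉ S := fun hvS => absurd (Finset.le_sup (f := id) hvS) (not_le.mpr hv)
      have hkS : k ∉ S := fun hkS => by
        rcases (show S = ∅ ∨ on .V ∧ ∃ j, S = {j} from hS) with rfl | ⟨-, j, rfl⟩
        · simp at hkS
        · obtain rfl := Finset.mem_singleton.mp hkS
          have h4 := weight_le_ofExprs (wt M on) he
          rw [weight_mk_V] at h4
          have h5 := (h4.trans (h1 i)).trans (not_lt.mp hcon)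
          have h6 := Nat.self_le_factorial k
          have h7 : k.factorial ≤ k.factorial ^ 2 := Nat.le_self_pow two_ne_zero _
          omega
      rw [hval, hval, decide_eq_false hvS, decide_eq_false hkS]
  rw [← Filter.eventually_all_finite (List.finite_toSet _)] at hev
  obtain ⟨v, hv, hvk⟩ := (hev.and (Filter.eventually_gt_atTop k)).exists
  have hi' : predVals (β' i) (initVal _ (test M on .V hn0 v)) = t i := by
    rw [← hi, predVals_str, predVals_str]
    exact List.map_congr_left hv
  refine Problem.notMem_solutions_full ?_ _ (h3 _ i hi) (h3 _ i hi')
  simp only [predVals_str, β, List.map_cons, List.map_nil]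
  rw [val_test_self (by decide) hn, val_test_self (by decide) hn]
  simp [hvk.ne']

/-- Locating `v` among `2 ^ C + 1` positions is certified by two neighbouring thresholds, while a
deterministic tree of depth `C` has too few leaves. -/
theorem separatedAt_of_active_C (h : Active M on .C n) : SeparatedAt (msr.{u} M on) n := by
  obtain ⟨hon, hn⟩ := h
  have hn0 := Nat.zero_lt_of_lt hn
  refine ⟨2, fun C => ?_⟩
  let K := 2 ^ C + 1
  have hS : ∀ k, Finset.range k ∈ fam on .C := fun k => Or.inr ⟨hon, k, rfl⟩
  let th : ℕ → Expr (str.{u} M on) := fun k => mk .C (.range k) (hS k) fun i => i.1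
  let β : List (Expr (str.{u} M on)) := (List.range (K + 1)).map th
  let z : Problem (str.{u} M on) := .full (firstVars n hn0) β (by
    rw [predCount_str]; simp [β])
  refine ⟨⟨z, Finset.card_range n⟩, ?_, ?_⟩
  · refine param_a_le_of_thresholds (wt M on) z (σ := Unit) (fun _ => th) K
      (fun _ k => weight_mk_CR (Or.inl rfl) _ _ _) (fun _ a => val_eq_false_of_empty _ _ _)
      (fun _ a k hk => ?_) fun a a' h => z.solutions_congr fun e he => ?_
    · simp only [th, val_mk, Option.any_eq_true, decide_eq_true_eq, Finset.mem_range] at hk ⊢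
      obtain ⟨v, h1, h2⟩ := hk
      exact ⟨v, h1, by omega⟩
    · obtain ⟨k, hk, rfl⟩ := List.mem_map.mp he
      exact h () k (by have := List.mem_range.mp hk; omega)
  · refine (msr M on).lt_param_d z (test M on .C hn0) (Finset.range K) (fun _ => true) (c := C)
      (fun e h => Bool.noConfusion h) (fun β hβ => ?_) ?_ fun i hi j hj hij κ =>
        Problem.notMem_solutions_full (fun h => hij ?_) κ
    · rw [List.countP_true]
      have := (msr_limited M on).length_le (β.map Expr.symb)
      rw [List.length_map] at this
      exact this.trans hβ
    · rw [Finset.card_range]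
      exact Nat.lt_succ_self _
    · rw [predVals_str, predVals_str] at h
      have h' : ∀ k ≤ K, i < k ↔ j < k := fun k hk => by
        have := List.map_inj_left.mp h (th k)
          (List.mem_map_of_mem (List.mem_range.mpr (Nat.lt_succ_of_le hk)))
        rw [val_test_self (by decide) hn, val_test_self (by decide) hn] at this
        simpa using this
      have h1 := h' (i + 1) (Finset.mem_range.mp hi)
      have h2 := h' (j + 1) (Finset.mem_range.mp hj)
      omega

theorem tightAt_of_active_R (h : Active M on .R n) : TightAt (msr.{u} M on) n := by
  obtain ⟨hon, hn⟩ := h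
  have hn0 := Nat.zero_lt_of_lt hn
  refine infinite_of_forall_ge 1 fun m hm => ?_
  have hS : ∀ S, S ∈ fam on .R := fun S => Or.inr ⟨hon, Set.mem_univ _⟩
  let bit : ℕ → Expr (str.{u} M on) := fun j =>
    -- The restriction to numbers below `2 ^ m` makes the set finite.
    mk .R ((Finset.range (2 ^ m)).filter fun x => x.testBit j = true) (hS _) fun i => i.1
  let β : List (Expr (str.{u} M on)) := (List.range m).map bit
  let z : Problem (str.{u} M on) := .full (firstVars n hn0) β (by
    rw [predCount_str]; simpa [β] using Nat.lt_of_succ_le hm)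
  have hi : (msr M on).param .i z = m := by
    change (msr M on).ofExprs β = m
    rw [ofExprs_weightedDepth, List.map_map,
      show Expr.weight (wt M on) ∘ bit = fun _ => 1 from
        funext fun j => weight_mk_CR (Or.inr rfl) _ _ _]
    simp
  refine ⟨⟨z, Finset.card_range n⟩, hi, le_antisymm (hi ▸ (msr M on).param_d_le_param_i z) ?_⟩
  obtain ⟨m, rfl⟩ : ∃ m', m = m' + 1 := ⟨m - 1, by omega⟩
  refine (msr M on).lt_param_d z (test M on .R hn0) (Finset.range (2 ^ (m + 1))) (fun _ => true)
    (c := m) (fun e h => Bool.noConfusion h) (fun β hβ => ?_) ?_ fun i hi j hj hij κ =>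
      Problem.notMem_solutions_full (fun h => hij ?_) κ
  · rw [List.countP_true]
    have := (msr_limited M on).length_le (β.map Expr.symb)
    rw [List.length_map] at this
    exact this.trans hβ
  · rw [Finset.card_range]
    exact Nat.pow_lt_pow_succ one_lt_two
  · rw [predVals_str, predVals_str] at h
    refine Nat.eq_of_testBit_eq fun k => ?_
    by_cases hk : k < m + 1
    · have := List.map_inj_left.mp h (bit k) (List.mem_map_of_mem (List.mem_range.mpr hk))
      rw [val_test_self (by decide) hn, val_test_self (by decide) hn] at this
      simpa [Finset.mem_range.mp hi, Finset.mem_range.mp hj, ← Bool.eq_iff_iff] using this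
    · have hlt : 2 ^ (m + 1) ≤ 2 ^ k := Nat.pow_le_pow_right two_pos (not_lt.mp hk)
      rw [Nat.testBit_lt_two_pow ((Finset.mem_range.mp hi).trans_le hlt),
        Nat.testBit_lt_two_pow ((Finset.mem_range.mp hj).trans_le hlt)]

/-- The problem is to name a `j` such that the predicate for `gadget m j` is false. No number lies
in all three gadgets, so a single query of weight `m + 1` certifies an answer. The numbers `3m`,
`3m+1`, `3m+2` have different unique answers; cheaper queries do not separate them, and a path of
cost at most `m + 1` has at most one query of weight at least `m + 1`, which cannot separate three
inputs. -/
theorem not_controlledAt_of_active_G (h : Active M on .G n) :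
    ¬ ControlledAt (msr.{u} M on) n := by
  obtain ⟨hon, hn⟩ := h
  have hn0 := Nat.zero_lt_of_lt hn
  refine Set.not_infinite.mpr ((Set.finite_singleton 0).subset fun m hm => ?_)
  by_contra hm0
  obtain ⟨m, rfl⟩ : ∃ m', m = m' + 1 := ⟨m - 1, by rw [Set.mem_singleton_iff] at hm0; omega⟩
  have hS : ∀ j : Fin 3, gadget m j ∈ fam on .G := fun j => Or.inr ⟨hon, m, j, j.2, rfl⟩
  let g : Fin 3 → Expr (str.{u} M on) := fun j => mk .G (gadget m j) (hS j) fun i => i.1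
  let β : List (Expr (str.{u} M on)) := [g 0, g 1, g 2]
  classical
  let ν : List Bool → Finset ℕ := fun t => (Finset.range 3).filter fun j => t[j]? = some false
  let z : Problem (str.{u} M on) := .ofFun (firstVars n hn0) β (by
    rw [predCount_str]; simp [β]) fun t =>
      if h : (ν t).Nonempty then ⟨ν t, h⟩ else ⟨{0}, Finset.singleton_nonempty _⟩
  have hget : ∀ (a : Input (str.{u} M on) (firstVars n hn0)) (j : Fin 3),
      (predVals β (initVal _ a))[j.1]? = some ((g j).val (initVal _ a)) := fun a j => by
    rw [predVals_str]
    fin_cases j <;> rfl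
  have hν : ∀ (a : Input (str.{u} M on) (firstVars n hn0)) (j : Fin 3),
      (j : ℕ) ∈ ν (predVals β (initVal _ a)) ↔ (g j).val (initVal _ a) = false := fun a j => by
    simp only [ν, Finset.mem_filter, Finset.mem_range, j.2, true_and, hget, Option.some.injEq]
  have hex : ∀ a : Input (str.{u} M on) (firstVars n hn0),
      ∃ j : Fin 3, (g j).val (initVal _ a) = false := fun a => by
    by_contra hcon
    push Not at hcon
    simp only [ne_eq, Bool.not_eq_false, g, val_mk, Option.any_eq_true, decide_eq_true_eq] at hcon
    obtain ⟨v, hv, h0⟩ := hcon 0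
    obtain ⟨v', hv', h1⟩ := hcon 1
    obtain ⟨v'', hv'', h2⟩ := hcon 2
    rw [hv] at hv' hv''
    cases hv'
    cases hv''
    simp [gadget] at h0 h1 h2
    omega
  have hsol : ∀ (a : Input (str.{u} M on) (firstVars n hn0)),
      z.solutions a = ν (predVals β (initVal _ a)) := fun a => by
    obtain ⟨j, hj⟩ := hex a
    have hne : (ν (predVals β (initVal _ a))).Nonempty := ⟨j, (hν a j).mpr hj⟩
    rw [Problem.solutions_ofFun, dif_pos hne]
  have hw : ∀ j, (g j).weight (wt M on) = m + 1 := fun j => weight_mk_G m j.2 _ _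
  have ha : (msr M on).param .a z ≤ m + 1 := by
    refine (msr M on).param_a_le_of_rules z (fun j => [g j]) (fun _ => [false])
      (fun j : Fin 3 => j.1) (fun j => ?_) (fun a => ?_) fun a j h => ?_
    · rw [ofExprs_weightedDepth]
      simp [hw]
    · obtain ⟨j, hj⟩ := hex a
      exact ⟨j, by rw [predVals_str]; exact congrArg (fun b => [b]) hj⟩
    · rw [predVals_str] at h
      exact (hsol a).symm ▸ (hν a j).mpr (List.cons.inj h).1
  have htest : ∀ i j : Fin 3, (g j).val (initVal _ (test M on .G hn0 (3 * m + i))) = false ↔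
      i = j := fun i j => by
    rw [val_test_self (by decide) hn, decide_eq_false_iff_not]
    have := i.2
    simp only [gadget, Finset.mem_erase, Finset.mem_insert, Finset.mem_singleton, Fin.ext_iff]
    omega
  have hd : m + 1 < (msr M on).param .d z := by
    refine (msr M on).lt_param_d z (fun i : Fin 3 => test M on .G hn0 (3 * m + i)) Finset.univ
      (fun e => decide (m + 1 ≤ e.weight (wt M on))) (c := 1) (fun e he => ?_)
      (fun β hβ => ?_) (by simp) fun i _ j _ hij κ hi hj => ?_
    · rw [decide_eq_false_iff_not] at he
      rcases val_test (f := .G) (by decide) hn0 e with h0 | ⟨S, hS, q, rfl, hval⟩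
      · exact fun i j => (h0 _).trans (h0 _).symm
      · have : ∀ i : Fin 3, 3 * m + i.1 ∉ S := fun i hi => by
          rcases (show S = ∅ ∨ on .G ∧ ∃ m j, j < 3 ∧ S = gadget m j from hS) with
            rfl | ⟨-, m', j', hj', rfl⟩
          · simp at hi
          · rw [weight_mk_G m' hj'] at he
            have := i.2
            simp [gadget] at hi
            omega
        exact fun i j => ((hval _).trans (decide_eq_false (this i))).trans
          ((hval _).trans (decide_eq_false (this j))).symm
    · have h1 := countP_mul_le_ofExprs (wt M on) (fun e => decide (m + 1 ≤ e.weight (wt M on)))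
        (m + 1) (fun e he => of_decide_eq_true he) β
      exact Nat.le_of_mul_le_mul_right ((h1.trans hβ).trans_eq (one_mul _).symm) (Nat.succ_pos m)
    · rw [hsol] at hi hj
      have hκ : κ < 3 := Finset.mem_range.mp (Finset.mem_filter.mp hi).1
      have h1 := (htest i ⟨κ, hκ⟩).mp ((hν _ ⟨κ, hκ⟩).mp hi)
      have h2 := (htest j ⟨κ, hκ⟩).mp ((hν _ ⟨κ, hκ⟩).mp hj)
      exact hij (h1.trans h2.symm)
  have := hm ⟨z, Finset.card_range n⟩ ha
  simp only at this
  omega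

end Model


namespace Model

variable {M : Tag → ℕ} {on : Tag → Prop} {n : ℕ}

/-! #### Upper bounds -/

theorem val_eq_false_or_active (Y : Vars) (e : Expr (str.{u} M on)) :
    (∀ a : Input (str.{u} M on) Y, e.val (initVal Y a) = false) ∨
    ∃ f S hS q, e = mk f S hS q ∧ Active M on f Y.1.card ∧ S ∈ baseFam f := by
  obtain ⟨f, S, hS, q, rfl⟩ := exists_eq_mk e
  by_cases hact : Active M on f Y.1.card
  · by_cases hne : S = ∅
    · subst hne
      exact Or.inl fun a => val_eq_false_of_empty hS q _
    · exact Or.inr ⟨f, S, hS, q, rfl, hact, (hS.resolve_left hne).2⟩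
  · exact Or.inl fun a => val_eq_false_of_not_active hS q hact a

/-- The value depends only on the input variables denoted by the variables of the expression. -/
theorem val_mk_resolve (f : Tag) (S : Finset ℕ) (hS : S ∈ fam on f) (q : Fin (M f + 1) → ℕ)
    (Y : Vars) (a : Input (str.{u} M on) Y) :
    (mk f S hS fun i => (resolve Y (q i)).1 : Expr (str.{u} M on)).val (initVal Y a) =
      (mk f S hS q : Expr (str.{u} M on)).val (initVal Y a) := by
  rw [val_mk_initVal, val_mk_initVal]
  simp only [resolve_coe]

theorem param_d_eq_zero (h : ∀ f, ¬ Active M on f n) (z : ProblemN (str.{u} M on) n) :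
    (msr.{u} M on).param .d z.1 = 0 := by
  obtain ⟨z, rfl⟩ := z
  refine Nat.eq_zero_of_le_zero ((msr M on).param_d_le_ofExprs z [] fun a => ?_)
  obtain ⟨κ, hκ⟩ := z.exists_mem_solutions a
  refine ⟨κ, fun a' _ => ?_⟩
  rwa [z.solutions_congr (a' := a) fun e _ => ?_]
  rcases val_eq_false_or_active z.Y e with h0 | ⟨f, -, -, -, -, hact, -⟩
  · rw [h0, h0]
  · exact absurd hact (h f)

theorem not_unboundedAt_d (h : ∀ f, ¬ Active M on f n) : ¬ UnboundedAt (msr.{u} M on) .d n :=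
  fun h' => by
    obtain ⟨z, hz⟩ := h' 0
    rw [param_d_eq_zero h z] at hz
    exact hz.false

/-- The thresholds `v` and `v + 1` together pin down the number `v`. -/
theorem any_eq_of_thresholds {o o' : Option ℕ} {S : Finset ℕ} {K : ℕ} (hS : ∀ v ∈ S, v < K)
    (h : ∀ k ≤ K, (o.any fun v => decide (v ∈ Finset.range k)) =
      o'.any fun v => decide (v ∈ Finset.range k)) :
    (o.any fun v => decide (v ∈ S)) = o'.any fun v => decide (v ∈ S) := by
  have key : ∀ o o' : Option ℕ, (∀ k ≤ K, (o.any fun v => decide (v ∈ Finset.range k)) =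
      o'.any fun v => decide (v ∈ Finset.range k)) →
      (o.any fun v => decide (v ∈ S)) = true → (o'.any fun v => decide (v ∈ S)) = true := by
    intro o o' h ho
    simp only [Option.any_eq_true, decide_eq_true_eq] at ho ⊢
    obtain ⟨v, rfl, hv⟩ := ho
    have h1 := h (v + 1) (hS v hv)
    have h2 := h v (hS v hv).le
    cases o' with
    | none => simp at h1
    | some v' =>
      simp at h1 h2
      obtain rfl : v = v' := by omega
      exact ⟨v, rfl, hv⟩
  exact Bool.eq_iff_iff.mpr ⟨key o o' h, key o' o fun k hk => (h k hk).symm⟩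

theorem range_mem_fam {f : Tag} (hf : f = .C ∨ f = .R) (hon : on f) (k : ℕ) :
    Finset.range k ∈ fam on f := by
  refine Or.inr ⟨hon, ?_⟩
  rcases hf with rfl | rfl
  · exact ⟨k, rfl⟩
  · exact Set.mem_univ _

/-- There are boundedly many pairs of an active tag and a tuple of input variables, and both tags
have all thresholds. Two thresholds per pair therefore certify the values of any description,
however long. -/
theorem not_unboundedAt_a (h : ∀ f, Active M on f n → f = .C ∨ f = .R) :
    ¬ UnboundedAt (msr.{u} M on) .a n := by
  classical
  intro h'
  obtain ⟨z, hz⟩ := h' (2 * ∑ f : {f // Active M on f n}, n ^ (M f + 1))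
  obtain ⟨z, rfl⟩ := z
  refine absurd hz (not_lt.mpr ?_)
  let σ := (f : {f // Active M on f z.Y.1.card}) × (Fin (M f + 1) → z.Y.1)
  have hσ : Fintype.card σ = ∑ f : {f // Active M on f z.Y.1.card}, z.Y.1.card ^ (M f + 1) := by
    simp [σ]
  rw [← hσ]
  let th : σ → ℕ → Expr (str.{u} M on) := fun s k =>
    mk s.1.1 (.range k) (range_mem_fam (h _ s.1.2) s.1.2.1 k) fun i => (s.2 i).1
  -- A single `K` must exceed every number in the sets of the finitely many expressions of the
  -- description.
  have hev : ∀ e ∈ {e | e ∈ z.β}, ∀ᶠ K in Filter.atTop, ∀ a a' : Input (str.{u} M on) z.Y,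
      (∀ s, ∀ k ≤ K, (th s k).val (initVal z.Y a) = (th s k).val (initVal z.Y a')) →
      e.val (initVal z.Y a) = e.val (initVal z.Y a') := by
    intro e _
    rcases val_eq_false_or_active z.Y e with h0 | ⟨f, S, hS, q, rfl, hact, -⟩
    · exact Filter.Eventually.of_forall fun K a a' _ => by rw [h0, h0]
    · filter_upwards [Filter.eventually_gt_atTop (S.sup id)] with K hK a a' hth
      rw [← val_mk_resolve, ← val_mk_resolve f S hS q z.Y a']
      exact any_eq_of_thresholds (fun v hv => (Finset.le_sup (f := id) hv).trans_lt hK)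
        (hth ⟨⟨f, hact⟩, fun i => resolve z.Y (q i)⟩)
  rw [← Filter.eventually_all_finite (List.finite_toSet _)] at hev
  obtain ⟨K, hK⟩ := hev.exists
  refine param_a_le_of_thresholds (wt M on) z th K
    (fun s k => weight_mk_CR (h _ s.1.2) _ _ _) (fun _ a => val_eq_false_of_empty _ _ _)
    (fun s a k hk => ?_) fun a a' h => z.solutions_congr fun e he => hK e he a a' h
  simp only [th, val_mk, Option.any_eq_true, decide_eq_true_eq, Finset.mem_range] at hk ⊢
  obtain ⟨v, h1, h2⟩ := hk
  exact ⟨v, h1, by omega⟩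

theorem singleton_mem_fam (hon : on .V) (k : ℕ) : {k} ∈ fam on .V := Or.inr ⟨hon, k, rfl⟩

theorem gadget_mem_fam (hon : on .G) (m : ℕ) {j : ℕ} (hj : j < 3) : gadget m j ∈ fam on .G :=
  Or.inr ⟨hon, m, j, hj, rfl⟩

/-- All expressions with `k < K` and the tag `V`. -/
noncomputable def listV (hon : on .V) (Y : Vars) (K : ℕ) : List (Expr (str.{u} M on)) :=
  (Finset.univ : Finset (Fin K × (Fin (M .V + 1) → Y.1))).toList.map fun x =>
    mk .V {x.1.1} (singleton_mem_fam hon x.1.1) fun i => (x.2 i).1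

/-- All expressions with `m < K` and the tag `G`. -/
noncomputable def listG (hon : on .G) (Y : Vars) (K : ℕ) : List (Expr (str.{u} M on)) :=
  (Finset.univ : Finset ((Fin K × Fin 3) × (Fin (M .G + 1) → Y.1))).toList.map fun x =>
    mk .G (gadget x.1.1 x.1.2) (gadget_mem_fam hon x.1.1 x.1.2.2) fun i => (x.2 i).1

theorem ofExprs_listV_le (hon : on .V) (Y : Vars) (K : ℕ) :
    (msr.{u} M on).ofExprs (listV hon Y K) ≤
      K * Y.1.card ^ (M .V + 1) * (K - 1).factorial ^ 2 := by
  refine (ofExprs_le_length_mul (wt M on) ((K - 1).factorial ^ 2) fun e he => ?_).trans_eq ?_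
  · obtain ⟨x, -, rfl⟩ := List.mem_map.mp he
    rw [weight_mk_V]
    exact Nat.pow_le_pow_left (Nat.factorial_le (by omega)) 2
  · simp [listV]

theorem ofExprs_listG_le (hon : on .G) (Y : Vars) (K : ℕ) :
    (msr.{u} M on).ofExprs (listG hon Y K) ≤ K * 3 * Y.1.card ^ (M .G + 1) * K := by
  refine (ofExprs_le_length_mul (wt M on) K fun e he => ?_).trans_eq ?_
  · obtain ⟨x, -, rfl⟩ := List.mem_map.mp he
    rw [weight_mk_G _ x.1.2.2]
    exact x.1.1.2
  · simp [listG]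

theorem exists_mem_listV (hon : on .V) (Y : Vars) {k K : ℕ} (hk : k < K) (hS : {k} ∈ fam on .V)
    (q : Fin (M .V + 1) → ℕ) : ∃ l ∈ listV.{u} hon Y K, ∀ a : Input (str.{u} M on) Y,
      (mk .V {k} hS q : Expr (str.{u} M on)).val (initVal Y a) = l.val (initVal Y a) :=
  ⟨_, List.mem_map_of_mem (Finset.mem_toList.mpr
    (Finset.mem_univ (⟨k, hk⟩, fun i => resolve Y (q i)))),
    fun a => (val_mk_resolve .V {k} hS q Y a).symm⟩

theorem exists_mem_listG (hon : on .G) (Y : Vars) {m j K : ℕ} (hm : m < K) (hj : j < 3)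
    (hS : gadget m j ∈ fam on .G) (q : Fin (M .G + 1) → ℕ) :
    ∃ l ∈ listG.{u} hon Y K, ∀ a : Input (str.{u} M on) Y,
      (mk .G (gadget m j) hS q : Expr (str.{u} M on)).val (initVal Y a) = l.val (initVal Y a) :=
  ⟨mk .G (gadget m j) hS fun i => (resolve Y (q i)).1,
    List.mem_map.mpr ⟨((⟨m, hm⟩, ⟨j, hj⟩), fun i => resolve Y (q i)),
      Finset.mem_toList.mpr (Finset.mem_univ _), rfl⟩,
    fun a => (val_mk_resolve .G (gadget m j) hS q Y a).symm⟩

theorem controlledAt (hV : Active M on .V n) (h : ∀ f, Active M on f n → f = .V) :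
    ControlledAt (msr.{u} M on) n := by
  refine infinite_setOf_of_unbounded fun C => ?_
  -- With budget `(K!)^2 - 1` only singletons `{k}` with `k < K` are affordable. Evaluating all of
  -- them costs at most `K * n ^ (M .V + 1) * ((K-1)!)^2`, which is below `(K!)^2` because `n ^ (M
  -- .V + 1) < K`.
  let K := C + n ^ (M .V + 1) + 3
  have hfac : K.factorial = K * (K - 1).factorial := (Nat.mul_factorial_pred (by omega)).symm
  have hpos : 0 < (K - 1).factorial ^ 2 := pow_pos (Nat.factorial_pos _) 2
  have hK : K ≤ K.factorial ^ 2 := (Nat.self_le_factorial K).trans (Nat.le_self_pow two_ne_zero _)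
  refine ⟨K.factorial ^ 2 - 1, by omega, ?_⟩
  rintro ⟨z, rfl⟩ ha
  refine (param_d_le_of_cheap (wt M on) z (listV hV.1 z.Y K) ha fun e he => ?_).trans ?_
  · rcases val_eq_false_or_active z.Y e with h0 | ⟨f, S, hS, q, rfl, hact, hbase⟩
    · exact Or.inl h0
    · obtain rfl := h f hact
      obtain ⟨k, rfl⟩ := hbase
      rw [weight_mk_V] at he
      refine Or.inr (exists_mem_listV hV.1 z.Y ?_ hS q)
      by_contra hk
      have := Nat.pow_le_pow_left (Nat.factorial_le (not_lt.mp hk)) 2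
      omega
  · refine (ofExprs_listV_le hV.1 z.Y K).trans (Nat.le_sub_one_of_lt ?_)
    rw [hfac, mul_pow, pow_two K]
    refine Nat.mul_lt_mul_of_pos_right ?_ hpos
    exact Nat.mul_lt_mul_of_pos_left (by omega) (by omega)

/-- Weights of `V` and `G` predicates tend to infinity, so up to the choice of input variables only
finitely many are affordable at level `m`. Evaluating them all has a cost depending on `m` and `n`
only. -/
theorem not_separatedAt (hV : Active M on .V n) (h : ∀ f, Active M on f n → f = .V ∨ f = .G) :
    ¬ SeparatedAt (msr.{u} M on) n := by
  rintro ⟨m, hm⟩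
  let L : (Y : Vars) → List (Expr (str.{u} M on)) := fun Y =>
    open Classical in listV hV.1 Y (m + 1) ++ if hG : on .G then listG hG Y (m + 1) else []
  obtain ⟨z, ha, hd⟩ := hm ((m + 1) * n ^ (M .V + 1) * (m + 1 - 1).factorial ^ 2 +
    (m + 1) * 3 * n ^ (M .G + 1) * (m + 1))
  obtain ⟨z, rfl⟩ := z
  refine absurd hd (not_lt.mpr ?_)
  refine (param_d_le_of_cheap (wt M on) z (L z.Y) ha fun e he => ?_).trans ?_
  · rcases val_eq_false_or_active z.Y e with h0 | ⟨f, S, hS, q, rfl, hact, hbase⟩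
    · exact Or.inl h0
    · rcases h f hact with rfl | rfl
      · obtain ⟨k, rfl⟩ := hbase
        rw [weight_mk_V] at he
        have h1 := Nat.self_le_factorial k
        have h2 : k.factorial ≤ k.factorial ^ 2 := Nat.le_self_pow two_ne_zero _
        obtain ⟨l, hl, hval⟩ := exists_mem_listV hV.1 z.Y (by omega : k < m + 1) hS q
        exact Or.inr ⟨l, List.mem_append_left _ hl, hval⟩
      · obtain ⟨m', j, hj, rfl⟩ := hbase
        rw [weight_mk_G m' hj] at he
        obtain ⟨l, hl, hval⟩ := exists_mem_listG hact.1 z.Y (by omega : m' < m + 1) hj hS q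
        exact Or.inr ⟨l, List.mem_append_right _ (by rwa [dif_pos hact.1]), hval⟩
  · have h1 := ofExprs_listV_le (M := M) hV.1 z.Y (m + 1)
    simp only [ofExprs_weightedDepth, L, List.map_append, List.sum_append] at h1 ⊢
    refine Nat.add_le_add h1 ?_
    split_ifs with hG
    · have h2 := ofExprs_listG_le (M := M) hG z.Y (m + 1)
      rwa [ofExprs_weightedDepth] at h2
    · simp

/-! #### Saving a query -/

/-- By the pigeonhole principle some fiber of `q` has three entries; sorting it by `k` brings them
into order. -/
theorem exists_perm_of_fiber {α κ : Type*} [Fintype κ] (β : List α) (q : α → κ) (k : α → ℕ)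
    (h : 2 * Fintype.card κ < β.length) : ∃ e₁ e₂ e₃ L, β.Perm (e₁ :: e₂ :: e₃ :: L) ∧
      q e₁ = q e₂ ∧ q e₂ = q e₃ ∧ k e₁ ≤ k e₂ ∧ k e₂ ≤ k e₃ := by
  classical
  obtain ⟨x, hx⟩ : ∃ x, 2 < (β.filter fun e => q e = x).length := by
    by_contra hcon
    push Not at hcon
    have hsum : ∑ x, (β.filter fun e => q e = x).length = β.length := by
      clear h hcon
      induction β with
      | nil => simp
      | cons e β ih =>
        rw [List.length_cons, ← ih]
        have : ∀ x, ((e :: β).filter fun e => q e = x).length =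
            (β.filter fun e => q e = x).length + if x = q e then 1 else 0 := fun x => by
          rw [List.filter_cons]
          by_cases hx : q e = x
          · simp [hx]
          · simp [hx, Ne.symm hx]
        rw [Finset.sum_congr rfl fun x _ => this x, Finset.sum_add_distrib]
        simp
    have := Finset.sum_le_card_nsmul Finset.univ _ 2 fun x _ => hcon x
    rw [hsum, Finset.card_univ, smul_eq_mul] at this
    omega
  let r : α → α → Prop := fun e e' => k e ≤ k e'
  have : Std.Total r := ⟨fun a b => Nat.le_total _ _⟩
  have : IsTrans α r := ⟨fun a b c => Nat.le_trans⟩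
  let l := (β.filter fun e => q e = x).insertionSort r
  have hl : l.Perm (β.filter fun e => q e = x) := List.perm_insertionSort _ _
  have hs : l.Pairwise r := List.pairwise_insertionSort r _
  have hq : ∀ e ∈ l, q e = x := fun e he => by
    simpa using (List.mem_filter.mp (hl.mem_iff.mp he)).2
  rw [← hl.length_eq] at hx
  match l, hx with
  | e₁ :: e₂ :: e₃ :: t, _ =>
    refine ⟨e₁, e₂, e₃, t ++ β.filter fun e => !decide (q e = x), ?_, ?_, ?_, ?_, ?_⟩
    · refine (List.filter_append_perm (fun e => decide (q e = x)) β).symm.trans ?_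
      exact hl.symm.append_right _
    · rw [hq e₁ (by simp), hq e₂ (by simp)]
    · rw [hq e₂ (by simp), hq e₃ (by simp)]
    · exact List.rel_of_pairwise_cons hs (by simp)
    · exact List.rel_of_pairwise_cons (List.pairwise_cons.mp hs).2 (by simp)

/-- A description of length above `2 * n ^ (M .C + 1)` contains three thresholds on the same tuple.
Asking the middle one first makes one of the outer two redundant, whatever the outcome, so `ψ^d <
ψ^i`. -/
theorem not_tightAt (h : ∀ f, Active M on f n → f = .C) : ¬ TightAt (msr.{u} M on) n := by
  refine Set.not_infinite.mpr ((Set.finite_Iic (2 * n ^ (M .C + 1))).subset ?_)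
  rintro m ⟨⟨z, rfl⟩, hi, hd⟩
  have hcost : ∀ β : List (Expr (str.{u} M on)),
      (msr M on).ofExprs β = (β.map (Expr.weight (wt M on))).sum := ofExprs_weightedDepth _
  -- A constantly false query could be dropped at a positive saving, against `ψ^i = ψ^d`.
  have hnc : ∀ e ∈ z.β, ¬ ∀ a : Input (str.{u} M on) z.Y, e.val (initVal z.Y a) = false := by
    intro e he h0
    obtain ⟨l₁, l₂, hβ⟩ := List.append_of_mem he
    have h1 : (msr M on).param .d z ≤ (msr M on).ofExprs (l₁ ++ l₂) := by
      refine (msr M on).param_d_le_ofExprs z _ fun a => ?_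
      obtain ⟨κ, hκ⟩ := z.exists_mem_solutions a
      refine ⟨κ, fun a' h' => ?_⟩
      rw [predVals_str, predVals_str] at h'
      have h2 := List.map_inj_left.mp h'
      rwa [z.solutions_congr (a' := a) fun e' he' => ?_]
      rw [hβ] at he'
      simp only [List.mem_append, List.mem_cons] at he'
      rcases he' with he' | rfl | he'
      · exact h2 e' (List.mem_append_left _ he')
      · rw [h0, h0]
      · exact h2 e' (List.mem_append_right _ he')
    have h2 : (msr M on).param .i z = (msr M on).ofExprs (l₁ ++ e :: l₂) :=
      congrArg (msr M on).ofExprs hβ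
    have h3 := weight_pos e
    simp only [hcost, List.map_append, List.map_cons, List.sum_append, List.sum_cons] at h1 h2
    simp only at hi hd
    omega
  have hC : ∀ e, ∃ (q : Fin (M .C + 1) → z.Y.1) (k : ℕ), e ∈ z.β → e.weight (wt M on) = 1 ∧
      ∀ a, e.val (initVal z.Y a) =
        (lastNum.{u} .C fun i => a (q i)).any fun v => decide (v ∈ Finset.range k) := by
    intro e
    by_cases he : e ∈ z.β
    · rcases val_eq_false_or_active z.Y e with h0 | ⟨f, S, hS, q, rfl, hact, hbase⟩
      · exact absurd h0 (hnc e he)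
      · obtain rfl := h f hact
        obtain ⟨k, rfl⟩ := hbase
        exact ⟨fun i => resolve z.Y (q i), k, fun _ => ⟨weight_mk_CR (Or.inl rfl) _ _ _,
          fun a => val_mk_initVal .C _ hS q z.Y a⟩⟩
    · exact ⟨fun _ => resolve z.Y 0, 0, fun he' => absurd he' he⟩
  choose q k hqk using hC
  have hlen : m = z.β.length := by
    rw [← hi, show (msr M on).param .i z = _ from hcost z.β,
      List.map_congr_left fun e he => (hqk e he).1]
    simp
  rw [Set.mem_Iic]
  by_contra hm
  obtain ⟨e₁, e₂, e₃, L, hperm, hq₁, hq₂, hk₁, hk₂⟩ := exists_perm_of_fiber z.β q k (by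
    rw [← hlen]
    simpa using hm)
  have he₁ : e₁ ∈ z.β := hperm.mem_iff.mpr (by simp)
  have he₂ : e₂ ∈ z.β := hperm.mem_iff.mpr (by simp)
  have he₃ : e₃ ∈ z.β := hperm.mem_iff.mpr (by simp)
  have hmono : ∀ e ∈ z.β, ∀ e' ∈ z.β, q e = q e' → k e ≤ k e' → ∀ a : Input (str.{u} M on) z.Y,
      e.val (initVal z.Y a) = true → e'.val (initVal z.Y a) = true := by
    intro e he e' he' hqe hke a hval
    rw [(hqk e he).2] at hval
    rw [(hqk e' he').2]
    simp only [Option.any_eq_true, decide_eq_true_eq, Finset.mem_range] at hval ⊢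
    obtain ⟨v, h1, h2⟩ := hval
    exact ⟨v, hqe ▸ h1, h2.trans_le hke⟩
  obtain ⟨f, S, hS, qq, he⟩ := exists_eq_mk e₂
  have hsum : (msr M on).param .i z = 1 + (1 + (1 + (L.map (Expr.weight (wt M on))).sum)) := by
    rw [show (msr M on).param .i z = _ from hcost z.β, (hperm.map _).sum_eq]
    simp only [List.map_cons, List.sum_cons]
    rw [(hqk e₁ he₁).1, (hqk e₂ he₂).1, (hqk e₃ he₃).1]
  have hbranch : (msr M on).param .d z ≤ 1 + (1 + (L.map (Expr.weight (wt M on))).sum) := by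
    refine (msr M on).param_d_le_of_branch z ⟨prd f (M f) S, f, S, hS, rfl⟩ qq
      -- If the middle threshold holds, so does `e₃`, and `e₁` remains to be asked; if it fails, so
      -- does `e₁`, and `e₃` remains.
      (fun b => if b then e₁ :: L else e₃ :: L) (fun b => ?_) fun a => ?_
    · change (msr M on).ofExprs (mk f S hS qq :: _) ≤ _
      rw [← he, hcost, List.map_cons, List.sum_cons, (hqk e₂ he₂).1]
      cases b
      · simp [(hqk e₃ he₃).1]
      · simp [(hqk e₁ he₁).1]
    · obtain ⟨κ, hκ⟩ := z.exists_mem_solutions a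
      refine ⟨κ, fun a' h1 h2 => ?_⟩
      change (mk f S hS qq : Expr (str.{u} M on)).val (initVal z.Y a') =
        (mk f S hS qq : Expr (str.{u} M on)).val (initVal z.Y a) at h1
      change predVals (if (mk f S hS qq : Expr (str.{u} M on)).val (initVal z.Y a) then _ else _) _
        = predVals (if (mk f S hS qq : Expr (str.{u} M on)).val (initVal z.Y a) then _ else _) _
        at h2
      rw [← he] at h1 h2
      rwa [z.solutions_congr (a' := a) fun e hemem => ?_]
      have hmem := hperm.mem_iff.mp hemem
      simp only [List.mem_cons] at hmem
      cases hb : e₂.val (initVal z.Y a) with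
      | true =>
        rw [hb, if_pos rfl, predVals_str, predVals_str] at h2
        have h3 := List.map_inj_left.mp h2
        rcases hmem with rfl | rfl | rfl | hmem
        · exact h3 e (by simp)
        · exact h1
        · rw [hmono e₂ he₂ e he₃ hq₂ hk₂ a hb, hmono e₂ he₂ e he₃ hq₂ hk₂ a' (h1.trans hb)]
        · exact h3 e (by simp [hmem])
      | false =>
        rw [hb, if_neg Bool.false_ne_true, predVals_str, predVals_str] at h2
        have h3 := List.map_inj_left.mp h2
        have hfalse : ∀ a : Input (str.{u} M on) z.Y, e₂.val (initVal z.Y a) = false →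
            e₁.val (initVal z.Y a) = false := fun a ha => by
          rw [← Bool.not_eq_true]
          intro hval
          rw [hmono e₁ he₁ e₂ he₂ hq₁ hk₁ a hval] at ha
          exact Bool.noConfusion ha
        rcases hmem with rfl | rfl | rfl | hmem
        · rw [hfalse a hb, hfalse a' (h1.trans hb)]
        · exact h1
        · exact h3 e (by simp)
        · exact h3 e (by simp [hmem])
  simp only at hi hd
  omega

end Model


/-! ### Realization of every sequence of `Δ` by a choice of tags and arities -/

namespace Model

variable {M : Tag → ℕ} {on : Tag → Prop} {n : ℕ}

theorem nType_msr_T₂ (hn : 1 ≤ n) (h : ∀ f, ¬ Active M on f n) : nType (msr.{u} M on) n = T₂ :=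
  nType_eq_T₂ (msr_limited M on) hn (not_unboundedAt_d h)

theorem nType_msr_T₃ (hC : Active M on .C n) (h : ∀ f, Active M on f n → f = .C) :
    nType (msr.{u} M on) n = T₃ :=
  nType_eq_T₃ (msr_limited M on) (Nat.zero_lt_of_lt hC.2)
    ((separatedAt_of_active_C hC).elim fun _ hm D => (hm D).imp fun _ hz => hz.2)
    (not_unboundedAt_a fun f hf => Or.inl (h f hf)) (not_tightAt h)

theorem nType_msr_T₄ (hR : Active M on .R n) (h : ∀ f, Active M on f n → f = .C ∨ f = .R) :
    nType (msr.{u} M on) n = T₄ :=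
  nType_eq_T₄ (msr_limited M on) (Nat.zero_lt_of_lt hR.2) (not_unboundedAt_a h)
    (tightAt_of_active_R hR)

theorem nType_msr_T₅ (hV : Active M on .V n) (h : ∀ f, Active M on f n → f = .V) :
    nType (msr.{u} M on) n = T₅ :=
  nType_eq_T₅ (msr_limited M on) (Nat.zero_lt_of_lt hV.2) (unboundedAt_a_of_active_V hV)
    (not_separatedAt hV fun f hf => Or.inl (h f hf)) (controlledAt hV h)

theorem nType_msr_T₆ (hV : Active M on .V n) (hG : Active M on .G n)
    (h : ∀ f, Active M on f n → f = .V ∨ f = .G) : nType (msr.{u} M on) n = T₆ :=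
  nType_eq_T₆ (msr_limited M on) (Nat.zero_lt_of_lt hV.2) (unboundedAt_a_of_active_V hV)
    (not_separatedAt hV h) (not_controlledAt_of_active_G hG)

/-- Separation and an unbounded `ψ^a` come from `C` and `V` alone, so the other tags need not be
controlled. -/
theorem nType_msr_T₇ (hC : Active M on .C n) (hV : Active M on .V n) :
    nType (msr.{u} M on) n = T₇ :=
  nType_eq_T₇ (msr_limited M on) (Nat.zero_lt_of_lt hV.2) (unboundedAt_a_of_active_V hV)
    (separatedAt_of_active_C hC)

/-- The arities (minus one) of the predicates for the sequences with `T₃` and `T₄`. -/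
def arityCRV (i j k : ℕ) : Tag → ℕ
  | .C => i
  | .R => i + j
  | _ => i + j + k

/-- The arities (minus one) of the predicates for the sequences with `T₅` and `T₆`. -/
def arityVGC (i j k : ℕ) : Tag → ℕ
  | .V => i
  | .G => i + j
  | _ => i + j + k

theorem dtyp_msr_T₂ : dtyp (msr.{u} (arityCRV 0 0 0) fun _ => False) = rep T₂ :=
  funext fun m => nType_msr_T₂ (Nat.succ_pos m) fun _ hf => hf.1

/-- The term with index `m` concerns `m + 1` input variables, so a tag `f` in use is active there
exactly when `M f ≤ m`. Hence `M f` counts the tables before `f` takes effect, in this and the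
following cases. -/
theorem dtyp_msr_T₂₃ (i : ℕ) :
    dtyp (msr.{u} (arityCRV i 0 0) fun f => f = .C) = prep T₂ i (rep T₃) := by
  funext m
  simp only [prep, rep, dtyp]
  split_ifs with h1
  · refine nType_msr_T₂ (Nat.succ_pos m) ?_
    rintro _ ⟨rfl, hf⟩
    simp only [arityCRV] at hf
    omega
  · exact nType_msr_T₃ ⟨rfl, by simp only [arityCRV]; omega⟩ fun f hf => hf.1

theorem dtyp_msr_T₂₃₄ (i j : ℕ) :
    dtyp (msr.{u} (arityCRV i j 0) fun f => f = .C ∨ f = .R) =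
      prep T₂ i (prep T₃ j (rep T₄)) := by
  funext m
  simp only [prep, rep, dtyp]
  split_ifs with h1 h2
  · refine nType_msr_T₂ (Nat.succ_pos m) ?_
    rintro _ ⟨rfl | rfl, hf⟩ <;> simp only [arityCRV] at hf <;> omega
  · refine nType_msr_T₃ ⟨Or.inl rfl, by simp only [arityCRV]; omega⟩ ?_
    rintro _ ⟨rfl | rfl, hf⟩
    · rfl
    · simp only [arityCRV] at hf
      omega
  · exact nType_msr_T₄ ⟨Or.inr rfl, by simp only [arityCRV]; omega⟩ fun f hf => hf.1

theorem dtyp_msr_T₂₃₄₇ (i j k : ℕ) :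
    dtyp (msr.{u} (arityCRV i j k) fun f => f = .C ∨ f = .R ∨ f = .V) =
      prep T₂ i (prep T₃ j (prep T₄ k (rep T₇))) := by
  funext m
  simp only [prep, rep, dtyp]
  split_ifs with h1 h2 h3
  · refine nType_msr_T₂ (Nat.succ_pos m) ?_
    rintro _ ⟨rfl | rfl | rfl, hf⟩ <;> simp only [arityCRV] at hf <;> omega
  · refine nType_msr_T₃ ⟨Or.inl rfl, by simp only [arityCRV]; omega⟩ ?_
    rintro _ ⟨rfl | rfl | rfl, hf⟩ <;> simp only [arityCRV] at hf
    · rfl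
    · omega
    · omega
  · refine nType_msr_T₄ ⟨Or.inr (Or.inl rfl), by simp only [arityCRV]; omega⟩ ?_
    rintro _ ⟨rfl | rfl | rfl, hf⟩ <;> simp only [arityCRV] at hf
    · exact Or.inl rfl
    · exact Or.inr rfl
    · omega
  · exact nType_msr_T₇ ⟨Or.inl rfl, by simp only [arityCRV]; omega⟩
      ⟨Or.inr (Or.inr rfl), by simp only [arityCRV]; omega⟩

theorem dtyp_msr_T₂₅ (i : ℕ) :
    dtyp (msr.{u} (arityVGC i 0 0) fun f => f = .V) = prep T₂ i (rep T₅) := by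
  funext m
  simp only [prep, rep, dtyp]
  split_ifs with h1
  · refine nType_msr_T₂ (Nat.succ_pos m) ?_
    rintro _ ⟨rfl, hf⟩
    simp only [arityVGC] at hf
    omega
  · exact nType_msr_T₅ ⟨rfl, by simp only [arityVGC]; omega⟩ fun f hf => hf.1

theorem dtyp_msr_T₂₅₆ (i j : ℕ) :
    dtyp (msr.{u} (arityVGC i j 0) fun f => f = .V ∨ f = .G) =
      prep T₂ i (prep T₅ j (rep T₆)) := by
  funext m
  simp only [prep, rep, dtyp]
  split_ifs with h1 h2
  · refine nType_msr_T₂ (Nat.succ_pos m) ?_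
    rintro _ ⟨rfl | rfl, hf⟩ <;> simp only [arityVGC] at hf <;> omega
  · refine nType_msr_T₅ ⟨Or.inl rfl, by simp only [arityVGC]; omega⟩ ?_
    rintro _ ⟨rfl | rfl, hf⟩
    · rfl
    · simp only [arityVGC] at hf
      omega
  · exact nType_msr_T₆ ⟨Or.inl rfl, by simp only [arityVGC]; omega⟩
      ⟨Or.inr rfl, by simp only [arityVGC]; omega⟩ fun f hf => hf.1

theorem dtyp_msr_T₂₅₆₇ (i j k : ℕ) :
    dtyp (msr.{u} (arityVGC i j k) fun f => f = .V ∨ f = .G ∨ f = .C) =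
      prep T₂ i (prep T₅ j (prep T₆ k (rep T₇))) := by
  funext m
  simp only [prep, rep, dtyp]
  split_ifs with h1 h2 h3
  · refine nType_msr_T₂ (Nat.succ_pos m) ?_
    rintro _ ⟨rfl | rfl | rfl, hf⟩ <;> simp only [arityVGC] at hf <;> omega
  · refine nType_msr_T₅ ⟨Or.inl rfl, by simp only [arityVGC]; omega⟩ ?_
    rintro _ ⟨rfl | rfl | rfl, hf⟩ <;> simp only [arityVGC] at hf
    · rfl
    · omega
    · omega
  · refine nType_msr_T₆ ⟨Or.inl rfl, by simp only [arityVGC]; omega⟩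
      ⟨Or.inr (Or.inl rfl), by simp only [arityVGC]; omega⟩ ?_
    rintro _ ⟨rfl | rfl | rfl, hf⟩ <;> simp only [arityVGC] at hf
    · exact Or.inl rfl
    · exact Or.inr rfl
    · omega
  · exact nType_msr_T₇ ⟨Or.inr (Or.inr rfl), by simp only [arityVGC]; omega⟩
      ⟨Or.inl rfl, by simp only [arityVGC]; omega⟩

theorem msr_isWeightedDepth (M : Tag → ℕ) (on : Tag → Prop) :
    (msr.{u} M on).IsWeightedDepth :=
  ⟨wt M on, wt_pos M on, fun _ => rfl⟩

/-- Every sequence from `Δ` is the dynamic type of a model. -/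
theorem exists_dtyp_eq {σ : ℕ → Table} (hσ : σ ∈ Δ) :
    ∃ (M : Tag → ℕ) (on : Tag → Prop), dtyp (msr.{u} M on) = σ := by
  rcases hσ with rfl | ⟨i, rfl⟩ | ⟨i, j, rfl⟩ | ⟨i, j, k, rfl⟩ | ⟨i, rfl⟩ | ⟨i, j, rfl⟩ |
    ⟨i, j, k, rfl⟩
  · exact ⟨_, _, dtyp_msr_T₂⟩
  · exact ⟨_, _, dtyp_msr_T₂₃ i⟩
  · exact ⟨_, _, dtyp_msr_T₂₃₄ i j⟩
  · exact ⟨_, _, dtyp_msr_T₂₃₄₇ i j k⟩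
  · exact ⟨_, _, dtyp_msr_T₂₅ i⟩
  · exact ⟨_, _, dtyp_msr_T₂₅₆ i j⟩
  · exact ⟨_, _, dtyp_msr_T₂₅₆₇ i j k⟩

end Model

end CompTrees

theorem theorem2 :
    (∀ (U : CompTrees.Structure.{u}) (ψ : CompTrees.Measure U), ψ.Limited →
      CompTrees.dtyp ψ ∈ CompTrees.Δ ∧
      ∀ n : ℕ, 1 ≤ n → CompTrees.nType ψ n ≠ CompTrees.T₁) ∧
    (∀ σ ∈ CompTrees.Δ, ∃ (U : CompTrees.Structure.{u}) (ψ : CompTrees.Measure U),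
      ψ.Limited ∧ ψ.IsWeightedDepth ∧ CompTrees.dtyp ψ = σ) := by
  refine ⟨fun U ψ hψ => ⟨CompTrees.dtyp_mem_Δ hψ, fun n hn => CompTrees.nType_ne_T₁ hψ hn⟩,
    fun σ hσ => ?_⟩
  obtain ⟨M, on, h⟩ := CompTrees.Model.exists_dtyp_eq hσ
  exact ⟨_, _, CompTrees.Model.msr_limited M on, CompTrees.Model.msr_isWeightedDepth M on, h⟩
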